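/- A \emph{disc quadrangulation} is a finite connected simple plane graph $Q$ in which the outer face is bounded by a simple closed cycle (the boundary) and every other face is a quadrangle. Vertices on the boundary cycle are called boundary vertices, all other vertices are internal, and $d_Q$ denotes the graph distance in $Q$. \textbf{Theorem.} Let $Q$ be a disc quadrangulation all of whose internal vertices have degree at least $4$. Then the distances between boundary vertices determine $Q$ (among such quadrangulations). That is, if $Q$ and $R$ are disc quadrangulations in which all internal vertices have degree at least $4$, and $\beta$ is a bijection from the boundary vertices of $Q$ to the boundary vertices of $R$ with $d_R(\beta(x),\beta(y))=d_Q(x,y)$ for all boundary vertices $x,y$ of $Q$, then $\beta$ extends to an isomorphism of plane graphs from $Q$ to $R$, i.e. to a graph isomorphism that takes the outer face to the outer face and either preserves the rotation (the cyclic order of the edges) at every vertex or reverses it at every vertex. -/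

import Mathlib

/-- A rotation system on a graph `G`: around each vertex a cyclic order of the darts (oriented
edges) leaving that vertex.  It encodes a cellular embedding of `G` in an oriented closed surface
(when `G` is connected and has an edge) up to orientation-preserving homeomorphism. -/
structure RotationSystem {V : Type*} (G : SimpleGraph V) where
  /-- the next dart around the initial vertex -/
  next : Equiv.Perm G.Dart
  /-- the cycles of `next` are exactly the sets of darts leaving the different vertices -/
  sameCycle_iff : ∀ d e : G.Dart, next.SameCycle d e ↔ d.fst = e.fst

namespace RotationSystem

variable {V : Type*} {G : SimpleGraph V}

/-- The permutation that sends a dart `d` to the dart following it on the boundary walk of the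
face on one fixed side of `d`: traverse `d`, and turn to the next dart at its end. -/
def facePerm (ρ : RotationSystem G) : Equiv.Perm G.Dart :=
  (Function.Involutive.toPerm SimpleGraph.Dart.symm SimpleGraph.Dart.symm_involutive).trans ρ.next

/-- The faces of the embedding: the cycles of `facePerm`. -/
def Face (ρ : RotationSystem G) : Type _ :=
  Quotient (Equiv.Perm.SameCycle.setoid ρ.facePerm)

/-- The face whose boundary walk contains the dart `d`. -/
def faceOf (ρ : RotationSystem G) (d : G.Dart) : ρ.Face :=
  Quotient.mk (Equiv.Perm.SameCycle.setoid ρ.facePerm) d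

/-- The darts on the boundary walk of the face `F`.  Their number is the length of `F`. -/
def faceDarts (ρ : RotationSystem G) (F : ρ.Face) : Set G.Dart :=
  {d | ρ.faceOf d = F}

end RotationSystem

/-- A disc quadrangulation with vertex set `V`: a finite connected plane graph, given by a rotation
system of genus zero (Euler's formula), with a distinguished outer face whose boundary is a simple
closed cycle, and all of whose other faces are quadrangles. -/
structure DiscQuadrangulation (V : Type*) [Finite V] where
  /-- the underlying graph -/
  graph : SimpleGraph V
  /-- the embedding -/
  rot : RotationSystem graph
  connected : graph.Connected
  /-- the embedding is in the sphere: `|V| - |E| + |F| = 2` -/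
  euler : Nat.card V + Nat.card rot.Face = Nat.card graph.edgeSet + 2
  /-- the outer face -/
  outer : rot.Face
  /-- the boundary walk of the outer face visits no vertex twice … -/
  outer_simple : Set.InjOn (fun d : graph.Dart => d.fst) (rot.faceDarts outer)
  /-- … and it is a genuine cycle -/
  outer_length : 3 ≤ (rot.faceDarts outer).ncard
  /-- every internal face is a quadrangle -/
  inner_length : ∀ F : rot.Face, F ≠ outer → (rot.faceDarts F).ncard = 4

namespace DiscQuadrangulation

variable {V W : Type*} [Finite V] [Finite W]

/-- The boundary vertices: those on the boundary cycle of the outer face.  All other vertices are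
internal. -/
def boundary (Q : DiscQuadrangulation V) : Set V :=
  {v | ∃ d ∈ Q.rot.faceDarts Q.outer, d.fst = v}

/-- All internal vertices have degree at least four. -/
def InternalDegreesAtLeastFour (Q : DiscQuadrangulation V) : Prop :=
  ∀ v : V, v ∉ Q.boundary → 4 ≤ (Q.graph.neighborSet v).ncard

/-- The graph isomorphism `f` is induced by an orientation-preserving homeomorphism of the discs:
it respects the rotation at each vertex and the outer face. -/
def IsOrientationPreserving (Q : DiscQuadrangulation V) (R : DiscQuadrangulation W)
    (f : Q.graph ≃g R.graph) : Prop :=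
  (∀ d : Q.graph.Dart,
    f.toHom.mapDart (Q.rot.next d) = R.rot.next (f.toHom.mapDart d)) ∧
  ∀ d : Q.graph.Dart,
    d ∈ Q.rot.faceDarts Q.outer ↔ f.toHom.mapDart d ∈ R.rot.faceDarts R.outer

/-- The graph isomorphism `f` is induced by an orientation-reversing homeomorphism of the discs:
it reverses the rotation at each vertex and respects the outer face, whose boundary is then
traversed in the opposite direction. -/
def IsOrientationReversing (Q : DiscQuadrangulation V) (R : DiscQuadrangulation W)
    (f : Q.graph ≃g R.graph) : Prop :=
  (∀ d : Q.graph.Dart,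
    f.toHom.mapDart (Q.rot.next d) = R.rot.next.symm (f.toHom.mapDart d)) ∧
  ∀ d : Q.graph.Dart,
    d ∈ Q.rot.faceDarts Q.outer ↔ (f.toHom.mapDart d).symm ∈ R.rot.faceDarts R.outer

/-- The graph isomorphism `f` is an isomorphism of plane graphs: it is induced by a homeomorphism
of the discs, which may preserve or reverse the orientation. -/
def IsPlaneIso (Q : DiscQuadrangulation V) (R : DiscQuadrangulation W)
    (f : Q.graph ≃g R.graph) : Prop :=
  Q.IsOrientationPreserving R f ∨ Q.IsOrientationReversing R f

end DiscQuadrangulation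

/-! ### Orthogonal subspaces over a field -/

/-! Passing through every quadrangle from an edge to the opposite edge arranges the edges into
tracks, which are dual curves. The theorem reads the whole crossing pattern of the tracks off the
boundary distances.

The engine is a combinatorial Gauss–Bonnet bound, `four_le_card_turns`: a nonzero closed dual curve
modulo 2 that avoids the outer face has at least four turns, because the enclosed part satisfies `V'
- E' + F' ≥ 1` and its vertices have degree at least 4. Hence a track neither closes up nor crosses
itself (`face_iterate_step_ne`, `not_sameTrack_φ`), two tracks cross at most once
(`face_eq_of_crossing`), and no three cross pairwise (`not_crosses_of_crosses`).

So each track joins two outer edges and has two sides. The distance of two vertices is the number of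
tracks separating them (`card_sep`), and a vertex lies on the side of the nearer end of any edge of
the track (`side_eq_iff_dist_lt`). Boundary distances therefore tell which outer edges belong to one
track, which tracks cross and in which direction. Two tracks crossing a third do not cross each
other, so the sides also give the order of the crossings (`Hits.card_filter_crossers`). Sending the
`i`-th dart of a track to the `i`-th dart of the corresponding track is then the required
isomorphism (`BoundaryMatch.exists_iso`).

This presupposes that the bijection preserves or reverses the boundary cycle. A boundary edge might
a priori go to a chord, but edges between boundary vertices do not cross (`chords_not_crossing`), so
the rest of the boundary would stay on one side of that chord (`map_φ_or`). The reversing case is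
reduced to the mirror image.

Planarity enters through linear algebra over `ZMod 2`: Euler's formula makes every cocycle a
coboundary (`exists_coboundary`), which provides the sides of tracks, the 2-colouring and the inside
of a closed curve. -/

theorem Submodule.finrank_add_finrank_le_of_dotProduct_eq_zero {K ι : Type*} [Field K] [Fintype ι]
    (W₁ W₂ : Submodule K (ι → K)) (h : ∀ x ∈ W₁, ∀ y ∈ W₂, x ⬝ᵥ y = 0) :
    Module.finrank K W₁ + Module.finrank K W₂ ≤ Fintype.card ι := by
  classical
  have h1 := Subspace.finrank_add_finrank_dualAnnihilator_eq W₁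
  have h2 : W₂.map (dotProductEquiv K ι).toLinearMap ≤ W₁.dualAnnihilator := by
    rintro _ ⟨y, hy, rfl⟩
    rw [Submodule.mem_dualAnnihilator]
    intro x hx
    simpa [dotProduct_comm] using h x hx y hy
  have h3 := Submodule.finrank_mono h2
  rw [LinearEquiv.finrank_map_eq (dotProductEquiv K ι) W₂] at h3
  rw [Module.finrank_fintype_fun_eq_card] at h1
  omega

/-- Adjoining `c` to `W₂` keeps it orthogonal to `W₁`, and there is no room for a larger dimension.
-/
theorem Submodule.mem_of_dotProduct_eq_zero_of_card_le {K ι : Type*} [Field K] [Fintype ι]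
    (W₁ W₂ : Submodule K (ι → K)) (h : ∀ x ∈ W₁, ∀ y ∈ W₂, x ⬝ᵥ y = 0)
    (hcard : Fintype.card ι ≤ Module.finrank K W₁ + Module.finrank K W₂)
    (c : ι → K) (hc : ∀ x ∈ W₁, x ⬝ᵥ c = 0) : c ∈ W₂ := by
  have h1 := Submodule.finrank_add_finrank_le_of_dotProduct_eq_zero W₁ (W₂ ⊔ K ∙ c) (by
    intro x hx y hy
    obtain ⟨u, hu, v, hv, rfl⟩ := Submodule.mem_sup.1 hy
    obtain ⟨a, rfl⟩ := Submodule.mem_span_singleton.1 hv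
    simp [dotProduct_add, h x hx u hu, hc x hx])
  have h2 : W₂ = W₂ ⊔ K ∙ c := Submodule.eq_of_le_of_finrank_le le_sup_left (by omega)
  rw [h2]
  exact Submodule.mem_sup_right (Submodule.mem_span_singleton_self c)

theorem LinearMap.card_le_finrank_range_of_injective {K X E : Type*} [Field K] [Fintype X]
    [Fintype E] (f : (X → K) →ₗ[K] (E → K)) (hf : ∀ g, f g = 0 → g = 0) :
    Fintype.card X ≤ Module.finrank K (LinearMap.range f) := by
  rw [LinearMap.finrank_range_of_inj ((injective_iff_map_eq_zero f).2 hf)]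
  simp

/-- The kernel consists of constants, so its dimension is at most one. This serves for functions on
the vertices or faces of a connected plane graph. -/
theorem LinearMap.card_le_finrank_range_add_one {K X E : Type*} [Field K] [Fintype X]
    [Fintype E] (f : (X → K) →ₗ[K] (E → K)) (hf : ∀ g, f g = 0 → ∀ x y, g x = g y) :
    Fintype.card X ≤ Module.finrank K (LinearMap.range f) + 1 := by
  have h1 := LinearMap.finrank_range_add_finrank_ker f
  have h2 : Module.finrank K (LinearMap.ker f) ≤ 1 := by
    refine finrank_le_one_iff.2 ?_
    by_cases h0 : ∀ g ∈ LinearMap.ker f, g = 0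
    · exact ⟨0, fun w => ⟨0, by ext1; simp [h0 w w.2]⟩⟩
    · push Not at h0
      obtain ⟨g, hg, hg0⟩ := h0
      obtain ⟨x, hx⟩ := Function.ne_iff.1 hg0
      refine ⟨⟨g, hg⟩, fun w => ⟨w.1 x / g x, ?_⟩⟩
      ext y
      have e1 := hf g hg x y
      have e2 := hf w.1 w.2 x y
      simp only [SetLike.mk_smul_mk, Pi.smul_apply, smul_eq_mul, Pi.zero_apply] at hx ⊢
      rw [← e1, ← e2, div_mul_cancel₀ _ hx]
  rw [Module.finrank_fintype_fun_eq_card] at h1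
  omega

theorem ZMod.eq_one_of_neZero {a : ZMod 2} (h : a ≠ 0) : a = 1 := by
  revert a; decide

theorem ZMod.eq_of_add_eq_zero_two {a b : ZMod 2} (h : a + b = 0) : a = b := by
  revert a b; decide

/-! ### Darts and faces -/

namespace RotationSystem

variable {V : Type*} {G : SimpleGraph V} (ρ : RotationSystem G)

theorem fst_next (d : G.Dart) : (ρ.next d).fst = d.fst :=
  ((ρ.sameCycle_iff d (ρ.next d)).1 (Equiv.Perm.sameCycle_apply_right.2 (Equiv.Perm.SameCycle.refl _ _))).symm

theorem facePerm_apply (d : G.Dart) : ρ.facePerm d = ρ.next d.symm := rfl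

@[simp] theorem fst_facePerm (d : G.Dart) : (ρ.facePerm d).fst = d.snd := by
  rw [facePerm_apply, fst_next]; rfl

theorem faceOf_eq_iff {d e : G.Dart} :
    ρ.faceOf d = ρ.faceOf e ↔ ρ.facePerm.SameCycle d e :=
  ⟨fun h => Quotient.exact h, fun h => Quotient.sound h⟩

@[simp] theorem faceOf_facePerm (d : G.Dart) : ρ.faceOf (ρ.facePerm d) = ρ.faceOf d :=
  ρ.faceOf_eq_iff.2 (Equiv.Perm.sameCycle_apply_left.2 (Equiv.Perm.SameCycle.refl _ _))

theorem faceOf_surjective (F : ρ.Face) : ∃ d, ρ.faceOf d = F := Quotient.exists_rep F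

instance [Finite V] : Finite G.Dart :=
  Finite.of_injective (fun d => d.toProd) (fun _ _ h => SimpleGraph.Dart.ext _ _ h)

instance [Finite V] : Finite ρ.Face := Quotient.finite _

end RotationSystem

namespace DiscQuadrangulation

section

open scoped Classical

variable {V W : Type*} [Finite V] [Finite W] (Q : DiscQuadrangulation V)

/-- The darts of the underlying graph. -/
abbrev Dart : Type _ := Q.graph.Dart

noncomputable instance : Fintype Q.graph.Dart := Fintype.ofFinite _

noncomputable instance : Fintype Q.rot.Face := Fintype.ofFinite _

/-- The successor of a dart on the boundary walk of its face. -/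
noncomputable abbrev φ : Equiv.Perm Q.Dart := Q.rot.facePerm

/-- The face of a dart. -/
abbrev face (d : Q.Dart) : Q.rot.Face := Q.rot.faceOf d

/-- The darts on the boundary walk of the outer face. -/
def IsOuter (d : Q.Dart) : Prop := Q.face d = Q.outer

variable {Q}

theorem isOuter_iff {d : Q.Dart} : Q.IsOuter d ↔ Q.face d = Q.outer := Iff.rfl

theorem mem_faceDarts_outer {d : Q.Dart} : d ∈ Q.rot.faceDarts Q.outer ↔ Q.IsOuter d := Iff.rfl

@[simp] theorem isOuter_φ {d : Q.Dart} : Q.IsOuter (Q.φ d) ↔ Q.IsOuter d := by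
  simp [IsOuter]

theorem minimalPeriod_φ (d : Q.Dart) :
    Function.minimalPeriod Q.φ d = (Q.rot.faceDarts (Q.face d)).ncard := by
  have h := MulAction.minimalPeriod_eq_card (a := Q.φ) (b := d)
  have h1 : (MulAction.orbit (Subgroup.zpowers Q.φ) d) = Q.rot.faceDarts (Q.face d) := by
    ext e
    change _ ↔ Q.rot.faceOf e = Q.rot.faceOf d
    rw [RotationSystem.faceOf_eq_iff, Equiv.Perm.sameCycle_comm]
    constructor
    · rintro ⟨⟨_, n, rfl⟩, rfl⟩
      exact ⟨n, rfl⟩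
    · rintro ⟨n, rfl⟩
      exact ⟨⟨_, n, rfl⟩, rfl⟩
  have h2 : (fun x : Q.Dart => Q.φ • x) = Q.φ := rfl
  rw [h2] at h
  rw [h, ← h1, ← Nat.card_eq_fintype_card]; rfl

theorem minimalPeriod_φ_of_not_isOuter {d : Q.Dart} (hd : ¬ Q.IsOuter d) :
    Function.minimalPeriod Q.φ d = 4 := by
  rw [minimalPeriod_φ, Q.inner_length _ hd]

theorem φ_four {d : Q.Dart} (hd : ¬ Q.IsOuter d) : Q.φ (Q.φ (Q.φ (Q.φ d))) = d := by
  have h := Function.iterate_minimalPeriod (f := Q.φ) (x := d)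
  rwa [minimalPeriod_φ_of_not_isOuter hd] at h

theorem iterate_φ_ne {d : Q.Dart} (hd : ¬ Q.IsOuter d) {k : ℕ} (h0 : 0 < k) (h4 : k < 4) :
    Q.φ^[k] d ≠ d := by
  have := minimalPeriod_φ_of_not_isOuter hd
  exact Function.not_isPeriodicPt_of_pos_of_lt_minimalPeriod h0.ne' (by omega)

theorem φ_ne {d : Q.Dart} (hd : ¬ Q.IsOuter d) : Q.φ d ≠ d :=
  iterate_φ_ne hd one_pos (by norm_num)

theorem φφ_ne {d : Q.Dart} (hd : ¬ Q.IsOuter d) : Q.φ (Q.φ d) ≠ d :=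
  iterate_φ_ne hd two_pos (by norm_num)

theorem φφφ_ne {d : Q.Dart} (hd : ¬ Q.IsOuter d) : Q.φ (Q.φ (Q.φ d)) ≠ d :=
  iterate_φ_ne hd three_pos (by norm_num)

theorem face_eq_iff {d : Q.Dart} (hd : ¬ Q.IsOuter d) (e : Q.Dart) :
    Q.face e = Q.face d ↔ e = d ∨ e = Q.φ d ∨ e = Q.φ (Q.φ d) ∨ e = Q.φ (Q.φ (Q.φ d)) := by
  constructor
  · intro h
    have h1 : Q.φ.SameCycle d e := Q.rot.faceOf_eq_iff.1 h.symm
    obtain ⟨n, hn⟩ := h1.exists_pow_eq''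
    obtain ⟨-, -, hn⟩ := hn
    have h2 : Q.φ^[n % 4] d = e := by
      rw [← minimalPeriod_φ_of_not_isOuter hd, Function.iterate_mod_minimalPeriod_eq]
      rw [← hn, Equiv.Perm.coe_pow]
    have h3 : n % 4 < 4 := Nat.mod_lt _ (by norm_num)
    generalize n % 4 = m at h2 h3
    interval_cases m <;> simp only [Function.iterate_succ, Function.iterate_zero,
      Function.comp_apply, id] at h2 <;> simp [← h2]
  · rintro (rfl | rfl | rfl | rfl) <;> simp [face]

/-- The sum of a function over the darts of the boundary walk of a quadrangle. -/
noncomputable def squareSum {M : Type*} [AddCommMonoid M] (c : Q.Dart → M) (d : Q.Dart) : M :=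
  c d + c (Q.φ d) + c (Q.φ (Q.φ d)) + c (Q.φ (Q.φ (Q.φ d)))

theorem sum_face_eq_squareSum {M : Type*} [AddCommMonoid M] (c : Q.Dart → M) {d : Q.Dart}
    (hd : ¬ Q.IsOuter d) :
    ∑ e with Q.face e = Q.face d, c e = squareSum c d := by
  have h : (Finset.univ.filter fun e => Q.face e = Q.face d) =
      {d, Q.φ d, Q.φ (Q.φ d), Q.φ (Q.φ (Q.φ d))} := by
    ext e; simp [face_eq_iff hd]
  have h1 := φ_ne hd
  have h2 := φφ_ne hd
  have h3 := φφφ_ne hd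
  rw [h, Finset.sum_insert, Finset.sum_insert, Finset.sum_insert, Finset.sum_singleton, squareSum]
  · abel
  · simpa using h1.symm
  · simpa [eq_comm] using ⟨h1.symm, h2.symm⟩
  · simpa [eq_comm] using ⟨h1.symm, h2.symm, h3.symm⟩

theorem exists_isOuter (Q : DiscQuadrangulation V) : ∃ d, Q.IsOuter d :=
  Q.rot.faceOf_surjective Q.outer

theorem exists_dart_fst (v : V) : ∃ d : Q.Dart, d.fst = v := by
  obtain ⟨d, -⟩ := exists_isOuter Q
  have : Nontrivial V := ⟨d.fst, d.snd, d.adj.ne⟩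
  obtain ⟨w, hw⟩ := Q.connected.preconnected.exists_adj_of_nontrivial v
  exact ⟨⟨(v, w), hw⟩, rfl⟩

theorem outer_fst_injective {d e : Q.Dart} (hd : Q.IsOuter d) (he : Q.IsOuter e)
    (h : d.fst = e.fst) : d = e := Q.outer_simple hd he h

theorem symm_ne (d : Q.Dart) : d.symm ≠ d := SimpleGraph.Dart.symm_ne d

end

end DiscQuadrangulation

/-! ### Cochains modulo 2 and Euler's formula -/

theorem Nat.card_subtype_add_card_filter {α : Type*} [Fintype α] {p q : α → Prop}
    [DecidablePred q] (h : ∀ a, q a ↔ ¬ p a) :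
    Nat.card {a // p a} + (Finset.univ.filter q).card = Nat.card α := by
  classical
  rw [Nat.card_eq_fintype_card, Nat.card_eq_fintype_card, Fintype.card_subtype,
    ← Finset.card_univ, ← Finset.card_filter_add_card_filter_not (s := Finset.univ) p]
  simp [h]

namespace DiscQuadrangulation

section

open scoped Classical

variable {V W : Type*} [Finite V] [Finite W] {Q : DiscQuadrangulation V}

noncomputable instance : Fintype Q.graph.edgeSet := Fintype.ofFinite _

theorem exists_dart_edge (e : Q.graph.edgeSet) : ∃ d : Q.Dart, d.edge = e := by
  obtain ⟨e, he⟩ := e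
  induction e with
  | h u v => exact ⟨⟨(u, v), he⟩, rfl⟩

/-- A chosen dart of an edge. -/
noncomputable def rep (e : Q.graph.edgeSet) : Q.Dart := (exists_dart_edge e).choose

theorem edge_rep (e : Q.graph.edgeSet) : (rep e).edge = e := (exists_dart_edge e).choose_spec

/-- The edge of a dart. -/
def toEdge (d : Q.Dart) : Q.graph.edgeSet := ⟨d.edge, d.edge_mem⟩

theorem rep_toEdge (d : Q.Dart) : rep (toEdge d) = d ∨ rep (toEdge d) = d.symm :=
  (SimpleGraph.dart_edge_eq_iff _ _).1 (edge_rep (toEdge d))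

theorem sum_dart_eq_sum_edge {M : Type*} [AddCommMonoid M] (f : Q.Dart → M) :
    ∑ d, f d = ∑ e : Q.graph.edgeSet, (f (rep e) + f (rep e).symm) := by
  rw [← Finset.sum_fiberwise Finset.univ (toEdge (Q := Q)) f]
  refine Finset.sum_congr rfl fun e _ => ?_
  have h : (Finset.univ.filter fun d => toEdge (Q := Q) d = e) = {rep e, (rep e).symm} := by
    ext d
    simp only [Finset.mem_filter, Finset.mem_univ, true_and, Finset.mem_insert,
      Finset.mem_singleton]
    rw [← SimpleGraph.dart_edge_eq_iff, edge_rep, toEdge, Subtype.ext_iff]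
  rw [h, Finset.sum_pair (symm_ne _).symm]

variable (Q) in
/-- The coboundary of a function on vertices: its sum over the ends of an edge. -/
noncomputable def coboundary : (V → ZMod 2) →ₗ[ZMod 2] (Q.graph.edgeSet → ZMod 2) where
  toFun h e := h (rep e).fst + h (rep e).snd
  map_add' _ _ := by ext; simp; ring
  map_smul' _ _ := by ext; simp; ring

variable (Q) in
/-- The coboundary of a function on faces: its sum over the sides of an edge. -/
noncomputable def dualCoboundary :
    (Q.rot.Face → ZMod 2) →ₗ[ZMod 2] (Q.graph.edgeSet → ZMod 2) where
  toFun g e := g (Q.face (rep e)) + g (Q.face (rep e).symm)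
  map_add' _ _ := by ext; simp; ring
  map_smul' _ _ := by ext; simp; ring

theorem dualCoboundary_dotProduct (g : Q.rot.Face → ZMod 2) (c : Q.Dart → ZMod 2)
    (hc : ∀ d, c d.symm = c d) :
    (Q.dualCoboundary g) ⬝ᵥ (fun e => c (rep e)) = ∑ d, g (Q.face d) * c d := by
  rw [sum_dart_eq_sum_edge]
  refine Finset.sum_congr rfl fun e _ => ?_
  simp only [dualCoboundary, LinearMap.coe_mk, AddHom.coe_mk, hc]
  ring

/-- Along the boundary walk of a face the end of each dart is the start of the next one, so every
vertex value occurs twice and cancels. -/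
theorem dualCoboundary_dotProduct_coboundary (g : Q.rot.Face → ZMod 2) (h : V → ZMod 2) :
    (Q.dualCoboundary g) ⬝ᵥ (Q.coboundary h) = 0 := by
  have h0 := dualCoboundary_dotProduct g (fun d => h d.fst + h d.snd)
    (fun d => by simp [add_comm])
  refine h0.trans ?_
  have h1 : ∑ d, g (Q.face d) * h d.snd = ∑ d : Q.Dart, g (Q.face d) * h d.fst := by
    rw [← Equiv.sum_comp Q.φ (fun d => g (Q.face d) * h d.fst)]
    simp [face]
  simp_rw [mul_add, Finset.sum_add_distrib, h1]
  exact CharTwo.add_self_eq_zero _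

/-- The relation of adjacency inside a set of vertices. -/
def AdjIn (U : Set V) (u v : V) : Prop := u ∈ U ∧ v ∈ U ∧ Q.graph.Adj u v

/-- The dart after `d` in the rotation lies on the face of `d.symm`, so `g` is constant around each
vertex of `U`; connectedness carries the value from vertex to vertex. -/
theorem face_function_const {α : Type*} (U : Set V) (g : Q.rot.Face → α)
    (hg : ∀ d : Q.Dart, d.fst ∈ U → g (Q.face d) = g (Q.face d.symm))
    (x₀ : V) (hU : ∀ v ∈ U, Relation.ReflTransGen (Q.AdjIn U) x₀ v)
    (d e : Q.Dart) (hd : d.fst ∈ U) (he : e.fst ∈ U) : g (Q.face d) = g (Q.face e) := by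
  have key : ∀ d e : Q.Dart, d.fst ∈ U → d.fst = e.fst → g (Q.face d) = g (Q.face e) := by
    intro d e hd hde
    obtain ⟨n, hn⟩ := ((Q.rot.sameCycle_iff d e).2 hde).exists_pow_eq'
    obtain ⟨-, hn⟩ := hn
    clear hde
    induction n generalizing e with
    | zero => simp at hn; rw [hn]
    | succ n ih =>
      rw [pow_succ', Equiv.Perm.mul_apply] at hn
      have h1 : (Q.rot.next.toFun ((Q.rot.next ^ n) d)) = e := hn
      have h2 : ((Q.rot.next ^ n) d).fst = d.fst :=
        ((Q.rot.sameCycle_iff d _).1 ⟨n, rfl⟩).symm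
      rw [ih _ rfl, hg _ (by rw [h2]; exact hd), ← hn]
      have h3 : Q.rot.next ((Q.rot.next ^ n) d) = Q.φ ((Q.rot.next ^ n) d).symm := by
        rw [RotationSystem.facePerm_apply, SimpleGraph.Dart.symm_symm]
      rw [h3]; simp [face]
  have key2 : ∀ v ∈ U, ∀ d e : Q.Dart, d.fst = x₀ → e.fst = v → g (Q.face d) = g (Q.face e) := by
    intro v hv d e hd he
    have hx : x₀ ∈ U := by
      rcases Relation.ReflTransGen.cases_head (hU v hv) with h | ⟨y, h, -⟩
      · rw [h]; exact hv
      · exact h.1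
    have h := hU v hv
    clear hv
    induction h generalizing e with
    | refl => exact key _ _ (hd ▸ hx) (hd.trans he.symm)
    | @tail u w _ huw ih =>
      rw [ih ⟨(u, w), huw.2.2⟩ rfl, hg _ huw.1]
      exact key _ _ huw.2.1 he.symm
  obtain ⟨d₀, hd₀⟩ := exists_dart_fst (Q := Q) x₀
  rw [← key2 _ hd d₀ d hd₀ rfl, ← key2 _ he d₀ e hd₀ rfl]

/-- A symmetric function on darts with vanishing sums around the inner faces is a coboundary. -/
theorem exists_coboundary (c : Q.Dart → ZMod 2) (hs : ∀ d, c d.symm = c d)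
    (hc : ∀ d, ¬ Q.IsOuter d → squareSum c d = 0) :
    ∃ h : V → ZMod 2, ∀ d : Q.Dart, h d.snd = h d.fst + c d := by
  have := Fintype.ofFinite V
  have hface : ∀ F : Q.rot.Face, ∑ d with Q.face d = F, c d = 0 := by
    have h1 : ∀ F : Q.rot.Face, F ≠ Q.outer → ∑ d with Q.face d = F, c d = 0 := by
      intro F hF
      obtain ⟨d, rfl⟩ := Q.rot.faceOf_surjective F
      rw [sum_face_eq_squareSum c hF, hc d hF]
    intro F
    by_cases hF : F = Q.outer
    -- Every edge is counted from both of its sides, so all face sums together vanish modulo 2, and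
    -- with the inner ones the outer one does.
    · have h2 : ∑ F : Q.rot.Face, ∑ d with Q.face d = F, c d = 0 := by
        rw [Finset.sum_fiberwise Finset.univ Q.face c, sum_dart_eq_sum_edge]
        simp [hs, CharTwo.add_self_eq_zero]
      rw [Finset.sum_eq_single Q.outer (fun F _ hF => h1 F hF) (by simp)] at h2
      rw [hF, h2]
    · exact h1 F hF
  -- Face boundaries and cuts are orthogonal, of ranks at least `F - 1` and `V - 1`. By Euler's
  -- formula these add up to `E`, so whatever is orthogonal to all faces is a cut.
  have hmem : (fun e => c (rep e)) ∈ LinearMap.range Q.coboundary := by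
    refine Submodule.mem_of_dotProduct_eq_zero_of_card_le (LinearMap.range Q.dualCoboundary) _
      ?_ ?_ _ ?_
    · rintro _ ⟨g, rfl⟩ _ ⟨h, rfl⟩
      exact dualCoboundary_dotProduct_coboundary g h
    · have h1 := LinearMap.card_le_finrank_range_add_one Q.coboundary (by
        intro h hh
        have hadj : ∀ u v, Q.graph.Adj u v → h u = h v := by
          intro u v huv
          have h1 := congrFun hh (toEdge ⟨(u, v), huv⟩)
          have h2 : h _ = h _ := ZMod.eq_of_add_eq_zero_two h1
          rcases rep_toEdge (Q := Q) ⟨(u, v), huv⟩ with h3 | h3 <;> rw [h3] at h2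
          · exact h2
          · exact h2.symm
        intro x y
        have := (SimpleGraph.reachable_iff_reflTransGen x y).1 (Q.connected.preconnected x y)
        induction this with
        | refl => rfl
        | tail _ h1 ih => exact ih.trans (hadj _ _ h1))
      have h2 := LinearMap.card_le_finrank_range_add_one Q.dualCoboundary (by
        intro g hg F F'
        have hside : ∀ d : Q.Dart, g (Q.face d) = g (Q.face d.symm) := by
          intro d
          have h1 := congrFun hg (toEdge d)
          have h2 : g _ = g _ := ZMod.eq_of_add_eq_zero_two h1
          rcases rep_toEdge d with h3 | h3 <;> rw [h3] at h2
          · exact h2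
          · simpa using h2.symm
        obtain ⟨d, rfl⟩ := Q.rot.faceOf_surjective F
        obtain ⟨e, rfl⟩ := Q.rot.faceOf_surjective F'
        refine face_function_const Set.univ g (fun d _ => hside d) d.fst (fun v hv => ?_) d e
          trivial trivial
        have := (SimpleGraph.reachable_iff_reflTransGen d.fst v).1
          (Q.connected.preconnected d.fst v)
        clear hv
        induction this with
        | refl => exact .refl
        | tail _ h1 ih => exact ih.tail ⟨trivial, trivial, h1⟩)
      have h3 := Q.euler
      rw [Nat.card_eq_fintype_card, Nat.card_eq_fintype_card, Nat.card_eq_fintype_card] at h3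
      omega
    · rintro _ ⟨g, rfl⟩
      rw [dualCoboundary_dotProduct g c hs, ← Finset.sum_fiberwise Finset.univ Q.face]
      refine Finset.sum_eq_zero fun F _ => ?_
      have : ∀ d ∈ Finset.univ.filter (fun d => Q.face d = F),
          g (Q.face d) * c d = g F * c d := by
        intro d hd
        rw [(Finset.mem_filter.1 hd).2]
      rw [Finset.sum_congr rfl this, ← Finset.mul_sum, hface, mul_zero]
  obtain ⟨h, hh⟩ := hmem
  refine ⟨h, fun d => ?_⟩
  have h1 : h _ + h _ = c _ := congrFun hh (toEdge d)
  rcases rep_toEdge d with h3 | h3 <;> rw [h3] at h1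
  · rw [← h1, ← add_assoc, CharTwo.add_self_eq_zero, zero_add]
  · rw [hs] at h1
    rw [← h1]
    simp only [SimpleGraph.Dart.symm_toProd, Prod.fst_swap, Prod.snd_swap]
    rw [add_left_comm, CharTwo.add_self_eq_zero, add_zero]

theorem two_mul_card_filter_rep (P : Q.Dart → Prop) [DecidablePred P] (hP : ∀ d, P d.symm ↔ P d) :
    2 * (Finset.univ.filter fun e : Q.graph.edgeSet => P (rep e)).card =
      (Finset.univ.filter P).card := by
  rw [Finset.card_filter, Finset.card_filter, sum_dart_eq_sum_edge, Finset.mul_sum]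
  refine Finset.sum_congr rfl fun e _ => ?_
  simp only [hP]
  split_ifs <;> rfl

theorem card_filter_face (P : Q.rot.Face → Prop) [DecidablePred P] (hP : ¬ P Q.outer) :
    (Finset.univ.filter fun d => P (Q.face d)).card = 4 * (Finset.univ.filter P).card := by
  rw [Finset.card_filter, Finset.card_filter, ← Finset.sum_fiberwise Finset.univ Q.face,
    Finset.mul_sum]
  refine Finset.sum_congr rfl fun F _ => ?_
  by_cases hF : P F
  · have hne : F ≠ Q.outer := by rintro rfl; exact hP hF
    have h1 := Q.inner_length F hne
    rw [Set.ncard_eq_toFinset_card', ] at h1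
    rw [if_pos hF, mul_one, ← h1, Finset.card_eq_sum_ones]
    refine Finset.sum_congr ?_ fun d hd => ?_
    · ext d
      rw [Finset.mem_filter, Set.mem_toFinset]
      simp [RotationSystem.faceDarts]
    · have : Q.face d = F := (Set.mem_toFinset (s := Q.rot.faceDarts F)).1 hd
      simp [this, hF]
  · rw [if_neg hF, mul_zero]
    refine Finset.sum_eq_zero fun d hd => ?_
    have : Q.face d = F := by simpa using hd
    simp [this, hF]

/-- Euler's inequality for a connected set of vertices, not all, and the edges and faces that
touch it. -/
theorem card_add_card_le_of_connected (U : Set V) (hne : ∃ v, v ∉ U) (x₀ : V)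
    (hU : ∀ v ∈ U, Relation.ReflTransGen (Q.AdjIn U) x₀ v) :
    Nat.card U + Nat.card {F : Q.rot.Face // ∃ d, Q.face d = F ∧ d.fst ∈ U} ≤
      Nat.card {e : Q.graph.edgeSet // (rep e).fst ∈ U ∨ (rep e).snd ∈ U} + 1 := by
  have := Fintype.ofFinite V
  set F' := {F : Q.rot.Face // ∃ d, Q.face d = F ∧ d.fst ∈ U}
  set E' := {e : Q.graph.edgeSet // (rep e).fst ∈ U ∨ (rep e).snd ∈ U}
  rw [Nat.card_eq_fintype_card, Nat.card_eq_fintype_card, Nat.card_eq_fintype_card]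
  let res : (Q.graph.edgeSet → ZMod 2) →ₗ[ZMod 2] (E' → ZMod 2) :=
    LinearMap.funLeft (ZMod 2) (ZMod 2) (fun e : E' => e.1)
  let extV : (U → ZMod 2) →ₗ[ZMod 2] (V → ZMod 2) :=
    Function.ExtendByZero.linearMap (ZMod 2) (fun v : U => v.1)
  let extF : (F' → ZMod 2) →ₗ[ZMod 2] (Q.rot.Face → ZMod 2) :=
    Function.ExtendByZero.linearMap (ZMod 2) (fun v : F' => v.1)
  have extV_mem : ∀ h (v : U), extV h v.1 = h v := fun h v =>
    Subtype.val_injective.extend_apply h 0 v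
  have extV_notMem : ∀ h v, v ∉ U → extV h v = 0 := fun h v hv =>
    Function.extend_apply' _ _ _ (by rintro ⟨a, rfl⟩; exact hv a.2)
  have extF_mem : ∀ g (v : F'), extF g v.1 = g v := fun h v =>
    Subtype.val_injective.extend_apply h 0 v
  -- No constants survive here: a function extended by zero with zero coboundary is constant and
  -- vanishes at a vertex outside `U`.
  have h1 := LinearMap.card_le_finrank_range_of_injective (res ∘ₗ Q.coboundary ∘ₗ extV) (by
    intro h hh
    have hadj : ∀ u v, Q.graph.Adj u v → extV h u = extV h v := by
      intro u v huv
      by_cases ht : u ∈ U ∨ v ∈ U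
      · have hmem : (rep (toEdge (Q := Q) ⟨(u, v), huv⟩)).fst ∈ U ∨
            (rep (toEdge (Q := Q) ⟨(u, v), huv⟩)).snd ∈ U := by
          rcases rep_toEdge (Q := Q) ⟨(u, v), huv⟩ with h3 | h3 <;> rw [h3]
          · exact ht
          · exact ht.symm
        have h1 := congrFun hh ⟨toEdge ⟨(u, v), huv⟩, hmem⟩
        have h2 : extV h _ = extV h _ := ZMod.eq_of_add_eq_zero_two h1
        rcases rep_toEdge (Q := Q) ⟨(u, v), huv⟩ with h3 | h3
        · simp only at h2; rw [h3] at h2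
          exact h2
        · simp only at h2; rw [h3] at h2
          exact h2.symm
      · push Not at ht
        rw [extV_notMem h u ht.1, extV_notMem h v ht.2]
    obtain ⟨w, hw⟩ := hne
    ext v
    have h3 : ∀ u, extV h w = extV h u := by
      intro u
      have := (SimpleGraph.reachable_iff_reflTransGen w u).1 (Q.connected.preconnected w u)
      induction this with
      | refl => rfl
      | tail _ h1 ih => exact ih.trans (hadj _ _ h1)
    rw [← extV_mem h v, ← h3 v.1, extV_notMem h w hw]; rfl)
  have h2 := LinearMap.card_le_finrank_range_add_one (res ∘ₗ Q.dualCoboundary ∘ₗ extF) (by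
    intro g hg
    rintro ⟨F₁, d, rfl, hd⟩ ⟨F₂, e, rfl, he⟩
    rw [← extF_mem g, ← extF_mem g]
    refine face_function_const U (extF g) (fun d hd => ?_) x₀ hU d e hd he
    have hmem : (rep (toEdge d)).fst ∈ U ∨ (rep (toEdge d)).snd ∈ U := by
      rcases rep_toEdge d with h3 | h3 <;> rw [h3]
      · exact Or.inl hd
      · exact Or.inr hd
    have h1 := congrFun hg ⟨toEdge d, hmem⟩
    have h2 : extF g _ = extF g _ := ZMod.eq_of_add_eq_zero_two h1
    rcases rep_toEdge d with h3 | h3 <;> simp only at h2 <;> rw [h3] at h2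
    · exact h2
    · simpa using h2.symm)
  have h3 := Submodule.finrank_add_finrank_le_of_dotProduct_eq_zero
    (LinearMap.range (res ∘ₗ Q.dualCoboundary ∘ₗ extF))
    (LinearMap.range (res ∘ₗ Q.coboundary ∘ₗ extV)) (by
    rintro _ ⟨g, rfl⟩ _ ⟨h, rfl⟩
    rw [← dualCoboundary_dotProduct_coboundary (extF g) (extV h)]
    simp only [dotProduct]
    -- Edges that miss `U` contribute nothing, since the extended vertex function vanishes at both
    -- ends; the restricted product equals the full one.
    rw [← Finset.sum_subset (Finset.subset_univ
      (Finset.univ.filter fun e : Q.graph.edgeSet => (rep e).fst ∈ U ∨ (rep e).snd ∈ U)) (by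
        intro e _ he
        simp only [Finset.mem_filter, Finset.mem_univ, true_and, not_or] at he
        have : Q.coboundary (extV h) e = 0 := by
          change extV h _ + extV h _ = 0
          rw [extV_notMem h _ he.1, extV_notMem h _ he.2, add_zero]
        rw [this, mul_zero])]
    exact (Finset.sum_subtype (p := fun e : Q.graph.edgeSet => (rep e).fst ∈ U ∨ (rep e).snd ∈ U)
      _ (by simp) (fun e => Q.dualCoboundary (extF g) e * Q.coboundary (extV h) e)).symm)
  omega

/-- Euler's inequality for the complement of a connected set of vertices that contains the
boundary. -/
theorem four_add_le_of_connected (U : Set V) (hne : ∃ v, v ∉ U) (x₀ : V)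
    (hU : ∀ v ∈ U, Relation.ReflTransGen (Q.AdjIn U) x₀ v)
    (hout : ∀ d, Q.IsOuter d → d.fst ∈ U) :
    4 + 2 * (Finset.univ.filter fun d : Q.Dart => d.fst ∉ U ∧ d.snd ∉ U).card ≤
      4 * Uᶜ.ncard + (Finset.univ.filter fun d : Q.Dart =>
        ∀ e, Q.face e = Q.face d → e.fst ∉ U).card := by
  have := Fintype.ofFinite V
  -- Subtracted from Euler's formula, this gives `V' - E' + F' ≥ 1` for the vertices, edges and
  -- faces wholly outside `U`. The two dart counts are `2 E'` and `4 F'`.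
  have h1 := card_add_card_le_of_connected U hne x₀ hU
  have h2 := two_mul_card_filter_rep (Q := Q) (fun d => d.fst ∉ U ∧ d.snd ∉ U)
    (fun d => by simp [and_comm])
  have h3 : (Finset.univ.filter fun d : Q.Dart => ∀ e, Q.face e = Q.face d → e.fst ∉ U).card =
      4 * (Finset.univ.filter fun F : Q.rot.Face => ∀ e, Q.face e = F → e.fst ∉ U).card := by
    convert card_filter_face (Q := Q) (fun F => ∀ e, Q.face e = F → e.fst ∉ U) (by
      intro h
      obtain ⟨d, hd⟩ := Q.exists_isOuter
      exact h d hd (hout d hd))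
  have h4 := Q.euler
  have h5 : Nat.card U + Uᶜ.ncard = Nat.card V := by
    rw [← Set.ncard_add_ncard_compl U]; rfl
  have h6 : Nat.card {F : Q.rot.Face // ∃ d, Q.face d = F ∧ d.fst ∈ U} +
      (Finset.univ.filter fun F : Q.rot.Face => ∀ e, Q.face e = F → e.fst ∉ U).card =
        Nat.card Q.rot.Face := by
    exact Nat.card_subtype_add_card_filter (by simp)
  have h7 : Nat.card {e : Q.graph.edgeSet // (rep e).fst ∈ U ∨ (rep e).snd ∈ U} +
      (Finset.univ.filter fun e : Q.graph.edgeSet => (rep e).fst ∉ U ∧ (rep e).snd ∉ U).card =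
        Nat.card Q.graph.edgeSet := by
    exact Nat.card_subtype_add_card_filter (by simp)
  omega

end

end DiscQuadrangulation

/-! ### Combinatorial Gauss–Bonnet: closed dual curves have four turns -/

namespace DiscQuadrangulation

section

open scoped Classical

variable {V W : Type*} [Finite V] [Finite W] {Q : DiscQuadrangulation V}

theorem card_filter_fst_eq (v : V) :
    (Finset.univ.filter fun d : Q.Dart => d.fst = v).card = (Q.graph.neighborSet v).ncard := by
  rw [← Nat.card_coe_set_eq, ← Fintype.card_subtype, ← Nat.card_eq_fintype_card]
  refine Nat.card_congr ⟨fun d => ⟨d.1.snd, ?_⟩, fun w => ⟨⟨(v, w.1), w.2⟩, rfl⟩, ?_, ?_⟩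
  · have := d.1.adj
    rw [d.2] at this
    exact this
  · rintro ⟨d, rfl⟩; rfl
  · rintro ⟨w, hw⟩; rfl

theorem four_mul_ncard_le (hQ : Q.InternalDegreesAtLeastFour) (U : Set V)
    (hU : ∀ d, Q.IsOuter d → d.fst ∈ U) :
    4 * Uᶜ.ncard ≤ (Finset.univ.filter fun d : Q.Dart => d.fst ∉ U).card := by
  have := Fintype.ofFinite V
  rw [Set.ncard_eq_toFinset_card', Finset.card_eq_sum_card_fiberwise
    (f := fun d : Q.Dart => d.fst) (t := Uᶜ.toFinset) (by intro d hd; simpa using hd), mul_comm,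
    ← smul_eq_mul]
  refine Finset.card_nsmul_le_sum _ _ _ fun v hv => ?_
  have hv' : v ∉ U := by simpa using hv
  rw [Finset.filter_filter, Finset.filter_congr (q := fun d => d.fst = v)
    (by intro d _; constructor
        · exact fun h => h.2
        · rintro rfl; exact ⟨hv', rfl⟩), card_filter_fst_eq]
  refine hQ v ?_
  rintro ⟨d, hd, rfl⟩
  exact hv' (hU d hd)

theorem exists_pow_φ_of_isOuter {d e : Q.Dart} (hd : Q.IsOuter d) (he : Q.IsOuter e) :
    ∃ n : ℕ, (Q.φ ^ n) d = e := by
  have h : Q.φ.SameCycle d e := Q.rot.faceOf_eq_iff.1 (hd.trans he.symm)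
  obtain ⟨n, -, hn⟩ := h.exists_pow_eq'
  exact ⟨n, hn⟩

/-- The local inequality for one quadrangle: `pᵢ` means that a corner is enclosed, `cᵢ` that the
curve crosses the side from corner `i` to the next. An enclosed corner without enclosed neighbours
is paid for by the turn around it, and an enclosed side pays for its two ends. -/
theorem square_turn_bound (p₀ p₁ p₂ p₃ c₀ c₁ c₂ c₃ : Prop) (h₀ : (p₀ ↔ ¬ p₁) → c₀)
    (h₁ : (p₁ ↔ ¬ p₂) → c₁) (h₂ : (p₂ ↔ ¬ p₃) → c₂) (h₃ : (p₃ ↔ ¬ p₀) → c₃) :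
    ((if p₀ then 1 else 0) + (if p₁ then 1 else 0) + (if p₂ then 1 else 0) +
      (if p₃ then 1 else 0) : ℤ) + 4 * (if p₀ ∧ p₁ ∧ p₂ ∧ p₃ then 1 else 0) ≤
    2 * ((if p₀ ∧ p₁ then 1 else 0) + (if p₁ ∧ p₂ then 1 else 0) + (if p₂ ∧ p₃ then 1 else 0) +
      (if p₃ ∧ p₀ then 1 else 0)) +
    ((if c₀ ∧ c₁ then 1 else 0) + (if c₁ ∧ c₂ then 1 else 0) + (if c₂ ∧ c₃ then 1 else 0) +
      (if c₃ ∧ c₀ then 1 else 0)) := by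
  by_cases p₀ <;> by_cases p₁ <;> by_cases p₂ <;> by_cases p₃ <;> simp_all <;> split_ifs <;> simp

theorem sum_rotate (f : Q.Dart → ℤ) :
    ∑ d, (f d + f (Q.φ d) + f (Q.φ (Q.φ d)) + f (Q.φ (Q.φ (Q.φ d)))) = 4 * ∑ d, f d := by
  have h1 : ∀ g : Q.Dart → ℤ, ∑ d, g (Q.φ d) = ∑ d, g d := fun g => Equiv.sum_comp Q.φ g
  simp_rw [Finset.sum_add_distrib]
  rw [h1 (fun d => f (Q.φ (Q.φ d))), h1 (fun d => f (Q.φ d)), h1 f]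
  ring

/-- The combinatorial Gauss–Bonnet argument: a nonzero closed dual curve in the interior of the
disc has at least four turns. -/
theorem four_le_card_turns (hQ : Q.InternalDegreesAtLeastFour) (c : Q.Dart → ZMod 2)
    (hs : ∀ d, c d.symm = c d) (hout : ∀ d, Q.IsOuter d → c d = 0)
    (hc : ∀ d, ¬ Q.IsOuter d → squareSum c d = 0) (hne : ∃ d, c d ≠ 0) :
    4 ≤ (Finset.univ.filter fun d : Q.Dart => c d ≠ 0 ∧ c (Q.φ d) ≠ 0).card := by
  obtain ⟨h, hh⟩ := exists_coboundary c hs hc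
  obtain ⟨o, ho⟩ := Q.exists_isOuter
  set R : V → V → Prop := fun u v => ∃ d : Q.Dart, d.fst = u ∧ d.snd = v ∧ c d = 0 with hR
  -- `U` is reachable from the boundary without crossing the curve; its complement is the enclosed
  -- part.
  set U : Set V := {v | Relation.ReflTransGen R o.fst v} with hUdef
  have hstep : ∀ d : Q.Dart, d.fst ∈ U → c d = 0 → d.snd ∈ U := fun d hd hcd =>
    Relation.ReflTransGen.tail hd ⟨d, rfl, rfl, hcd⟩
  have hcut : ∀ d : Q.Dart, (d.fst ∉ U ↔ ¬ d.snd ∉ U) → c d ≠ 0 := by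
    intro d hd hcd
    by_cases h1 : d.fst ∈ U
    · exact (not_congr hd).1 (not_not.2 h1) (not_not.2 (hstep d h1 hcd))
    · exact h1 (hstep d.symm (by simpa using hd.1 h1) (by rw [hs, hcd]))
  have hconst : ∀ v ∈ U, h v = h o.fst := by
    intro v hv
    induction hv with
    | refl => rfl
    | tail _ h2 ih =>
      obtain ⟨d, rfl, rfl, hd⟩ := h2
      rw [hh, hd, add_zero, ih]
  have hconn : ∀ v ∈ U, Relation.ReflTransGen (Q.AdjIn U) o.fst v := by
    intro v hv
    induction hv with
    | refl => exact .refl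
    | @tail u w h1 h2 ih =>
      have hw : w ∈ U := Relation.ReflTransGen.tail h1 h2
      obtain ⟨d, rfl, rfl, hd⟩ := h2
      exact ih.tail ⟨h1, hw, d.adj⟩
  have houtU : ∀ d, Q.IsOuter d → d.fst ∈ U := by
    intro d hd
    obtain ⟨n, rfl⟩ := exists_pow_φ_of_isOuter ho hd
    clear hd
    suffices Q.IsOuter ((Q.φ ^ n) o) ∧ ((Q.φ ^ n) o).fst ∈ U from this.2
    induction n with
    | zero => exact ⟨ho, .refl⟩
    | succ n ih =>
      rw [pow_succ', Equiv.Perm.mul_apply]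
      exact ⟨isOuter_φ.2 ih.1, by rw [RotationSystem.fst_facePerm]; exact hstep _ ih.2 (hout _ ih.1)⟩
  -- The potential `h` is constant on `U`; if `U` were everything, the curve would be zero.
  have hneU : ∃ v, v ∉ U := by
    obtain ⟨d, hd⟩ := hne
    by_contra hcon
    push Not at hcon
    have := hh d
    rw [hconst d.fst (hcon _), hconst d.snd (hcon _)] at this
    exact hd (left_eq_add.1 this)
  have key := four_add_le_of_connected U hneU o.fst hconn houtU
  have hdeg := four_mul_ncard_le hQ U houtU
  -- Euler gives `4 + 2 ∑ B ≤ 4 |Uᶜ| + ∑ X`, the degrees give `4 |Uᶜ| ≤ ∑ A`, and the quadrangles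
  -- give `∑ A + ∑ X ≤ 2 ∑ B + ∑ T`. Together, `4 ≤ ∑ T`.
  obtain ⟨A, hA⟩ : ∃ A : Q.Dart → ℤ, ∀ d, A d = if d.fst ∉ U then 1 else 0 := ⟨_, fun _ => rfl⟩
  obtain ⟨B, hB⟩ : ∃ B : Q.Dart → ℤ, ∀ d, B d = if d.fst ∉ U ∧ d.snd ∉ U then 1 else 0 :=
    ⟨_, fun _ => rfl⟩
  obtain ⟨X, hX⟩ : ∃ X : Q.Dart → ℤ, ∀ d, X d =
    if ∀ e, Q.face e = Q.face d → e.fst ∉ U then 1 else 0 := ⟨_, fun _ => rfl⟩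
  obtain ⟨T, hT⟩ : ∃ T : Q.Dart → ℤ, ∀ d, T d = if c d ≠ 0 ∧ c (Q.φ d) ≠ 0 then 1 else 0 :=
    ⟨_, fun _ => rfl⟩
  have e1 : ((Finset.univ.filter fun d : Q.Dart => d.fst ∉ U).card : ℤ) = ∑ d, A d := by
    simp_rw [hA, Finset.sum_boole]
  have e2 : ((Finset.univ.filter fun d : Q.Dart => d.fst ∉ U ∧ d.snd ∉ U).card : ℤ) =
      ∑ d, B d := by simp_rw [hB, Finset.sum_boole]
  have e3 : ((Finset.univ.filter fun d : Q.Dart =>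
      ∀ e, Q.face e = Q.face d → e.fst ∉ U).card : ℤ) = ∑ d, X d := by
    simp_rw [hX, Finset.sum_boole]
  have e4 : ((Finset.univ.filter fun d : Q.Dart => c d ≠ 0 ∧ c (Q.φ d) ≠ 0).card : ℤ) =
      ∑ d, T d := by simp_rw [hT, Finset.sum_boole]
  have hpt : ∀ d, (A d + A (Q.φ d) + A (Q.φ (Q.φ d)) + A (Q.φ (Q.φ (Q.φ d)))) + 4 * X d ≤
      2 * (B d + B (Q.φ d) + B (Q.φ (Q.φ d)) + B (Q.φ (Q.φ (Q.φ d)))) +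
      (T d + T (Q.φ d) + T (Q.φ (Q.φ d)) + T (Q.φ (Q.φ (Q.φ d)))) := by
    intro d
    simp only [hA, hB, hX, hT]
    by_cases hd : Q.IsOuter d
    · have h0 := houtU d hd
      have h1 := houtU _ (isOuter_φ.2 hd)
      have h2 := houtU _ (isOuter_φ.2 (isOuter_φ.2 hd))
      have h3 := houtU _ (isOuter_φ.2 (isOuter_φ.2 (isOuter_φ.2 hd)))
      have h4 : ¬ ∀ e, Q.face e = Q.face d → e.fst ∉ U := fun h => h d rfl h0
      simp only [h0, h1, h2, h3, h4, hout d hd, hout _ (isOuter_φ.2 hd),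
        hout _ (isOuter_φ.2 (isOuter_φ.2 hd)), hout _ (isOuter_φ.2 (isOuter_φ.2 (isOuter_φ.2 hd)))]
      simp
    · have hall : (∀ e, Q.face e = Q.face d → e.fst ∉ U) ↔ (d.fst ∉ U ∧ (Q.φ d).fst ∉ U ∧
          (Q.φ (Q.φ d)).fst ∉ U ∧ (Q.φ (Q.φ (Q.φ d))).fst ∉ U) := by
        simp only [face_eq_iff hd]
        constructor
        · exact fun h => ⟨h _ (by simp), h _ (by simp), h _ (by simp), h _ (by simp)⟩
        · rintro ⟨h0, h1, h2, h3⟩ e (rfl | rfl | rfl | rfl) <;> assumption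
      have hφ : (Q.φ (Q.φ (Q.φ d))).snd = d.fst := by
        rw [← RotationSystem.fst_facePerm, φ_four hd]
      have := square_turn_bound (d.fst ∉ U) ((Q.φ d).fst ∉ U) ((Q.φ (Q.φ d)).fst ∉ U)
        ((Q.φ (Q.φ (Q.φ d))).fst ∉ U) (c d ≠ 0) (c (Q.φ d) ≠ 0) (c (Q.φ (Q.φ d)) ≠ 0)
        (c (Q.φ (Q.φ (Q.φ d))) ≠ 0) (by rw [RotationSystem.fst_facePerm]; exact hcut _)
        (by rw [RotationSystem.fst_facePerm (d := Q.φ d)]; exact hcut _)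
        (by rw [RotationSystem.fst_facePerm (d := Q.φ (Q.φ d))]; exact hcut _)
        (by rw [← hφ]; exact hcut _)
      simp only [hall, φ_four hd, hφ]
      simp only [RotationSystem.fst_facePerm] at this ⊢
      convert this
  have hsum := Finset.sum_le_sum (s := (Finset.univ : Finset Q.Dart)) fun d _ => hpt d
  rw [Finset.sum_add_distrib, ← Finset.mul_sum, sum_rotate, Finset.sum_add_distrib,
    ← Finset.mul_sum, sum_rotate, sum_rotate, ← e1, ← e2, ← e3, ← e4] at hsum
  omega

/-- A closed dual curve turns in at least four faces. -/
theorem four_le_card_turnFaces (hQ : Q.InternalDegreesAtLeastFour) (c : Q.Dart → ZMod 2)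
    (hs : ∀ d, c d.symm = c d) (hout : ∀ d, Q.IsOuter d → c d = 0)
    (hc : ∀ d, ¬ Q.IsOuter d → squareSum c d = 0) (hne : ∃ d, c d ≠ 0)
    (hfull : ∀ d, ¬ Q.IsOuter d → c d = 0 ∨ c (Q.φ d) = 0 ∨ c (Q.φ (Q.φ d)) = 0)
    (T : Finset Q.rot.Face) (hT : ∀ d, c d ≠ 0 → c (Q.φ d) ≠ 0 → Q.face d ∈ T) :
    4 ≤ T.card := by
  refine (four_le_card_turns hQ c hs hout hc hne).trans ?_
  -- By `hfull`, applied from each corner, the curve crosses at most two sides of a quadrangle and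
  -- so turns at most once in it.
  refine Finset.card_le_card_of_injOn Q.face (fun d hd => ?_) fun d hd e he hde => ?_
  · have := (Finset.mem_filter.1 hd).2
    exact hT d this.1 this.2
  · have h1 := (Finset.mem_filter.1 hd).2
    have h2 := (Finset.mem_filter.1 he).2
    have hd' : ¬ Q.IsOuter d := fun h => h1.1 (hout d h)
    have h3 := hfull d hd'
    have h4 := hfull _ (isOuter_φ.not.2 (isOuter_φ.not.2 hd'))
    have h5 := hfull _ (isOuter_φ.not.2 (isOuter_φ.not.2 (isOuter_φ.not.2 hd')))
    rw [φ_four hd'] at h4 h5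
    rcases (face_eq_iff hd' e).1 hde.symm with rfl | rfl | rfl | rfl
    · rfl
    · simp_all
    · simp_all
    · rw [φ_four hd'] at h2
      simp_all

end

end DiscQuadrangulation

namespace DiscQuadrangulation

section

open scoped Classical

variable {V W : Type*} [Finite V] [Finite W] {Q : DiscQuadrangulation V}

/-! ### Tracks -/

/-- The dart opposite to an inner dart in its quadrangle; outer darts are fixed. -/
noncomputable def oppFun (d : Q.Dart) : Q.Dart := if Q.IsOuter d then d else Q.φ (Q.φ d)

theorem oppFun_involutive : Function.Involutive (oppFun (Q := Q)) := by
  intro d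
  unfold oppFun
  by_cases h : Q.IsOuter d
  · simp [h]
  · rw [if_neg h, if_neg (isOuter_φ.not.2 (isOuter_φ.not.2 h)), φ_four h]

variable (Q) in
/-- The involution that exchanges opposite darts of each quadrangle. -/
noncomputable def opp : Equiv.Perm Q.Dart := oppFun_involutive.toPerm _

variable (Q) in
/-- One step along a track: cross the quadrangle of a dart and pass to the next quadrangle. -/
noncomputable def step : Equiv.Perm Q.Dart :=
  Q.opp.trans (SimpleGraph.Dart.symm_involutive.toPerm _)

theorem opp_of_isOuter {d : Q.Dart} (h : Q.IsOuter d) : Q.opp d = d := if_pos h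

theorem opp_of_not_isOuter {d : Q.Dart} (h : ¬ Q.IsOuter d) : Q.opp d = Q.φ (Q.φ d) := if_neg h

@[simp] theorem opp_opp (d : Q.Dart) : Q.opp (Q.opp d) = d := oppFun_involutive d

@[simp] theorem face_opp (d : Q.Dart) : Q.face (Q.opp d) = Q.face d := by
  by_cases h : Q.IsOuter d
  · rw [opp_of_isOuter h]
  · rw [opp_of_not_isOuter h]; simp [face]

@[simp] theorem isOuter_opp {d : Q.Dart} : Q.IsOuter (Q.opp d) ↔ Q.IsOuter d := by
  rw [isOuter_iff, face_opp]; rfl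

theorem opp_ne {d : Q.Dart} (h : ¬ Q.IsOuter d) : Q.opp d ≠ d := by
  rw [opp_of_not_isOuter h]; exact φφ_ne h

theorem φ_opp {d : Q.Dart} : Q.φ (Q.opp d) = Q.opp (Q.φ d) := by
  by_cases h : Q.IsOuter d
  · rw [opp_of_isOuter h, opp_of_isOuter (isOuter_φ.2 h)]
  · rw [opp_of_not_isOuter h, opp_of_not_isOuter (isOuter_φ.not.2 h)]

theorem step_apply (d : Q.Dart) : Q.step d = (Q.opp d).symm := rfl

/-- At the boundary a track turns back, so a cycle of `step` that meets the boundary runs along its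
track in both directions. -/
theorem step_of_isOuter {d : Q.Dart} (h : Q.IsOuter d) : Q.step d = d.symm := by
  rw [step_apply, opp_of_isOuter h]

@[simp] theorem symm_step (d : Q.Dart) : (Q.step d).symm = Q.opp d := by
  rw [step_apply, SimpleGraph.Dart.symm_symm]

theorem step_symm_step (d : Q.Dart) : Q.step (Q.step d).symm = d.symm := by
  rw [symm_step, step_apply, opp_opp]

/-- Reversing the last dart of a stretch traverses the stretch backwards. -/
theorem iterate_step_symm (k l : ℕ) (d : Q.Dart) :
    Q.step^[k] (Q.step^[k + l] d).symm = (Q.step^[l] d).symm := by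
  induction k with
  | zero => simp
  | succ k ih =>
    rw [Function.iterate_succ_apply, show k + 1 + l = k + l + 1 by omega,
      Function.iterate_succ_apply', step_symm_step, ih]

theorem step_iterate_injective (n : ℕ) : Function.Injective (Q.step^[n]) :=
  Q.step.injective.iterate n

theorem step_iterate_eq_iff {m n : ℕ} (h : m ≤ n) {d e : Q.Dart} :
    Q.step^[m] d = Q.step^[n] e ↔ d = Q.step^[n - m] e := by
  conv_lhs => rw [← Nat.add_sub_cancel' h, Function.iterate_add_apply]
  exact (step_iterate_injective m).eq_iff

/-! ### Segments of tracks -/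

/-- The indicator function of the edges crossed by a track in `m` steps from a given dart. -/
noncomputable def segment (d : Q.Dart) (m : ℕ) (y : Q.Dart) : ZMod 2 :=
  ∑ k ∈ Finset.range m, ((if y = Q.step^[k + 1] d then 1 else 0) +
    (if y = (Q.step^[k + 1] d).symm then 1 else 0))

theorem segment_symm (d : Q.Dart) (m : ℕ) (y : Q.Dart) : segment d m y.symm = segment d m y := by
  refine Finset.sum_congr rfl fun k _ => ?_
  have h : ∀ z : Q.Dart, y.symm = z.symm ↔ y = z := fun z =>
    SimpleGraph.Dart.symm_involutive.injective.eq_iff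
  have h' : ∀ z : Q.Dart, y.symm = z ↔ y = z.symm := fun z =>
    SimpleGraph.Dart.symm_involutive.eq_iff
  simp only [h]
  rw [add_comm]
  simp only [h']

theorem exists_of_segment_ne_zero {d : Q.Dart} {m : ℕ} {y : Q.Dart} (h : segment d m y ≠ 0) :
    ∃ k, (1 ≤ k ∧ k ≤ m ∧ y = Q.step^[k] d) ∨ (k < m ∧ y = Q.opp (Q.step^[k] d)) := by
  obtain ⟨k, hk, h⟩ := Finset.exists_ne_zero_of_sum_ne_zero h
  rw [Finset.mem_range] at hk
  by_cases h1 : y = Q.step^[k + 1] d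
  · exact ⟨k + 1, Or.inl ⟨by omega, by omega, h1⟩⟩
  · by_cases h2 : y = (Q.step^[k + 1] d).symm
    · refine ⟨k, Or.inr ⟨hk, ?_⟩⟩
      rw [h2, Function.iterate_succ_apply', symm_step]
    · rw [if_neg h1, if_neg h2, add_zero] at h
      exact absurd rfl h

theorem segment_of_isOuter {d : Q.Dart} {m : ℕ}
    (hd : ∀ k ≤ m, ¬ Q.IsOuter (Q.step^[k] d)) {y : Q.Dart} (hy : Q.IsOuter y) :
    segment d m y = 0 := by
  by_contra h
  obtain ⟨k, ⟨-, h2, rfl⟩ | ⟨h1, rfl⟩⟩ := exists_of_segment_ne_zero h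
  · exact hd k h2 hy
  · exact hd k h1.le (isOuter_opp.1 hy)

theorem squareSum_indicator (x : Q.Dart) {y : Q.Dart} (hy : ¬ Q.IsOuter y) :
    squareSum (fun z => if z = x then (1 : ZMod 2) else 0) y =
      if Q.face x = Q.face y then 1 else 0 := by
  rw [← sum_face_eq_squareSum _ hy, Finset.sum_ite_eq']
  simp

theorem squareSum_add (c c' : Q.Dart → ZMod 2) (y : Q.Dart) :
    squareSum (fun z => c z + c' z) y = squareSum c y + squareSum c' y := by
  simp only [squareSum]; ring

theorem squareSum_sum {ι : Type*} (s : Finset ι) (c : ι → Q.Dart → ZMod 2) (y : Q.Dart) :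
    squareSum (fun z => ∑ i ∈ s, c i z) y = ∑ i ∈ s, squareSum (c i) y := by
  simp only [squareSum, Finset.sum_add_distrib]

/-- The boundary of a segment consists of the faces at its two ends. -/
theorem squareSum_segment (d : Q.Dart) (m : ℕ) {y : Q.Dart} (hy : ¬ Q.IsOuter y) :
    squareSum (segment d m) y = (if Q.face d = Q.face y then 1 else 0) +
      (if Q.face (Q.step^[m] d) = Q.face y then 1 else 0) := by
  -- The `k`-th crossed edge lies between the faces of two consecutive darts of the track, so the
  -- sum telescopes modulo 2.
  have h : squareSum (segment d m) y = ∑ k ∈ Finset.range m,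
      ((if Q.face (Q.step^[k + 1] d) = Q.face y then (1 : ZMod 2) else 0) +
        (if Q.face (Q.step^[k] d) = Q.face y then 1 else 0)) := by
    unfold segment
    rw [squareSum_sum]
    refine Finset.sum_congr rfl fun k _ => ?_
    rw [squareSum_add, squareSum_indicator _ hy, squareSum_indicator _ hy,
      Function.iterate_succ_apply' _ k, symm_step, face_opp]
  rw [h]
  clear h
  induction m with
  | zero =>
    rw [Finset.sum_range_zero]
    exact (CharTwo.add_self_eq_zero _).symm
  | succ m ih =>
    rw [Finset.sum_range_succ, ih]
    have := CharTwo.add_self_eq_zero (if Q.face (Q.step^[m] d) = Q.face y then (1 : ZMod 2) else 0)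
    linear_combination this

theorem face_of_segment_ne_zero {d : Q.Dart} {m : ℕ} {y : Q.Dart} (h : segment d m y ≠ 0) :
    ∃ k ≤ m, Q.face y = Q.face (Q.step^[k] d) ∧
      (y = Q.step^[k] d ∨ y = Q.opp (Q.step^[k] d)) := by
  obtain ⟨k, ⟨-, h2, rfl⟩ | ⟨h1, rfl⟩⟩ := exists_of_segment_ne_zero h
  · exact ⟨k, h2, rfl, Or.inl rfl⟩
  · exact ⟨k, h1.le, face_opp _, Or.inr rfl⟩

theorem not_opposite_of_adjacent {a y : Q.Dart} (ha : ¬ Q.IsOuter a)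
    (hy : y = a ∨ y = Q.opp a) (hy' : Q.φ y = a ∨ Q.φ y = Q.opp a) : False := by
  rw [opp_of_not_isOuter ha] at hy hy'
  rcases hy with rfl | rfl
  · rcases hy' with h | h
    · exact φ_ne ha h
    · exact φ_ne ha (Q.φ.injective h).symm
  · rcases hy' with h | h
    · exact φφφ_ne ha h
    · exact φ_ne (isOuter_φ.not.2 (isOuter_φ.not.2 ha)) h

/-- In the interior of the disc, a track does not visit a quadrangle twice. -/
theorem face_iterate_step_ne (hQ : Q.InternalDegreesAtLeastFour) (m : ℕ) (hm : 1 ≤ m)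
    (d : Q.Dart) (hd : ∀ k ≤ m, ¬ Q.IsOuter (Q.step^[k] d)) :
    Q.face (Q.step^[m] d) ≠ Q.face d := by
  induction m using Nat.strong_induction_on generalizing d with
  | _ m ih =>
  intro hface
  -- By minimality only the first and the last quadrangle of the stretch coincide; the segment is
  -- closed and can turn only there, which is fewer than four faces.
  have hinj : ∀ k l, k < l → l ≤ m → (0 < k ∨ l < m) →
      Q.face (Q.step^[k] d) ≠ Q.face (Q.step^[l] d) := by
    intro k l hkl hl h0 h
    refine ih (l - k) (by omega) (by omega) (Q.step^[k] d) (fun j hj => ?_) ?_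
    · rw [← Function.iterate_add_apply]
      exact hd _ (by omega)
    · rw [← Function.iterate_add_apply, Nat.sub_add_cancel hkl.le, h]
  have hturn : ∀ y, segment d m y ≠ 0 → segment d m (Q.φ y) ≠ 0 → Q.face y = Q.face d := by
    intro y h1 h2
    by_contra hcon
    obtain ⟨k, hk, hk1, hk2⟩ := face_of_segment_ne_zero h1
    obtain ⟨l, hl, hl1, hl2⟩ := face_of_segment_ne_zero h2
    have hk0 : 0 < k := by
      rcases Nat.eq_zero_or_pos k with rfl | h
      · exact absurd hk1 hcon
      · exact h
    have hkm : k < m := by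
      rcases hk.eq_or_lt with rfl | h
      · exact absurd (hk1.trans hface) hcon
      · exact h
    have hkl : k = l := by
      rw [show Q.face (Q.φ y) = Q.face y by simp [face], hk1] at hl1
      rcases lt_trichotomy k l with h | h | h
      · exact absurd hl1 (hinj k l h hl (Or.inl hk0))
      · exact h
      · exact absurd hl1.symm (hinj l k h hk (Or.inr hkm))
    subst hkl
    exact not_opposite_of_adjacent (hd k hk) hk2 hl2
  have hends : ∀ y, segment d m y ≠ 0 → Q.face y = Q.face d → y = Q.step^[m] d ∨ y = Q.opp d := by
    intro y hy hyd
    obtain ⟨k, ⟨h1, h2, rfl⟩ | ⟨h1, rfl⟩⟩ := exists_of_segment_ne_zero hy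
    · rcases h2.eq_or_lt with rfl | h2
      · exact Or.inl rfl
      · exact absurd hyd.symm (hinj 0 k h1 h2.le (Or.inr h2))
    · rcases Nat.eq_zero_or_pos k with rfl | h
      · exact Or.inr rfl
      · rw [face_opp] at hyd
        exact absurd hyd.symm (hinj 0 k h h1.le (Or.inr h1))
  have h4 := four_le_card_turnFaces hQ (segment d m) (segment_symm d m)
    (fun y hy => segment_of_isOuter hd hy)
    (fun y hy => by rw [squareSum_segment d m hy, hface, CharTwo.add_self_eq_zero])
    ⟨Q.step d, ?_⟩ (fun y hy => ?_) {Q.face d} (fun y h1 h2 => by simpa using hturn y h1 h2)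
  · simp at h4
  · have hd1 : ¬ Q.IsOuter (Q.step d) := hd 1 hm
    have hne : Q.step d ≠ Q.opp d := by rw [step_apply]; exact symm_ne _
    -- The first crossed edge is not crossed again, so the closed curve does not cancel to zero.
    have : segment d m (Q.step d) = 1 := by
      unfold segment
      rw [Finset.sum_eq_single 0]
      · simp [hne]
      · intro k hk hk0
        rw [Finset.mem_range] at hk
        rw [if_neg, if_neg, add_zero]
        · intro h
          rw [Function.iterate_succ_apply', symm_step] at h
          rcases (show k = 1 ∨ 2 ≤ k by omega) with rfl | hk2
          · exact opp_ne hd1 h.symm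
          · refine hinj 1 k hk2 hk.le (Or.inl one_pos) ?_
            have := congrArg Q.face h
            rwa [face_opp] at this
        · intro h
          exact hinj 1 (k + 1) (by omega) (by omega) (Or.inl one_pos) (congrArg Q.face h)
      · intro h
        exact absurd (Finset.mem_range.2 hm) h
    rw [this]
    exact one_ne_zero
  · by_contra! hcon
    obtain ⟨h1, h2, h3⟩ := hcon
    have hf := hturn y h1 h2
    have e1 := hends y h1 hf
    have e2 := hends _ h2 (by simpa [face] using hf)
    have e3 := hends _ h3 (by simpa [face] using hf)
    have n1 := φ_ne hy
    have n2 := φφ_ne hy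
    have n3 := φ_ne (isOuter_φ.not.2 hy)
    rcases e1 with e1 | e1 <;> rcases e2 with e2 | e2 <;> rcases e3 with e3 | e3 <;>
      first
      | exact n1 (e2.trans e1.symm)
      | exact n2 (e3.trans e1.symm)
      | exact n3 (e3.trans e2.symm)

/-! ### Coordinates along tracks -/

theorem exists_isOuter_iterate_step (hQ : Q.InternalDegreesAtLeastFour) (d : Q.Dart) :
    ∃ n, Q.IsOuter (Q.step^[n] d) := by
  by_contra! hcon
  have h1 : 0 < orderOf Q.step := orderOf_pos _
  refine face_iterate_step_ne hQ (orderOf Q.step) h1 d (fun k _ => hcon k) ?_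
  rw [← Equiv.Perm.coe_pow, pow_orderOf_eq_one]
  rfl

/-- The number of steps from a dart along its track to the boundary. -/
noncomputable def len (d : Q.Dart) : ℕ := sInf {n | 1 ≤ n ∧ Q.IsOuter (Q.step^[n] d)}

/-- The outer dart at which the track of a dart ends. -/
noncomputable def exit (d : Q.Dart) : Q.Dart := Q.step^[len d] d

theorem len_mem (hQ : Q.InternalDegreesAtLeastFour) (d : Q.Dart) :
    1 ≤ len d ∧ Q.IsOuter (exit d) := by
  refine Nat.sInf_mem (s := {n | 1 ≤ n ∧ Q.IsOuter (Q.step^[n] d)}) ?_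
  obtain ⟨n, hn⟩ := exists_isOuter_iterate_step hQ (Q.step d)
  exact ⟨n + 1, by omega, hn⟩

theorem one_le_len (hQ : Q.InternalDegreesAtLeastFour) (d : Q.Dart) : 1 ≤ len d := (len_mem hQ d).1

theorem isOuter_exit (hQ : Q.InternalDegreesAtLeastFour) (d : Q.Dart) : Q.IsOuter (exit d) :=
  (len_mem hQ d).2

theorem not_isOuter_of_lt_len {d : Q.Dart} {k : ℕ} (h1 : 1 ≤ k) (h2 : k < len d) :
    ¬ Q.IsOuter (Q.step^[k] d) := fun h => Nat.notMem_of_lt_sInf h2 ⟨h1, h⟩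

theorem len_eq_of {d : Q.Dart} {n : ℕ} (h1 : 1 ≤ n) (h2 : Q.IsOuter (Q.step^[n] d))
    (h3 : ∀ k, 1 ≤ k → k < n → ¬ Q.IsOuter (Q.step^[k] d)) : len d = n := by
  refine le_antisymm (Nat.sInf_le ⟨h1, h2⟩) (le_csInf ⟨n, h1, h2⟩ ?_)
  rintro k ⟨hk, hk'⟩
  by_contra hcon
  exact h3 k hk (by omega) hk'

theorem isOuter_iterate_iff (hQ : Q.InternalDegreesAtLeastFour) {d : Q.Dart} {k : ℕ} (h1 : 1 ≤ k)
    (h2 : k ≤ len d) : Q.IsOuter (Q.step^[k] d) ↔ k = len d := by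
  constructor
  · intro h
    by_contra hne
    exact not_isOuter_of_lt_len h1 (by omega) h
  · rintro rfl
    exact isOuter_exit hQ d

/-- Indices start at 1: an outer dart is the last dart of the track from the other end, not the
zeroth of its own, which makes coordinates unique. The origin is found by following the reversed
dart to the boundary. -/
theorem exists_coordinates (hQ : Q.InternalDegreesAtLeastFour) (d : Q.Dart) :
    ∃ o, Q.IsOuter o ∧ ∃ i, 1 ≤ i ∧ i ≤ len o ∧ d = Q.step^[i] o := by
  have hex := exists_isOuter_iterate_step hQ d.symm
  set n := Nat.find hex with hn
  have h1 : Q.IsOuter (Q.step^[n] d.symm) := Nat.find_spec hex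
  have h2 : ∀ k < n, ¬ Q.IsOuter (Q.step^[k] d.symm) := fun k hk => Nat.find_min hex hk
  have hk : ∀ k ≤ n, Q.step^[k + 1] (Q.step^[n] d.symm) = (Q.step^[n - k] d.symm).symm := by
    intro k hk
    rw [Function.iterate_succ_apply, step_of_isOuter h1]
    conv_lhs => rw [← Nat.add_sub_cancel' hk]
    exact iterate_step_symm k (n - k) _
  refine ⟨_, h1, n + 1, by omega, le_csInf ?_ ?_, ?_⟩
  · exact ⟨_, one_le_len hQ _, isOuter_exit hQ _⟩
  · rintro k ⟨hk1, hk2⟩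
    by_contra hcon
    obtain ⟨k, rfl⟩ := Nat.exists_eq_add_of_le' hk1
    rw [hk k (by omega), show n - k = n - k - 1 + 1 by omega, Function.iterate_succ_apply',
      symm_step, isOuter_opp] at hk2
    exact h2 _ (by omega) hk2
  · rw [hk n le_rfl]; simp

theorem coordinates_unique {o o' : Q.Dart} (ho : Q.IsOuter o) (ho' : Q.IsOuter o') {i j : ℕ}
    (hi : 1 ≤ i) (hi' : i ≤ len o) (hj : 1 ≤ j) (hj' : j ≤ len o')
    (h : Q.step^[i] o = Q.step^[j] o') : o = o' ∧ i = j := by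
  wlog hij : i ≤ j generalizing i j o o'
  · exact (this ho' ho hj hj' hi hi' h.symm (by omega)).imp Eq.symm Eq.symm
  rw [step_iterate_eq_iff hij] at h
  have : i = j := by
    by_contra hne
    exact not_isOuter_of_lt_len (d := o') (k := j - i) (by omega) (by omega) (h ▸ ho)
  subst this
  simpa using h

theorem symm_iterate_step (hQ : Q.InternalDegreesAtLeastFour) {o : Q.Dart} {i : ℕ}
    (hi' : i ≤ len o) :
    (Q.step^[i] o).symm = Q.step^[len o + 1 - i] (exit o) := by
  rw [show len o + 1 - i = (len o - i) + 1 by omega, Function.iterate_succ_apply,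
    step_of_isOuter (isOuter_exit hQ o), exit]
  have := iterate_step_symm (len o - i) i o
  rw [Nat.sub_add_cancel hi'] at this
  exact this.symm

theorem iterate_step_exit (hQ : Q.InternalDegreesAtLeastFour) {o : Q.Dart} {i : ℕ} (hi : 1 ≤ i)
    (hi' : i ≤ len o) :
    Q.step^[i] (exit o) = (Q.step^[len o + 1 - i] o).symm := by
  rw [symm_iterate_step hQ (by omega)]
  congr 2
  omega

theorem len_exit (hQ : Q.InternalDegreesAtLeastFour) {o : Q.Dart} (ho : Q.IsOuter o) :
    len (exit o) = len o := by
  have h1 := one_le_len hQ o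
  refine len_eq_of h1 ?_ fun k hk1 hk2 => ?_
  · rw [iterate_step_exit hQ h1 le_rfl, show len o + 1 - len o = 0 + 1 by omega,
      Function.iterate_succ_apply', symm_step, isOuter_opp]
    exact ho
  · rw [iterate_step_exit hQ hk1 hk2.le, show len o + 1 - k = (len o - k) + 1 by omega,
      Function.iterate_succ_apply', symm_step, isOuter_opp]
    exact not_isOuter_of_lt_len (by omega) (by omega)

theorem exit_exit (hQ : Q.InternalDegreesAtLeastFour) {o : Q.Dart} (ho : Q.IsOuter o) :
    exit (exit o) = o := by
  have h1 := one_le_len hQ o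
  rw [exit, len_exit hQ ho, iterate_step_exit hQ h1 le_rfl,
    show len o + 1 - len o = 0 + 1 by omega, Function.iterate_succ_apply', symm_step]
  exact opp_of_isOuter ho

/-- A track with a single end would be its own reversal, so its middle dart would equal its reverse
or its opposite dart. -/
theorem exit_ne (hQ : Q.InternalDegreesAtLeastFour) (o : Q.Dart) :
    exit o ≠ o := by
  intro h
  have hrev : ∀ i, i ≤ len o → (Q.step^[i] o).symm = Q.step^[len o + 1 - i] o := by
    intro i hi
    rw [symm_iterate_step hQ hi, h]
  have h1 := one_le_len hQ o
  rcases Nat.even_or_odd' (len o) with ⟨m, hm | hm⟩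
  · have := hrev m (by omega)
    rw [show len o + 1 - m = m + 1 by omega, Function.iterate_succ_apply', step_apply] at this
    have := SimpleGraph.Dart.symm_involutive.injective this
    exact opp_ne (not_isOuter_of_lt_len (d := o) (k := m) (by omega) (by omega)) this.symm
  · have := hrev (m + 1) (by omega)
    rw [show len o + 1 - (m + 1) = m + 1 by omega] at this
    exact symm_ne _ this

/-- Two darts are on the same track, with any orientations. -/
def SameTrack (d e : Q.Dart) : Prop := Q.step.SameCycle d e

theorem SameTrack.refl (d : Q.Dart) : SameTrack d d := Equiv.Perm.SameCycle.refl _ _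

theorem SameTrack.symm {d e : Q.Dart} (h : SameTrack d e) : SameTrack e d :=
  Equiv.Perm.SameCycle.symm h

theorem SameTrack.trans {d e f : Q.Dart} (h : SameTrack d e) (h' : SameTrack e f) :
    SameTrack d f := Equiv.Perm.SameCycle.trans h h'

theorem sameTrack_iterate (d : Q.Dart) (n : ℕ) : SameTrack d (Q.step^[n] d) :=
  ⟨n, by simp [Equiv.Perm.coe_pow]⟩

theorem sameTrack_exit (d : Q.Dart) : SameTrack d (exit d) := sameTrack_iterate d _

theorem sameTrack_dart_symm (hQ : Q.InternalDegreesAtLeastFour) (d : Q.Dart) :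
    SameTrack d d.symm := by
  obtain ⟨o, ho, i, hi, hi', rfl⟩ := exists_coordinates hQ d
  rw [symm_iterate_step hQ hi']
  exact (sameTrack_iterate o i).symm.trans ((sameTrack_exit o).trans (sameTrack_iterate _ _))

theorem sameTrack_opp (hQ : Q.InternalDegreesAtLeastFour) (d : Q.Dart) :
    SameTrack d (Q.opp d) := by
  rw [← symm_step]
  exact (sameTrack_iterate d 1).trans (sameTrack_dart_symm hQ _)

theorem isOuter_sameTrack_iff (hQ : Q.InternalDegreesAtLeastFour) {o o' : Q.Dart}
    (ho : Q.IsOuter o) (ho' : Q.IsOuter o') : SameTrack o o' ↔ o' = o ∨ o' = exit o := by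
  constructor
  · intro h
    obtain ⟨n, -, -, hn⟩ := h.exists_pow_eq''
    rw [Equiv.Perm.coe_pow] at hn
    clear h
    induction n using Nat.strong_induction_on generalizing o with
    | _ n ih =>
    by_cases h0 : n = 0
    · subst h0; exact Or.inl hn.symm
    · by_cases h1 : n < len o
      · exact absurd (hn ▸ ho') (not_isOuter_of_lt_len (by omega) h1)
      · push Not at h1
        have h2 := one_le_len hQ o
        have := ih (n - len o) (by omega) (isOuter_exit hQ o) (by
          rw [exit, ← Function.iterate_add_apply, Nat.sub_add_cancel h1, hn])
        rw [exit_exit hQ ho] at this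
        exact this.symm
  · rintro (rfl | rfl)
    · exact SameTrack.refl _
    · exact sameTrack_exit _

theorem exists_isOuter_sameTrack (hQ : Q.InternalDegreesAtLeastFour) (d : Q.Dart) :
    ∃ o, Q.IsOuter o ∧ SameTrack o d := by
  obtain ⟨o, ho, i, -, -, rfl⟩ := exists_coordinates hQ d
  exact ⟨o, ho, sameTrack_iterate o i⟩

theorem sameTrack_isOuter_iff (hQ : Q.InternalDegreesAtLeastFour) {o d : Q.Dart}
    (ho : Q.IsOuter o) : SameTrack o d ↔
      ∃ i, 1 ≤ i ∧ i ≤ len o ∧ (d = Q.step^[i] o ∨ d = Q.step^[i] (exit o)) := by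
  constructor
  · intro h
    obtain ⟨o', ho', i, hi, hi', rfl⟩ := exists_coordinates hQ d
    rcases (isOuter_sameTrack_iff hQ ho ho').1 (h.trans (sameTrack_iterate o' i).symm) with
      rfl | rfl
    · exact ⟨i, hi, hi', Or.inl rfl⟩
    · exact ⟨i, hi, by rwa [len_exit hQ ho] at hi', Or.inr rfl⟩
  · rintro ⟨i, -, -, rfl | rfl⟩
    · exact sameTrack_iterate _ _
    · exact (sameTrack_exit o).trans (sameTrack_iterate _ _)

/-- Up to passing to the opposite dart, an inner dart of a track is visited by the track in a given
orientation. -/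
theorem exists_index (hQ : Q.InternalDegreesAtLeastFour) {o d : Q.Dart} (ho : Q.IsOuter o)
    (hd : ¬ Q.IsOuter d) (h : SameTrack o d) :
    ∃ i, 1 ≤ i ∧ i < len o ∧ (d = Q.step^[i] o ∨ d = Q.opp (Q.step^[i] o)) := by
  obtain ⟨i, hi, hi', rfl | rfl⟩ := (sameTrack_isOuter_iff hQ ho).1 h
  · refine ⟨i, hi, ?_, Or.inl rfl⟩
    rw [isOuter_iterate_iff hQ hi hi'] at hd
    omega
  · rw [isOuter_iterate_iff hQ hi (by rwa [len_exit hQ ho]), len_exit hQ ho] at hd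
    refine ⟨len o - i, by omega, by omega, Or.inr ?_⟩
    rw [iterate_step_exit hQ hi hi', show len o + 1 - i = (len o - i) + 1 by omega,
      Function.iterate_succ_apply', symm_step]

theorem face_eq_of_index {a d : Q.Dart} (h : d = a ∨ d = Q.opp a) : Q.face d = Q.face a := by
  rcases h with rfl | rfl
  · rfl
  · exact face_opp _

theorem face_iterate_injective (hQ : Q.InternalDegreesAtLeastFour) {o : Q.Dart} {i j : ℕ}
    (hi : 1 ≤ i) (hi' : i < len o) (hj : 1 ≤ j) (hj' : j < len o)
    (h : Q.face (Q.step^[i] o) = Q.face (Q.step^[j] o)) : i = j := by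
  wlog hij : i ≤ j generalizing i j
  · exact (this hj hj' hi hi' h.symm (by omega)).symm
  by_contra hne
  refine face_iterate_step_ne hQ (j - i) (by omega) (Q.step^[i] o) (fun k hk => ?_) ?_
  · rw [← Function.iterate_add_apply]
    exact not_isOuter_of_lt_len (by omega) (by omega)
  · rw [← Function.iterate_add_apply, Nat.sub_add_cancel hij, h]

/-- A track does not cross itself. -/
theorem not_sameTrack_φ (hQ : Q.InternalDegreesAtLeastFour) {d : Q.Dart} (hd : ¬ Q.IsOuter d) :
    ¬ SameTrack d (Q.φ d) := by
  intro h
  obtain ⟨o, ho, hod⟩ := exists_isOuter_sameTrack hQ d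
  obtain ⟨i, hi, hi', h1⟩ := exists_index hQ ho hd hod
  obtain ⟨j, hj, hj', h2⟩ := exists_index hQ ho (isOuter_φ.not.2 hd) (hod.trans h)
  have h3 : i = j := by
    refine face_iterate_injective hQ hi hi' hj hj' ?_
    rw [← face_eq_of_index h1, ← face_eq_of_index h2]
    simp [face]
  subst h3
  exact not_opposite_of_adjacent (not_isOuter_of_lt_len hi hi') h1 h2

end

end DiscQuadrangulation

namespace DiscQuadrangulation

section

open scoped Classical

variable {V W : Type*} [Finite V] [Finite W] {Q : DiscQuadrangulation V}

/-! ### Crossings of tracks -/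

theorem sameTrack_φφ (hQ : Q.InternalDegreesAtLeastFour) {d : Q.Dart} (hd : ¬ Q.IsOuter d) :
    SameTrack d (Q.φ (Q.φ d)) := by
  rw [← opp_of_not_isOuter hd]
  exact sameTrack_opp hQ d

theorem sameTrack_of_face_eq (hQ : Q.InternalDegreesAtLeastFour) {d e : Q.Dart}
    (hd : ¬ Q.IsOuter d) (h : Q.face e = Q.face d) : SameTrack d e ∨ SameTrack (Q.φ d) e := by
  rcases (face_eq_iff hd e).1 h with rfl | rfl | rfl | rfl
  · exact Or.inl (SameTrack.refl _)
  · exact Or.inr (SameTrack.refl _)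
  · exact Or.inl (sameTrack_φφ hQ hd)
  · exact Or.inr (sameTrack_φφ hQ (isOuter_φ.not.2 hd))

theorem sameTrack_of_index (hQ : Q.InternalDegreesAtLeastFour) {a d : Q.Dart}
    (h : d = a ∨ d = Q.opp a) : SameTrack a d := by
  rcases h with rfl | rfl
  · exact SameTrack.refl _
  · exact sameTrack_opp hQ a

theorem sameTrack_φ_of_index (hQ : Q.InternalDegreesAtLeastFour) {a d : Q.Dart}
    (h : d = a ∨ d = Q.opp a) : SameTrack (Q.φ a) (Q.φ d) := by
  rcases h with rfl | rfl
  · exact SameTrack.refl _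
  · rw [φ_opp]; exact sameTrack_opp hQ _

/-- There is no closed dual curve with at most three turns composed of pieces of different tracks. -/
theorem polygon_false (hQ : Q.InternalDegreesAtLeastFour) {ι : Type*} [Fintype ι]
    (o : ι → Q.Dart) (ho : ∀ i j, SameTrack (o i) (o j) → i = j) (c : ι → Q.Dart → ZMod 2)
    (hs : ∀ i d, c i d.symm = c i d) (hout : ∀ i d, Q.IsOuter d → c i d = 0)
    (hsupp : ∀ i d, c i d ≠ 0 → SameTrack (o i) d)
    (hc : ∀ y, ¬ Q.IsOuter y → ∑ i, squareSum (c i) y = 0) (T : Finset Q.rot.Face)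
    (hT : ∀ i j y, i ≠ j → ¬ Q.IsOuter y → SameTrack (o i) y → SameTrack (o j) (Q.φ y) →
      c i y ≠ 0 → c j (Q.φ y) ≠ 0 → Q.face y ∈ T)
    (hend : ∀ i y, ¬ Q.IsOuter y → SameTrack (o i) y → Q.face y ∈ T → squareSum (c i) y ≠ 0)
    (hcard : T.card < 4) (hne : ∃ i d, c i d ≠ 0) : False := by
  -- Different tracks share no darts, so on the track of `o i` only the piece `c i` is seen.
  have hval : ∀ i d, SameTrack (o i) d → ∑ j, c j d = c i d := by
    intro i d hid
    refine Finset.sum_eq_single i (fun j _ hji => ?_) (by simp)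
    by_contra h
    exact hji (ho _ _ ((hsupp j d h).trans hid.symm))
  have hex : ∀ d, ∑ j, c j d ≠ 0 → ∃ i, c i d ≠ 0 := by
    intro d hd
    obtain ⟨i, -, hi⟩ := Finset.exists_ne_zero_of_sum_ne_zero hd
    exact ⟨i, hi⟩
  have hinner : ∀ i d, c i d ≠ 0 → ¬ Q.IsOuter d := fun i d h h' => h (hout i d h')
  have hturn : ∀ y, ∑ j, c j y ≠ 0 → ∑ j, c j (Q.φ y) ≠ 0 → Q.face y ∈ T := by
    intro y h1 h2
    obtain ⟨i, hi⟩ := hex _ h1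
    obtain ⟨j, hj⟩ := hex _ h2
    have hy := hinner i y hi
    refine hT i j y ?_ hy (hsupp _ _ hi) (hsupp _ _ hj) hi hj
    rintro rfl
    exact not_sameTrack_φ hQ hy ((hsupp _ _ hi).symm.trans (hsupp _ _ hj))
  refine absurd (four_le_card_turnFaces hQ (fun d => ∑ j, c j d) (fun d => ?_) (fun d hd => ?_)
    (fun d hd => ?_) ?_ (fun y hy => ?_) T hturn) (by omega)
  · simp [hs]
  · exact Finset.sum_eq_zero fun i _ => hout i d hd
  · rw [squareSum_sum, hc d hd]
  · obtain ⟨i, d, hd⟩ := hne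
    exact ⟨d, by rwa [hval i d (hsupp i d hd)]⟩
  -- Three crossed sides include a turn, so the face is a corner in `T`. But the piece of the track
  -- `o i` crosses two opposite sides there, so it does not end in this face.
  · by_contra! hcon
    obtain ⟨h1, h2, h3⟩ := hcon
    have hf := hturn y h1 h2
    obtain ⟨i, hi⟩ := hex _ h1
    have hiy := hsupp _ _ hi
    have e1 : c i y = 1 := ZMod.eq_one_of_neZero hi
    have e2 : c i (Q.φ (Q.φ y)) = 1 := by
      rw [hval i _ (hiy.trans (sameTrack_φφ hQ hy))] at h3
      exact ZMod.eq_one_of_neZero h3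
    have e3 : c i (Q.φ y) = 0 := by
      by_contra h
      exact not_sameTrack_φ hQ hy (hiy.symm.trans (hsupp _ _ h))
    have e4 : c i (Q.φ (Q.φ (Q.φ y))) = 0 := by
      by_contra h
      exact not_sameTrack_φ hQ hy ((hiy.symm.trans (hsupp _ _ h)).trans
        (sameTrack_φφ hQ (isOuter_φ.not.2 hy)).symm)
    refine hend i y hy hiy hf ?_
    rw [squareSum, e1, e2, e3, e4]
    decide

/-- The piece of a track between two of its quadrangles. -/
theorem exists_segment {o : Q.Dart} {p q : ℕ} (hp : 1 ≤ p) (hp' : p < len o) (hq : 1 ≤ q)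
    (hq' : q < len o) : ∃ c : Q.Dart → ZMod 2, (∀ d, c d.symm = c d) ∧
      (∀ d, Q.IsOuter d → c d = 0) ∧
      (∀ y, c y ≠ 0 → ∃ k, min p q ≤ k ∧ k ≤ max p q ∧
        (y = Q.step^[k] o ∨ y = Q.opp (Q.step^[k] o))) ∧
      ∀ y, ¬ Q.IsOuter y → squareSum c y =
        (if Q.face (Q.step^[p] o) = Q.face y then 1 else 0) +
        (if Q.face (Q.step^[q] o) = Q.face y then 1 else 0) := by
  wlog hpq : p ≤ q generalizing p q
  · obtain ⟨c, h1, h2, h3, h4⟩ := this hq hq' hp hp' (by omega)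
    refine ⟨c, h1, h2, fun y hy => ?_, fun y hy => ?_⟩
    · rw [min_comm, max_comm]; exact h3 y hy
    · rw [h4 y hy, add_comm]
  refine ⟨segment (Q.step^[p] o) (q - p), segment_symm _ _, fun d hd => ?_, fun y hy => ?_,
    fun y hy => ?_⟩
  · refine segment_of_isOuter (fun k hk => ?_) hd
    rw [← Function.iterate_add_apply]
    exact not_isOuter_of_lt_len (by omega) (by omega)
  · obtain ⟨k, hk, -, h⟩ := face_of_segment_ne_zero hy
    rw [← Function.iterate_add_apply] at h
    exact ⟨k + p, by omega, by omega, h⟩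
  · rw [squareSum_segment _ _ hy, ← Function.iterate_add_apply, Nat.sub_add_cancel hpq]

theorem ite_add_ite_ne_zero {α : Type*} {A B f : α} (hAB : A ≠ B) (h : A = f ∨ B = f) :
    (if A = f then (1 : ZMod 2) else 0) + (if B = f then 1 else 0) ≠ 0 := by
  rcases h with rfl | rfl
  · rw [if_pos rfl, if_neg hAB.symm]; decide
  · rw [if_pos rfl, if_neg hAB]; decide

theorem exists_ne_zero_of_squareSum {c : Q.Dart → ZMod 2} {y : Q.Dart} (h : squareSum c y ≠ 0) :
    ∃ d, c d ≠ 0 := by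
  by_contra! hcon
  exact h (by simp [squareSum, hcon])

/-- Two tracks cross at most once. -/
theorem face_eq_of_crossing (hQ : Q.InternalDegreesAtLeastFour) {y y' : Q.Dart}
    (hy : ¬ Q.IsOuter y) (hy' : ¬ Q.IsOuter y') (h : SameTrack y y')
    (hφ : SameTrack (Q.φ y) (Q.φ y')) : Q.face y = Q.face y' := by
  by_contra hface
  obtain ⟨o, ho, hoy⟩ := exists_isOuter_sameTrack hQ y
  obtain ⟨o₁, ho₁, hoy₁⟩ := exists_isOuter_sameTrack hQ (Q.φ y)
  have hoo : ¬ SameTrack o o₁ := fun hcon =>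
    not_sameTrack_φ hQ hy (hoy.symm.trans (hcon.trans hoy₁))
  set P : ℕ → Prop := fun k => 1 ≤ k ∧ k < len o ∧ SameTrack o₁ (Q.φ (Q.step^[k] o)) with hP
  -- Consecutive crossings are chosen, so that the piece of the first track between them meets the
  -- second track only at its ends: a bigon.
  have hcons : ∃ p q, p < q ∧ P p ∧ P q ∧ ∀ k, p < k → k < q → ¬ P k := by
    have h2 : ∃ a b, a < b ∧ P a ∧ P b := by
      obtain ⟨i, hi, hi', h1⟩ := exists_index hQ ho hy hoy
      obtain ⟨j, hj, hj', h2⟩ := exists_index hQ ho hy' (hoy.trans h)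
      have hPi : P i := ⟨hi, hi', hoy₁.trans (sameTrack_φ_of_index hQ h1).symm⟩
      have hPj : P j := ⟨hj, hj', (hoy₁.trans hφ).trans (sameTrack_φ_of_index hQ h2).symm⟩
      rcases lt_trichotomy i j with hij | rfl | hij
      · exact ⟨i, j, hij, hPi, hPj⟩
      · exact absurd ((face_eq_of_index h1).trans (face_eq_of_index h2).symm) hface
      · exact ⟨j, i, hij, hPj, hPi⟩
    obtain ⟨a, b, hab, ha, hb⟩ := h2
    have hex : ∃ k, a < k ∧ P k := ⟨b, hab, hb⟩
    refine ⟨a, Nat.find hex, (Nat.find_spec hex).1, ha, (Nat.find_spec hex).2, fun k hk hk' hPk => ?_⟩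
    exact Nat.find_min hex hk' ⟨hk, hPk⟩
  obtain ⟨p, q, hpq, ⟨hp, hp', hPp⟩, ⟨hq, hq', hPq⟩, hmin⟩ := hcons
  have hpo := not_isOuter_of_lt_len hp hp'
  have hqo := not_isOuter_of_lt_len hq hq'
  obtain ⟨p₁, hp₁, hp₁', h1⟩ := exists_index hQ ho₁ (isOuter_φ.not.2 hpo) hPp
  obtain ⟨q₁, hq₁, hq₁', h2⟩ := exists_index hQ ho₁ (isOuter_φ.not.2 hqo) hPq
  obtain ⟨a, ha1, ha2, ha3, ha4⟩ := exists_segment hp hp' hq hq'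
  obtain ⟨b, hb1, hb2, hb3, hb4⟩ := exists_segment hp₁ hp₁' hq₁ hq₁'
  have hA : Q.face (Q.step^[p₁] o₁) = Q.face (Q.step^[p] o) := by
    rw [← face_eq_of_index h1]; simp [face]
  have hB : Q.face (Q.step^[q₁] o₁) = Q.face (Q.step^[q] o) := by
    rw [← face_eq_of_index h2]; simp [face]
  rw [hA, hB] at hb4
  set A := Q.face (Q.step^[p] o)
  set B := Q.face (Q.step^[q] o)
  have hAB : A ≠ B := fun h => hpq.ne (face_iterate_injective hQ hp hp' hq hq' h)
  have hkey : ∀ z, a z ≠ 0 → SameTrack o₁ (Q.φ z) → A = Q.face z ∨ B = Q.face z := by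
    intro z hz hz'
    obtain ⟨k, hk1, hk2, hk3⟩ := ha3 z hz
    have hPk : P k := ⟨by omega, by omega, hz'.trans (sameTrack_φ_of_index hQ hk3).symm⟩
    have : k = p ∨ k = q := by
      by_contra hcon
      exact hmin k (by omega) (by omega) hPk
    rcases this with rfl | rfl
    · exact Or.inl (face_eq_of_index hk3).symm
    · exact Or.inr (face_eq_of_index hk3).symm
  have hsa : ∀ d, a d ≠ 0 → SameTrack o d := by
    intro d hd
    obtain ⟨k, -, -, hk⟩ := ha3 d hd
    exact (sameTrack_iterate o k).trans (sameTrack_of_index hQ hk)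
  have hsb : ∀ d, b d ≠ 0 → SameTrack o₁ d := by
    intro d hd
    obtain ⟨k, -, -, hk⟩ := hb3 d hd
    exact (sameTrack_iterate o₁ k).trans (sameTrack_of_index hQ hk)
  refine polygon_false hQ ![o, o₁] ?_ ![a, b] ?_ ?_ ?_ (fun y hy => ?_) {A, B} ?_ ?_ ?_ ⟨0, ?_⟩
  · refine Fin.forall_fin_two.2 ⟨Fin.forall_fin_two.2 ⟨fun _ => rfl, fun h => absurd h hoo⟩,
      Fin.forall_fin_two.2 ⟨fun h => absurd h.symm hoo, fun _ => rfl⟩⟩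
  · exact Fin.forall_fin_two.2 ⟨ha1, hb1⟩
  · exact Fin.forall_fin_two.2 ⟨ha2, hb2⟩
  · exact Fin.forall_fin_two.2 ⟨hsa, hsb⟩
  · rw [Fin.sum_univ_two]
    exact (congrArg₂ _ (ha4 y hy) (hb4 y hy)).trans (CharTwo.add_self_eq_zero _)
  · simp only [Fin.forall_fin_two]
    refine ⟨⟨fun y h => absurd rfl h, fun y _ hy h1 h2 h3 h4 => ?_⟩,
      ⟨fun y _ hy h1 h2 h3 h4 => ?_, fun y h => absurd rfl h⟩⟩
    · rcases hkey y h3 h2 with h | h <;> simp [← h]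
    · have := hkey (Q.φ y) h4 (h1.trans (sameTrack_φφ hQ hy))
      rw [show Q.face (Q.φ y) = Q.face y by simp [face]] at this
      rcases this with h | h <;> simp [← h]
  · have hmem : ∀ f, f ∈ ({A, B} : Finset Q.rot.Face) → A = f ∨ B = f := by
      intro f hf
      simpa [eq_comm] using hf
    refine Fin.forall_fin_two.2 ⟨fun y hy _ hT => ?_, fun y hy _ hT => ?_⟩
    · exact (ha4 y hy).trans_ne (ite_add_ite_ne_zero hAB (hmem _ hT))
    · exact (hb4 y hy).trans_ne (ite_add_ite_ne_zero hAB (hmem _ hT))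
  · exact lt_of_le_of_lt (Finset.card_insert_le _ _) (by simp)
  · exact exists_ne_zero_of_squareSum
      ((ha4 _ hpo).trans_ne (ite_add_ite_ne_zero hAB (Or.inl rfl)))

/-- Indices are modulo 3: `x i` is the crossing of tracks `i` and `i + 1`, so the side on track `i`
runs from `x (i + 2)` to `x i`. There are no further corners, as two tracks cross only once. -/
theorem triangle_false_aux (hQ : Q.InternalDegreesAtLeastFour) (o x : Fin 3 → Q.Dart)
    (ho : ∀ i, Q.IsOuter (o i)) (hne : ∀ i j, SameTrack (o i) (o j) → i = j)
    (hx : ∀ i, ¬ Q.IsOuter (x i)) (h1 : ∀ i, SameTrack (o i) (x i))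
    (h2 : ∀ i, SameTrack (o (i + 1)) (Q.φ (x i))) : False := by
  have hface : ∀ i k, Q.face (x i) = Q.face (x k) → i = k := by
    intro i k hik
    have e1 := sameTrack_of_face_eq hQ (hx k) hik
    have e2 := sameTrack_of_face_eq hQ (hx k) (e := Q.φ (x i)) (by simpa [face] using hik)
    have e1' : k = i ∨ k + 1 = i := e1.imp (fun h => hne _ _ ((h1 k).trans (h.trans (h1 i).symm)))
      (fun h => hne _ _ ((h2 k).trans (h.trans (h1 i).symm)))
    have e2' : k = i + 1 ∨ k + 1 = i + 1 :=
      e2.imp (fun h => hne _ _ ((h1 k).trans (h.trans (h2 i).symm)))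
        (fun h => hne _ _ ((h2 k).trans (h.trans (h2 i).symm)))
    revert e1' e2'
    clear e1 e2 hik
    revert i k
    decide
  have hseg : ∀ i, ∃ c : Q.Dart → ZMod 2, (∀ d, c d.symm = c d) ∧
      (∀ d, Q.IsOuter d → c d = 0) ∧ (∀ d, c d ≠ 0 → SameTrack (o i) d) ∧
      ∀ y, ¬ Q.IsOuter y → squareSum c y =
        (if Q.face (x (i + 2)) = Q.face y then 1 else 0) +
        (if Q.face (x i) = Q.face y then 1 else 0) := by
    intro i
    have h3 := h2 (i + 2)
    rw [(by decide : ∀ i : Fin 3, i + 2 + 1 = i) i] at h3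
    obtain ⟨p, hp, hp', hp1⟩ := exists_index hQ (ho i) (isOuter_φ.not.2 (hx (i + 2))) h3
    obtain ⟨q, hq, hq', hq1⟩ := exists_index hQ (ho i) (hx i) (h1 i)
    obtain ⟨c, c1, c2, c3, c4⟩ := exists_segment hp hp' hq hq'
    refine ⟨c, c1, c2, fun d hd => ?_, fun y hy => ?_⟩
    · obtain ⟨k, -, -, hk⟩ := c3 d hd
      exact (sameTrack_iterate _ k).trans (sameTrack_of_index hQ hk)
    · rw [c4 y hy, ← face_eq_of_index hp1, ← face_eq_of_index hq1]
      simp [face]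
  choose c c1 c2 c3 c4 using hseg
  have hends : ∀ i k y, SameTrack (o i) y → Q.face y = Q.face (x k) → i = k ∨ i = k + 1 := by
    intro i k y hiy hy
    exact (sameTrack_of_face_eq hQ (hx k) hy).imp
      (fun h => hne _ _ (hiy.trans (h.symm.trans (h1 k).symm)))
      (fun h => hne _ _ (hiy.trans (h.symm.trans (h2 k).symm)))
  have hnext : ∀ i, Q.face (x (i + 2)) ≠ Q.face (x i) := by
    intro i h
    exact (by decide : ∀ i : Fin 3, i + 2 ≠ i) i (hface _ _ h)
  refine polygon_false hQ o hne c c1 c2 c3 (fun y hy => ?_)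
    (Finset.univ.image fun i => Q.face (x i)) (fun i j y hij hy hi hj _ _ => ?_)
    (fun i y hy hi hT => ?_) ?_ ⟨0, ?_⟩
  · simp_rw [c4 _ y hy, Finset.sum_add_distrib]
    refine (congrArg (· + _) (Equiv.sum_comp (Equiv.addRight (2 : Fin 3))
      (fun i => if Q.face (x i) = Q.face y then (1 : ZMod 2) else 0))).trans ?_
    exact CharTwo.add_self_eq_zero _
  · have hcase : j = i + 1 ∨ i = j + 1 :=
      (by decide : ∀ i j : Fin 3, i ≠ j → j = i + 1 ∨ i = j + 1) i j hij
    rw [Finset.mem_image]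
    rcases hcase with rfl | rfl
    · exact ⟨i, Finset.mem_univ _, face_eq_of_crossing hQ (hx i) hy ((h1 i).symm.trans hi)
        ((h2 i).symm.trans hj)⟩
    · refine ⟨j, Finset.mem_univ _, (face_eq_of_crossing hQ (hx j) (isOuter_φ.not.2 hy)
        ((h1 j).symm.trans hj) ((h2 j).symm.trans (hi.trans (sameTrack_φφ hQ hy)))).trans ?_⟩
      simp [face]
  · rw [Finset.mem_image] at hT
    obtain ⟨k, -, hk⟩ := hT
    rw [c4 i y hy]
    refine ite_add_ite_ne_zero (hnext i) ?_
    rcases hends i k y hi hk.symm with rfl | rfl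
    · exact Or.inr hk
    · left
      rw [← hk, (by decide : ∀ k : Fin 3, k + 1 + 2 = k) k]
  · exact lt_of_le_of_lt Finset.card_image_le (by simp)
  · exact exists_ne_zero_of_squareSum (c := c 0) (y := x 0)
      ((c4 0 _ (hx 0)).trans_ne (ite_add_ite_ne_zero (hnext 0) (Or.inr rfl)))

/-- The tracks of two darts cross in a quadrangle. -/
def Crosses (d e : Q.Dart) : Prop := ∃ y, ¬ Q.IsOuter y ∧ SameTrack d y ∧ SameTrack e (Q.φ y)

theorem Crosses.symm (hQ : Q.InternalDegreesAtLeastFour) {d e : Q.Dart} (h : Crosses d e) :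
    Crosses e d := by
  obtain ⟨y, hy, h1, h2⟩ := h
  exact ⟨Q.φ y, isOuter_φ.not.2 hy, h2, h1.trans (sameTrack_φφ hQ hy)⟩

theorem Crosses.not_sameTrack (hQ : Q.InternalDegreesAtLeastFour) {d e : Q.Dart}
    (h : Crosses d e) : ¬ SameTrack d e := by
  obtain ⟨y, hy, h1, h2⟩ := h
  exact fun h => not_sameTrack_φ hQ hy (h1.symm.trans (h.trans h2))

/-- No three tracks cross pairwise. -/
theorem not_crosses_of_crosses (hQ : Q.InternalDegreesAtLeastFour) {o₀ o₁ o₂ : Q.Dart}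
    (ho₀ : Q.IsOuter o₀) (ho₁ : Q.IsOuter o₁) (ho₂ : Q.IsOuter o₂)
    (h₀ : Crosses o₀ o₁) (h₁ : Crosses o₁ o₂) : ¬ Crosses o₂ o₀ := by
  intro h₂
  have n₀ := h₀.not_sameTrack hQ
  have n₁ := h₁.not_sameTrack hQ
  have n₂ := h₂.not_sameTrack hQ
  obtain ⟨y₀, hy₀, a₀, b₀⟩ := h₀
  obtain ⟨y₁, hy₁, a₁, b₁⟩ := h₁
  obtain ⟨y₂, hy₂, a₂, b₂⟩ := h₂
  refine triangle_false_aux hQ ![o₀, o₁, o₂] ![y₀, y₁, y₂] ?_ ?_ ?_ ?_ ?_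
  · intro i; fin_cases i <;> assumption
  · intro i j h
    fin_cases i <;> fin_cases j <;> first
      | rfl
      | exact absurd h n₀
      | exact absurd h.symm n₀
      | exact absurd h n₁
      | exact absurd h.symm n₁
      | exact absurd h n₂
      | exact absurd h.symm n₂
  · intro i; fin_cases i <;> assumption
  · intro i; fin_cases i <;> assumption
  · intro i; fin_cases i <;> assumption

end

end DiscQuadrangulation

namespace DiscQuadrangulation

section

open scoped Classical

variable {V W : Type*} [Finite V] [Finite W] {Q : DiscQuadrangulation V}

/-! ### Sides of tracks and distances -/

theorem sameTrack_dart_symm_iff (hQ : Q.InternalDegreesAtLeastFour) {e d : Q.Dart} :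
    SameTrack e d.symm ↔ SameTrack e d :=
  ⟨fun h => h.trans (sameTrack_dart_symm hQ d).symm, fun h => h.trans (sameTrack_dart_symm hQ d)⟩

/-- A track crosses opposite sides of a quadrangle together, so its edges form a cocycle, hence a
cut. -/
theorem exists_side (hQ : Q.InternalDegreesAtLeastFour) (e : Q.Dart) :
    ∃ h : V → ZMod 2, ∀ d : Q.Dart, h d.snd = h d.fst + if SameTrack e d then 1 else 0 := by
  refine exists_coboundary _ (fun d => by simp only [sameTrack_dart_symm_iff hQ]) fun d hd => ?_
  have h1 : SameTrack e (Q.φ (Q.φ d)) ↔ SameTrack e d :=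
    ⟨fun h => h.trans (sameTrack_φφ hQ hd).symm, fun h => h.trans (sameTrack_φφ hQ hd)⟩
  have hd' := isOuter_φ.not.2 hd
  have h2 : SameTrack e (Q.φ (Q.φ (Q.φ d))) ↔ SameTrack e (Q.φ d) :=
    ⟨fun h => h.trans (sameTrack_φφ hQ hd').symm, fun h => h.trans (sameTrack_φφ hQ hd')⟩
  simp only [squareSum, h1, h2]
  split_ifs <;> decide

/-- A function that tells the two sides of the track of a dart apart. -/
noncomputable def side (hQ : Q.InternalDegreesAtLeastFour) (e : Q.Dart) : V → ZMod 2 :=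
  (exists_side hQ e).choose

theorem side_snd (hQ : Q.InternalDegreesAtLeastFour) (e d : Q.Dart) :
    side hQ e d.snd = side hQ e d.fst + if SameTrack e d then 1 else 0 :=
  (exists_side hQ e).choose_spec d

theorem side_snd_eq_iff (hQ : Q.InternalDegreesAtLeastFour) {e d : Q.Dart} :
    side hQ e d.snd = side hQ e d.fst ↔ ¬ SameTrack e d := by
  rw [side_snd]
  split_ifs with h <;> simp [h]

theorem ZMod.eq_of_ne_of_ne {a b c : ZMod 2} (h : a ≠ b) (h' : c ≠ b) : a = c := by
  revert a b c; decide

/-- The two functions have the same coboundary and so differ by a constant. -/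
theorem side_congr (hQ : Q.InternalDegreesAtLeastFour) {e e' : Q.Dart} (h : SameTrack e e')
    (x y : V) : side hQ e x = side hQ e y ↔ side hQ e' x = side hQ e' y := by
  have key : ∀ z, side hQ e z - side hQ e' z = side hQ e x - side hQ e' x := by
    intro z
    have := (SimpleGraph.reachable_iff_reflTransGen x z).1 (Q.connected.preconnected x z)
    induction this with
    | refl => rfl
    | @tail u v _ h1 ih =>
      rw [← ih]
      have e1 := side_snd hQ e ⟨(u, v), h1⟩
      have e2 := side_snd hQ e' ⟨(u, v), h1⟩
      have e3 : SameTrack e ⟨(u, v), h1⟩ ↔ SameTrack e' ⟨(u, v), h1⟩ :=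
        ⟨fun h2 => h.symm.trans h2, fun h2 => h.trans h2⟩
      simp only [e3] at e1
      linear_combination e1 - e2
  have := key y
  constructor
  · intro h1
    linear_combination this + h1
  · intro h1
    linear_combination h1 - this

/-- Quadrangles have even length, so the constant 1 is a cocycle and the graph is bipartite. -/
theorem exists_coloring (Q : DiscQuadrangulation V) :
    ∃ h : V → ZMod 2, ∀ d : Q.Dart, h d.snd = h d.fst + 1 :=
  exists_coboundary (fun _ => 1) (fun _ => rfl) fun _ _ => by simp only [squareSum]; decide

theorem exists_coloring_dist (Q : DiscQuadrangulation V) :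
    ∃ h : V → ZMod 2, ∀ x y, h y = h x + Q.graph.dist x y := by
  obtain ⟨h, hh⟩ := exists_coloring Q
  refine ⟨h, fun x y => ?_⟩
  obtain ⟨p, hp⟩ := (Q.connected.preconnected x y).exists_walk_length_eq_dist
  rw [← hp]
  clear hp
  induction p with
  | nil => simp
  | @cons u v w huv p ih =>
    rw [ih, SimpleGraph.Walk.length_cons, hh ⟨(u, v), huv⟩]
    push_cast
    ring

theorem dist_ne_of_adj {u v : V} (h : Q.graph.Adj u v) (y : V) :
    Q.graph.dist y u ≠ Q.graph.dist y v := by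
  obtain ⟨c, hc⟩ := exists_coloring_dist Q
  intro hd
  have h1 := hc y u
  have h2 := hc y v
  have h3 := hc u v
  rw [SimpleGraph.dist_eq_one_iff_adj.2 h] at h3
  rw [hd] at h1
  rw [h1, h2] at h3
  simp at h3

theorem exists_dart_dist {x y : V} (h : x ≠ y) :
    ∃ d : Q.Dart, d.fst = x ∧ Q.graph.dist x y = Q.graph.dist d.snd y + 1 := by
  obtain ⟨p, hp⟩ := (Q.connected.preconnected x y).exists_walk_length_eq_dist
  cases p with
  | nil => exact absurd rfl h
  | @cons _ v _ hv p =>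
    refine ⟨⟨(x, v), hv⟩, rfl, le_antisymm ?_ ?_⟩
    · have h1 := Q.connected.dist_triangle (u := x) (v := v) (w := y)
      rw [SimpleGraph.dist_eq_one_iff_adj.2 hv] at h1
      simpa [add_comm] using h1
    · rw [← hp, SimpleGraph.Walk.length_cons]
      exact Nat.succ_le_succ (SimpleGraph.dist_le p)

/-- The outer darts whose tracks separate two vertices. -/
noncomputable def sep (hQ : Q.InternalDegreesAtLeastFour) (x y : V) : Finset Q.Dart :=
  Finset.univ.filter fun o => Q.IsOuter o ∧ side hQ o x ≠ side hQ o y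

theorem mem_sep (hQ : Q.InternalDegreesAtLeastFour) {x y : V} {o : Q.Dart} :
    o ∈ sep hQ x y ↔ Q.IsOuter o ∧ side hQ o x ≠ side hQ o y := by simp [sep]

/-- The outer darts of the track of a dart. -/
noncomputable def ends (d : Q.Dart) : Finset Q.Dart :=
  Finset.univ.filter fun o => Q.IsOuter o ∧ SameTrack o d

theorem mem_ends {d o : Q.Dart} : o ∈ ends d ↔ Q.IsOuter o ∧ SameTrack o d := by simp [ends]

theorem card_ends (hQ : Q.InternalDegreesAtLeastFour) (d : Q.Dart) : (ends d).card = 2 := by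
  obtain ⟨o, ho, hod⟩ := exists_isOuter_sameTrack hQ d
  have : ends d = {o, exit o} := by
    ext o'
    rw [mem_ends, Finset.mem_insert, Finset.mem_singleton]
    constructor
    · rintro ⟨h1, h2⟩
      exact (isOuter_sameTrack_iff hQ ho h1).1 (hod.trans h2.symm)
    · rintro (rfl | rfl)
      · exact ⟨ho, hod⟩
      · exact ⟨isOuter_exit hQ o, (sameTrack_exit o).symm.trans hod⟩
  rw [this, Finset.card_pair (exit_ne hQ o).symm]

theorem sep_dart (hQ : Q.InternalDegreesAtLeastFour) (d : Q.Dart) :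
    sep hQ d.fst d.snd = ends d := by
  ext o
  rw [mem_sep, mem_ends, ne_comm, Ne, side_snd_eq_iff, not_not]

/-- A path crosses every track that separates its ends. The factor 2 appears because each track is
counted at both of its outer darts. -/
theorem card_sep_le (hQ : Q.InternalDegreesAtLeastFour) (x y : V) :
    (sep hQ x y).card ≤ 2 * Q.graph.dist x y := by
  obtain ⟨p, hp⟩ := (Q.connected.preconnected x y).exists_walk_length_eq_dist
  rw [← hp]
  clear hp
  induction p with
  | nil => simp [sep]
  | @cons u v w huv p ih =>
    have h1 : sep hQ u w ⊆ ends ⟨(u, v), huv⟩ ∪ sep hQ v w := by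
      intro o ho
      rw [Finset.mem_union, ← sep_dart hQ]
      rw [mem_sep] at ho
      by_cases h : side hQ o u = side hQ o v
      · right
        rw [mem_sep, ← h]
        exact ho
      · left
        exact (mem_sep hQ).2 ⟨ho.1, h⟩
    have h2 := Finset.card_le_card h1
    have h3 := Finset.card_union_le (ends ⟨(u, v), huv⟩) (sep hQ v w)
    rw [card_ends hQ] at h3
    rw [SimpleGraph.Walk.length_cons]
    omega

theorem fst_step {d : Q.Dart} (hd : ¬ Q.IsOuter d) :
    (Q.step d).fst = (Q.φ (Q.φ (Q.φ d))).fst := by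
  rw [step_apply, opp_of_not_isOuter hd, RotationSystem.fst_facePerm]; rfl

theorem snd_φφφ {d : Q.Dart} (hd : ¬ Q.IsOuter d) : (Q.φ (Q.φ (Q.φ d))).snd = d.fst := by
  rw [← RotationSystem.fst_facePerm, φ_four hd]

theorem snd_step {d : Q.Dart} (hd : ¬ Q.IsOuter d) : (Q.step d).snd = (Q.φ d).snd := by
  rw [step_apply, opp_of_not_isOuter hd, ← RotationSystem.fst_facePerm Q.rot (Q.φ d)]; rfl

theorem sameTrack_φφφ_iff (hQ : Q.InternalDegreesAtLeastFour) {o d : Q.Dart}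
    (hd : ¬ Q.IsOuter d) : SameTrack o (Q.φ (Q.φ (Q.φ d))) ↔ SameTrack o (Q.φ d) := by
  have := sameTrack_φφ hQ (isOuter_φ.not.2 hd)
  exact ⟨fun h => h.trans this.symm, fun h => h.trans this⟩

theorem side_fst_step (hQ : Q.InternalDegreesAtLeastFour) {o d : Q.Dart} (hd : ¬ Q.IsOuter d) :
    side hQ o (Q.step d).fst = side hQ o d.fst ↔ ¬ SameTrack o (Q.φ d) := by
  rw [fst_step hd, eq_comm, ← sameTrack_φφφ_iff hQ hd, ← side_snd_eq_iff hQ, snd_φφφ hd]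

theorem side_snd_step (hQ : Q.InternalDegreesAtLeastFour) {o d : Q.Dart} (hd : ¬ Q.IsOuter d) :
    side hQ o (Q.step d).snd = side hQ o d.snd ↔ ¬ SameTrack o (Q.φ d) := by
  rw [snd_step hd, ← side_snd_eq_iff hQ, RotationSystem.fst_facePerm]

/-- Walking alongside a track crosses its transversal tracks, each only once because two tracks
share at most one quadrangle; exactly these separate the ends of the walk. -/
theorem side_iterate_step_ne_iff (hQ : Q.InternalDegreesAtLeastFour) {o d : Q.Dart} {m : ℕ}
    (hd : ∀ k < m, ¬ Q.IsOuter (Q.step^[k] d)) :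
    side hQ o d.fst ≠ side hQ o (Q.step^[m] d).fst ↔
      ∃ k < m, SameTrack o (Q.φ (Q.step^[k] d)) := by
  induction m with
  | zero => simp
  | succ m ih =>
    have ih := ih fun k hk => hd k (by omega)
    have hm := hd m (by omega)
    rw [Function.iterate_succ_apply']
    have h1 := side_fst_step hQ (o := o) hm
    by_cases hc : SameTrack o (Q.φ (Q.step^[m] d))
    · have h2 : side hQ o d.fst = side hQ o (Q.step^[m] d).fst := by
        by_contra hcon
        obtain ⟨k, hk, hk'⟩ := ih.1 hcon
        refine face_iterate_step_ne hQ (m - k) (by omega) (Q.step^[k] d) (fun j hj => ?_) ?_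
        · rw [← Function.iterate_add_apply]
          exact hd _ (by omega)
        · rw [← Function.iterate_add_apply, Nat.sub_add_cancel hk.le]
          exact face_eq_of_crossing hQ hm (hd k (by omega))
            ((sameTrack_iterate d m).symm.trans (sameTrack_iterate d k)) (hc.symm.trans hk')
      rw [h2]
      refine ⟨fun _ => ⟨m, by omega, hc⟩, fun _ h => h1.1 h.symm hc⟩
    · rw [h1.2 hc, ih]
      constructor
      · rintro ⟨k, hk, h⟩
        exact ⟨k, by omega, h⟩
      · rintro ⟨k, hk, h⟩
        refine ⟨k, ?_, h⟩
        rcases (show k < m ∨ k = m by omega) with h' | rfl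
        · exact h'
        · exact absurd h hc

/-- The vertices along one side of a track form a geodesic. -/
theorem le_dist_fst_iterate_step (hQ : Q.InternalDegreesAtLeastFour) {d : Q.Dart} {m : ℕ}
    (hd : ∀ k < m, ¬ Q.IsOuter (Q.step^[k] d)) :
    m ≤ Q.graph.dist d.fst (Q.step^[m] d).fst := by
  have hcard : (sep hQ d.fst (Q.step^[m] d).fst).card = 2 * m := by
    induction m with
    | zero => simp [sep]
    | succ m ih =>
      have hd' : ∀ k < m, ¬ Q.IsOuter (Q.step^[k] d) := fun k hk => hd k (by omega)
      have h1 : sep hQ d.fst (Q.step^[m + 1] d).fst =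
          (sep hQ d.fst (Q.step^[m] d).fst).disjUnion (ends (Q.φ (Q.step^[m] d))) (by
            rw [Finset.disjoint_left]
            intro o ho ho'
            rw [mem_sep, side_iterate_step_ne_iff hQ hd'] at ho
            rw [mem_ends] at ho'
            obtain ⟨-, k, hk, hk'⟩ := ho
            refine face_iterate_step_ne hQ (m - k) (by omega) (Q.step^[k] d) (fun j hj => ?_) ?_
            · rw [← Function.iterate_add_apply]
              exact hd _ (by omega)
            · rw [← Function.iterate_add_apply, Nat.sub_add_cancel hk.le]
              exact face_eq_of_crossing hQ (hd m (by omega)) (hd k (by omega))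
                ((sameTrack_iterate d m).symm.trans (sameTrack_iterate d k))
                (ho'.2.symm.trans hk')) := by
        ext o
        rw [Finset.mem_disjUnion, mem_sep, mem_sep, mem_ends, side_iterate_step_ne_iff hQ hd,
          side_iterate_step_ne_iff hQ hd']
        constructor
        · rintro ⟨ho, k, hk, h⟩
          rcases (show k < m ∨ k = m by omega) with h' | rfl
          · exact Or.inl ⟨ho, k, h', h⟩
          · exact Or.inr ⟨ho, h⟩
        · rintro (⟨ho, k, hk, h⟩ | ⟨ho, h⟩)
          · exact ⟨ho, k, by omega, h⟩
          · exact ⟨ho, m, by omega, h⟩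
      rw [h1, Finset.card_disjUnion, ih hd', card_ends hQ]
      ring
  have := card_sep_le hQ d.fst (Q.step^[m] d).fst
  omega

theorem dist_snd_iterate_step_le {d : Q.Dart} {m : ℕ}
    (hd : ∀ k < m, ¬ Q.IsOuter (Q.step^[k] d)) :
    Q.graph.dist d.snd (Q.step^[m] d).snd ≤ m := by
  induction m with
  | zero => simp
  | succ m ih =>
    have h1 := ih fun k hk => hd k (by omega)
    have h2 := Q.connected.dist_triangle (u := d.snd) (v := (Q.step^[m] d).snd)
      (w := (Q.step^[m + 1] d).snd)
    have h3 : Q.graph.dist (Q.step^[m] d).snd (Q.step^[m + 1] d).snd = 1 := by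
      rw [Function.iterate_succ_apply', snd_step (hd m (by omega)), ← RotationSystem.fst_facePerm]
      exact SimpleGraph.dist_eq_one_iff_adj.2 (Q.φ _).adj
    omega

theorem side_fst_iterate_step (hQ : Q.InternalDegreesAtLeastFour) {o : Q.Dart} {i j : ℕ}
    (hi : 1 ≤ i) (hij : i ≤ j) (hj : j ≤ len o) :
    side hQ o (Q.step^[j] o).fst = side hQ o (Q.step^[i] o).fst := by
  induction j, hij using Nat.le_induction with
  | base => rfl
  | succ j hij ih =>
    rw [← ih (by omega), Function.iterate_succ_apply',
      side_fst_step hQ (not_isOuter_of_lt_len (by omega) hj)]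
    intro h
    exact not_sameTrack_φ hQ (not_isOuter_of_lt_len (d := o) (k := j) (by omega) hj)
      ((sameTrack_iterate o j).symm.trans h)

/-- Darts of one track that start on the same side of it point in the same direction across it, so
one lies ahead of the other. -/
theorem exists_parallel (hQ : Q.InternalDegreesAtLeastFour) {e g : Q.Dart} (h : SameTrack e g)
    (hs : side hQ e g.fst = side hQ e e.fst) : ∃ k,
      (g = Q.step^[k] e ∧ ∀ j < k, ¬ Q.IsOuter (Q.step^[j] e)) ∨
      (e = Q.step^[k] g ∧ ∀ j < k, ¬ Q.IsOuter (Q.step^[j] g)) := by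
  obtain ⟨o, ho, i, hi, hi', rfl⟩ := exists_coordinates hQ e
  rw [side_congr hQ (sameTrack_iterate o i).symm] at hs
  have hog : SameTrack o g := (sameTrack_iterate o i).trans h
  have hside : ∀ j, 1 ≤ j → j ≤ len o →
      side hQ o (Q.step^[j] o).fst = side hQ o (Q.step^[i] o).fst := by
    intro j hj hj'
    rcases le_total i j with hij | hij
    · exact side_fst_iterate_step hQ hi hij hj'
    · exact (side_fst_iterate_step hQ hj hij hi').symm
  have key : ∀ a b, 1 ≤ a → a ≤ b → b ≤ len o →
      (Q.step^[b] o = Q.step^[b - a] (Q.step^[a] o) ∧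
        ∀ j < b - a, ¬ Q.IsOuter (Q.step^[j] (Q.step^[a] o))) := by
    intro a b ha hab hb
    rw [← Function.iterate_add_apply, Nat.sub_add_cancel hab]
    refine ⟨rfl, fun j hj => ?_⟩
    rw [← Function.iterate_add_apply]
    exact not_isOuter_of_lt_len (by omega) (by omega)
  obtain ⟨j, hj, hj', rfl | rfl⟩ := (sameTrack_isOuter_iff hQ ho).1 hog
  · rcases le_total i j with hij | hij
    · exact ⟨j - i, Or.inl (key i j hi hij hj')⟩
    · exact ⟨i - j, Or.inr (key j i hj hij hi')⟩
  · exfalso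
    have h1 : side hQ o (Q.step^[j] (exit o)).snd = side hQ o (Q.step^[i] o).fst := by
      rw [iterate_step_exit hQ hj hj']
      exact hside _ (by omega) (by omega)
    exact (side_snd_eq_iff hQ).1 (h1.trans hs.symm) hog

theorem exists_crossing_dart (hQ : Q.InternalDegreesAtLeastFour) (e : Q.Dart) {y z : V}
    (h : side hQ e y ≠ side hQ e z) : ∃ f : Q.Dart,
      Q.graph.dist y f.fst + 1 + Q.graph.dist f.snd z = Q.graph.dist y z ∧
      side hQ e f.fst = side hQ e y ∧ side hQ e f.snd ≠ side hQ e y := by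
  generalize hn : Q.graph.dist y z = n
  induction n generalizing y with
  | zero =>
    rw [Q.connected.dist_eq_zero_iff] at hn
    exact absurd (hn ▸ rfl) h
  | succ n ih =>
    have hyz : y ≠ z := by rintro rfl; exact h rfl
    obtain ⟨d, rfl, hd⟩ := exists_dart_dist (Q := Q) hyz
    by_cases hc : side hQ e d.snd = side hQ e d.fst
    · obtain ⟨f, hf1, hf2, hf3⟩ := ih (y := d.snd) (by rwa [hc]) (by omega)
      refine ⟨f, ?_, hf2.trans hc, by rwa [← hc]⟩
      have h1 := Q.connected.dist_triangle (u := d.fst) (v := d.snd) (w := f.fst)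
      have h2 := Q.connected.dist_triangle (u := d.fst) (v := f.fst) (w := z)
      have h3 := Q.connected.dist_triangle (u := f.fst) (v := f.snd) (w := z)
      rw [SimpleGraph.dist_eq_one_iff_adj.2 d.adj] at h1
      rw [SimpleGraph.dist_eq_one_iff_adj.2 f.adj] at h3
      omega
    · refine ⟨d, ?_, rfl, hc⟩
      rw [SimpleGraph.dist_self]
      omega

/-- Otherwise a geodesic from `y` to `e.fst` crosses the track at some `f`. The two borders of the
track between `f` and `e` satisfy `d(f.fst, e.snd) ≤ k ≤ d(f.snd, e.fst)`, so staying on the side of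
`y` reaches `e.snd` sooner than `e.fst`. -/
theorem side_eq_of_dist_lt (hQ : Q.InternalDegreesAtLeastFour) {e : Q.Dart} {y : V}
    (h : Q.graph.dist y e.fst < Q.graph.dist y e.snd) : side hQ e y = side hQ e e.fst := by
  by_contra hcon
  obtain ⟨f, hf1, hf2, hf3⟩ := exists_crossing_dart hQ e hcon
  have hfe : side hQ e f.snd = side hQ e e.fst := ZMod.eq_of_ne_of_ne hf3 (Ne.symm hcon)
  have htr : SameTrack e f.symm := by
    rw [sameTrack_dart_symm_iff hQ]
    by_contra hc
    exact hf3 (((side_snd_eq_iff hQ).2 hc).trans hf2)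
  have h2 := Q.connected.dist_triangle (u := y) (v := f.fst) (w := e.snd)
  have hk : ∃ k, k ≤ Q.graph.dist f.snd e.fst ∧ Q.graph.dist f.fst e.snd ≤ k := by
    obtain ⟨k, ⟨h3, h4⟩ | ⟨h3, h4⟩⟩ := exists_parallel hQ htr hfe
    · have h5 := le_dist_fst_iterate_step hQ h4
      have h6 := dist_snd_iterate_step_le h4
      rw [← h3, SimpleGraph.dist_comm] at h5 h6
      exact ⟨k, h5, h6⟩
    · have h5 := le_dist_fst_iterate_step hQ h4
      have h6 := dist_snd_iterate_step_le h4
      rw [← h3] at h5 h6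
      exact ⟨k, h5, h6⟩
  obtain ⟨k, h5, h6⟩ := hk
  omega

/-- The side of a track on which a vertex lies is determined by distances. -/
theorem side_eq_iff_dist_lt (hQ : Q.InternalDegreesAtLeastFour) {e : Q.Dart} {y : V} :
    side hQ e y = side hQ e e.fst ↔ Q.graph.dist y e.fst < Q.graph.dist y e.snd := by
  refine ⟨fun h => ?_, side_eq_of_dist_lt hQ⟩
  by_contra hcon
  have h1 := dist_ne_of_adj e.adj y
  have h2 := side_eq_of_dist_lt hQ (e := e.symm) (y := y) (by
    simp only [SimpleGraph.Dart.symm_toProd, Prod.fst_swap, Prod.snd_swap]; omega)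
  rw [side_congr hQ (sameTrack_dart_symm hQ e).symm] at h2
  exact (side_snd_eq_iff hQ).1 (h2.symm.trans h) (SameTrack.refl e)

/-- The distance of two vertices is the number of tracks that separate them. -/
theorem card_sep (hQ : Q.InternalDegreesAtLeastFour) (x y : V) :
    (sep hQ x y).card = 2 * Q.graph.dist x y := by
  generalize hn : Q.graph.dist x y = n
  induction n generalizing x with
  | zero =>
    rw [Q.connected.dist_eq_zero_iff] at hn
    simp [sep, hn]
  | succ n ih =>
    have hxy : x ≠ y := by
      rintro rfl
      simp at hn
    obtain ⟨d, rfl, hd⟩ := exists_dart_dist (Q := Q) hxy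
    have h1 := ih d.snd (by omega)
    -- The first edge of a geodesic leads closer to `y`, so its track does not separate the rest.
    have h2 : ∀ o, SameTrack o d → side hQ o y = side hQ o d.snd := by
      intro o ho
      rw [side_congr hQ (ho.trans (sameTrack_dart_symm hQ d))]
      refine side_eq_of_dist_lt hQ (e := d.symm) ?_
      simp only [SimpleGraph.Dart.symm_toProd, Prod.fst_swap, Prod.snd_swap]
      rw [SimpleGraph.dist_comm, SimpleGraph.dist_comm (u := y)]
      omega
    have h3 : sep hQ d.fst y = (sep hQ d.snd y).disjUnion (ends d) (by
        rw [Finset.disjoint_left]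
        intro o ho ho'
        rw [mem_sep] at ho
        rw [mem_ends] at ho'
        exact ho.2 (h2 o ho'.2).symm) := by
      ext o
      rw [Finset.mem_disjUnion, mem_sep, mem_sep, mem_ends, ← and_or_left]
      refine and_congr_right fun _ => ?_
      by_cases hod : SameTrack o d
      · rw [h2 o hod]
        simp only [hod, ne_eq, not_true_eq_false, or_true, iff_true]
        exact fun h => (side_snd_eq_iff hQ).1 h.symm hod
      · simp [hod, (side_snd_eq_iff hQ).2 hod]
    rw [h3, Finset.card_disjUnion, h1, card_ends hQ]
    ring

end

end DiscQuadrangulation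

namespace DiscQuadrangulation

section

open scoped Classical

variable {V W : Type*} [Finite V] [Finite W] {Q : DiscQuadrangulation V}

/-! ### The order of the crossings along a track -/

/-- The first step merely reverses `o`, so all later darts start on the side of `o.snd`, not of
`o.fst`. -/
theorem side_fst_iterate (hQ : Q.InternalDegreesAtLeastFour) {o : Q.Dart} (ho : Q.IsOuter o)
    {i : ℕ} (hi : 1 ≤ i) (hi' : i ≤ len o) :
    side hQ o (Q.step^[i] o).fst = side hQ o o.snd := by
  rw [side_fst_iterate_step hQ le_rfl hi hi']
  change side hQ o (Q.step o).fst = _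
  rw [step_of_isOuter ho]; rfl

theorem side_snd_iterate (hQ : Q.InternalDegreesAtLeastFour) {o : Q.Dart} (ho : Q.IsOuter o)
    {i : ℕ} (hi : 1 ≤ i) (hi' : i ≤ len o) :
    side hQ o (Q.step^[i] o).snd = side hQ o o.fst := by
  refine ZMod.eq_of_ne_of_ne (b := side hQ o o.snd) ?_ ?_
  · rw [← side_fst_iterate hQ ho hi hi']
    exact fun h => (side_snd_eq_iff hQ).1 h (sameTrack_iterate o i)
  · exact fun h => (side_snd_eq_iff hQ).1 h.symm (SameTrack.refl o)

theorem side_snd_iterate_eq (hQ : Q.InternalDegreesAtLeastFour) {e o : Q.Dart} {a b : ℕ}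
    (ha : 1 ≤ a) (hab : a ≤ b) (hb : b ≤ len o)
    (h : ∀ l, a ≤ l → l < b → ¬ SameTrack e (Q.φ (Q.step^[l] o))) :
    side hQ e (Q.step^[b] o).snd = side hQ e (Q.step^[a] o).snd := by
  induction b, hab using Nat.le_induction with
  | base => rfl
  | succ b hab ih =>
    rw [← ih (by omega) fun l h1 h2 => h l h1 (by omega), Function.iterate_succ_apply',
      side_snd_step hQ (not_isOuter_of_lt_len (by omega) hb)]
    exact h b hab (by omega)

theorem snd_step_of_isOuter {o : Q.Dart} (ho : Q.IsOuter o) : (Q.step^[1] o).snd = o.fst := by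
  change (Q.step o).snd = _
  rw [step_of_isOuter ho]; rfl

theorem crossing_index_unique (hQ : Q.InternalDegreesAtLeastFour) {e o : Q.Dart} {j l : ℕ}
    (hj : 1 ≤ j) (hj' : j < len o) (hl : 1 ≤ l) (hl' : l < len o)
    (h : SameTrack e (Q.φ (Q.step^[j] o))) (h' : SameTrack e (Q.φ (Q.step^[l] o))) : j = l :=
  face_iterate_injective hQ hj hj' hl hl' (face_eq_of_crossing hQ (not_isOuter_of_lt_len hj hj')
    (not_isOuter_of_lt_len hl hl') ((sameTrack_iterate o j).symm.trans (sameTrack_iterate o l))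
    (h.symm.trans h'))

/-- The `i`-th quadrangle on the track from the outer dart `o` is the `j`-th one on the track from
`o'`, which crosses the former from its left to its right. -/
def Hits (o : Q.Dart) (i : ℕ) (o' : Q.Dart) (j : ℕ) : Prop :=
  1 ≤ i ∧ i < len o ∧ 1 ≤ j ∧ j < len o' ∧ Q.φ (Q.step^[i] o) = Q.step^[j] o'

theorem exists_hits (hQ : Q.InternalDegreesAtLeastFour) {o : Q.Dart} {i : ℕ} (hi : 1 ≤ i)
    (hi' : i < len o) : ∃ o' j, Q.IsOuter o' ∧ Hits o i o' j := by
  obtain ⟨o', ho', j, hj, hj', h⟩ := exists_coordinates hQ (Q.φ (Q.step^[i] o))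
  refine ⟨o', j, ho', hi, hi', hj, lt_of_le_of_ne hj' fun hcon => ?_, h⟩
  have h1 := isOuter_φ.not.2 (not_isOuter_of_lt_len hi hi')
  rw [h, hcon] at h1
  exact h1 (isOuter_exit hQ o')

namespace Hits

variable {o o' o'' : Q.Dart} {i j k l : ℕ}

/-- Applying `φ` twice gives the opposite dart, which is the reverse of the next dart along `o`. It
belongs to the track run from its other end, with the index counted from there. -/
theorem reverse (hQ : Q.InternalDegreesAtLeastFour) (ho : Q.IsOuter o) (h : Hits o i o' j) :
    Hits o' j (exit o) (len o - i) := by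
  obtain ⟨h1, h2, h3, h4, h5⟩ := h
  refine ⟨h3, h4, by omega, by rw [len_exit hQ ho]; omega, ?_⟩
  rw [← h5, ← opp_of_not_isOuter (not_isOuter_of_lt_len h1 h2), ← symm_step,
    ← Function.iterate_succ_apply' (f := Q.step), symm_iterate_step hQ (by omega),
    show len o + 1 - (i + 1) = len o - i by omega]

theorem sameTrack_left (h : Hits o i o' j) : SameTrack o' (Q.φ (Q.step^[i] o)) :=
  h.2.2.2.2 ▸ sameTrack_iterate o' j

theorem sameTrack_right (hQ : Q.InternalDegreesAtLeastFour) (h : Hits o i o' j) :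
    SameTrack o (Q.φ (Q.step^[j] o')) := by
  rw [← h.2.2.2.2]
  exact (sameTrack_iterate o i).trans (sameTrack_φφ hQ (not_isOuter_of_lt_len h.1 h.2.1))

theorem crosses (h : Hits o i o' j) : Crosses o o' :=
  ⟨_, not_isOuter_of_lt_len h.1 h.2.1, sameTrack_iterate o i, h.sameTrack_left⟩

theorem index_unique (hQ : Q.InternalDegreesAtLeastFour) (h : Hits o i o' j)
    (h' : Hits o k o' l) : i = k :=
  crossing_index_unique hQ h.1 h.2.1 h'.1 h'.2.1 h.sameTrack_left h'.sameTrack_left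

theorem track_unique (ho' : Q.IsOuter o') (ho'' : Q.IsOuter o'') (h : Hits o i o' j)
    (h' : Hits o i o'' l) : o' = o'' :=
  (coordinates_unique ho' ho'' h.2.2.1 h.2.2.2.1.le h'.2.2.1 h'.2.2.2.1.le
    (h.2.2.2.2.symm.trans h'.2.2.2.2)).1

theorem side_fst (hQ : Q.InternalDegreesAtLeastFour) (ho : Q.IsOuter o) (ho' : Q.IsOuter o')
    (h : Hits o i o' j) : side hQ o o'.fst = side hQ o o.fst := by
  rw [← snd_step_of_isOuter ho', ← side_snd_iterate_eq hQ le_rfl h.2.2.1 h.2.2.2.1.le,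
    ← h.2.2.2.2, ← side_snd_iterate hQ ho h.1 h.2.1.le,
    ← RotationSystem.fst_facePerm Q.rot (Q.step^[i] o)]
  · exact (side_snd_eq_iff hQ).2 fun hcon => h.crosses.not_sameTrack hQ
      (hcon.trans h.sameTrack_left.symm)
  · intro a ha ha' hcon
    exact ha'.ne (crossing_index_unique hQ ha (ha'.trans h.2.2.2.1) h.2.2.1 h.2.2.2.1 hcon
      (h.sameTrack_right hQ))

theorem side_fst_exit (hQ : Q.InternalDegreesAtLeastFour) (ho : Q.IsOuter o) (ho' : Q.IsOuter o')
    (h : Hits o i o' j) : side hQ o (exit o').fst ≠ side hQ o o.fst := by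
  have h0 : ∀ a, 1 ≤ a → a < len o' → a ≠ j → ¬ SameTrack o (Q.φ (Q.step^[a] o')) :=
    fun a ha ha' haj hcon => haj (crossing_index_unique hQ ha ha' h.2.2.1 h.2.2.2.1 hcon
      (h.sameTrack_right hQ))
  have h1 : side hQ o (exit o').snd = side hQ o (exit o').fst :=
    (side_snd_eq_iff hQ).2 fun hcon => h.crosses.not_sameTrack hQ
      (hcon.trans (sameTrack_exit o').symm)
  have h2 : side hQ o (exit o').snd = side hQ o (Q.step^[j + 1] o').snd :=
    side_snd_iterate_eq hQ (by omega) h.2.2.2.1 le_rfl fun a ha ha' =>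
      h0 a (by omega) ha' (by omega)
  have h3 : side hQ o (Q.step^[j] o').snd = side hQ o (Q.step^[1] o').snd :=
    side_snd_iterate_eq hQ le_rfl h.2.2.1 h.2.2.2.1.le fun a ha ha' =>
      h0 a ha (ha'.trans h.2.2.2.1) ha'.ne
  rw [← h1, h2, ← h.side_fst hQ ho ho', ← snd_step_of_isOuter ho', ← h3,
    Function.iterate_succ_apply']
  intro hcon
  exact (side_snd_step hQ (not_isOuter_of_lt_len h.2.2.1 h.2.2.2.1)).1 hcon (h.sameTrack_right hQ)

/-- The order of the crossings along a track is determined by the sides of the crossing tracks. -/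
theorem side_fst_iff (hQ : Q.InternalDegreesAtLeastFour) (ho : Q.IsOuter o) (ho' : Q.IsOuter o')
    (ho'' : Q.IsOuter o'') (h : Hits o i o' j) (h' : Hits o k o'' l) :
    side hQ o' o''.fst = side hQ o' o'.fst ↔ i ≤ k := by
  have h0 : ∀ a, 1 ≤ a → a < len o → a ≠ i → ¬ SameTrack o' (Q.φ (Q.step^[a] o)) :=
    fun a ha ha' hai hcon => hai (crossing_index_unique hQ ha ha' h.1 h.2.1 hcon h.sameTrack_left)
  have h1 : side hQ o' (Q.step^[i + 1] o).snd = side hQ o' o'.fst := by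
    rw [Function.iterate_succ_apply', snd_step (not_isOuter_of_lt_len h.1 h.2.1), h.2.2.2.2,
      side_snd_iterate hQ ho' h.2.2.1 h.2.2.2.1.le]
  -- Both tracks cross that of `o`, so they do not cross each other: `o''` starts on the same side
  -- of the track of `o'` as it meets the track of `o`.
  have h2 : side hQ o' o''.fst = side hQ o' (Q.step^[k + 1] o).snd := by
    rw [Function.iterate_succ_apply', snd_step (not_isOuter_of_lt_len h'.1 h'.2.1), h'.2.2.2.2,
      ← snd_step_of_isOuter ho'']
    refine (side_snd_iterate_eq hQ le_rfl h'.2.2.1 h'.2.2.2.1.le fun a ha ha' hcon => ?_).symm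
    refine not_crosses_of_crosses hQ ho ho' ho'' h.crosses ?_ (h'.crosses.symm hQ)
    exact Crosses.symm hQ ⟨_, not_isOuter_of_lt_len ha (ha'.trans h'.2.2.2.1),
      sameTrack_iterate o'' a, hcon⟩
  rw [h2, ← h1]
  constructor
  · intro h3
    by_contra hcon
    have h4 : side hQ o' (Q.step^[i] o).snd = side hQ o' (Q.step^[k + 1] o).snd :=
      side_snd_iterate_eq hQ (by omega) (by omega) h.2.1.le fun a ha ha' =>
        h0 a (by omega) (ha'.trans h.2.1) ha'.ne
    rw [← h4, Function.iterate_succ_apply'] at h3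
    exact (side_snd_step hQ (not_isOuter_of_lt_len h.1 h.2.1)).1 h3.symm h.sameTrack_left
  · intro hik
    exact side_snd_iterate_eq hQ (by omega) (by omega) h'.2.1 fun a ha ha' =>
      h0 a (by omega) (by have := h'.2.1; omega) (by omega)

end Hits

/-- The outer darts whose tracks cross the track of `o` from its left to its right. -/
noncomputable def crossers (hQ : Q.InternalDegreesAtLeastFour) (o : Q.Dart) : Finset Q.Dart :=
  Finset.univ.filter fun o' => Q.IsOuter o' ∧ ¬ SameTrack o o' ∧
    side hQ o o'.fst = side hQ o o.fst ∧ side hQ o (exit o').fst ≠ side hQ o o.fst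

theorem mem_crossers (hQ : Q.InternalDegreesAtLeastFour) {o o' : Q.Dart} :
    o' ∈ crossers hQ o ↔ Q.IsOuter o' ∧ ¬ SameTrack o o' ∧
      side hQ o o'.fst = side hQ o o.fst ∧ side hQ o (exit o').fst ≠ side hQ o o.fst := by
  simp [crossers]

theorem Hits.mem_crossers (hQ : Q.InternalDegreesAtLeastFour) {o o' : Q.Dart} {i j : ℕ}
    (ho : Q.IsOuter o) (ho' : Q.IsOuter o') (h : Hits o i o' j) : o' ∈ crossers hQ o :=
  (DiscQuadrangulation.mem_crossers hQ).2 ⟨ho', h.crosses.not_sameTrack hQ, h.side_fst hQ ho ho',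
    h.side_fst_exit hQ ho ho'⟩

theorem exists_hits_of_mem_crossers (hQ : Q.InternalDegreesAtLeastFour) {o o' : Q.Dart}
    (ho : Q.IsOuter o) (h : o' ∈ crossers hQ o) : ∃ i j, Hits o i o' j := by
  obtain ⟨ho', hne, h1, h2⟩ := (mem_crossers hQ).1 h
  have hex : ∃ l, 1 ≤ l ∧ l < len o' ∧ SameTrack o (Q.φ (Q.step^[l] o')) := by
    by_contra! hcon
    have h3 := side_snd_iterate_eq hQ (e := o) le_rfl (one_le_len hQ o') le_rfl hcon
    rw [snd_step_of_isOuter ho', h1] at h3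
    refine h2 (h3 ▸ ?_)
    exact ((side_snd_eq_iff hQ).2 fun hc => hne (hc.trans (sameTrack_exit o').symm)).symm
  obtain ⟨l, hl, hl', hl''⟩ := hex
  have hlo := not_isOuter_of_lt_len hl hl'
  obtain ⟨k, hk, hk', hk''⟩ := exists_index hQ ho (isOuter_φ.not.2 hlo) hl''
  refine ⟨k, l, hk, hk', hl, hl', ?_⟩
  rcases hk'' with h4 | h4
  -- This would be a crossing from right to left, but up to its crossing the track of `o'` stays on
  -- the side where it starts.
  · exfalso
    have h5 : side hQ o (Q.step^[l] o').snd = side hQ o (Q.step^[1] o').snd :=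
      side_snd_iterate_eq hQ le_rfl hl hl'.le fun a ha ha' hcon =>
        ha'.ne (crossing_index_unique hQ ha (ha'.trans hl') hl hl' hcon hl'')
    rw [snd_step_of_isOuter ho', h1, ← RotationSystem.fst_facePerm Q.rot, h4,
      side_fst_iterate hQ ho hk hk'.le] at h5
    exact (side_snd_eq_iff hQ).1 h5 (SameTrack.refl o)
  · have h5 := congrArg (fun d => Q.opp (Q.φ d)) h4
    simp only [φ_opp, opp_opp] at h5
    rw [← h5, ← opp_of_not_isOuter hlo, opp_opp]

/-- Each of the `len o - 1` quadrangles along the track gives one crossing track, and different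
quadrangles give different ones. -/
theorem card_crossers (hQ : Q.InternalDegreesAtLeastFour) {o : Q.Dart} (ho : Q.IsOuter o) :
    (crossers hQ o).card + 1 = len o := by
  have : Nonempty Q.Dart := ⟨o⟩
  choose! f g hf hg using fun (i : ℕ) (hi : 1 ≤ i ∧ i < len o) => exists_hits hQ hi.1 hi.2
  have h := Finset.card_nbij (s := Finset.Ico 1 (len o)) (t := crossers hQ o) f
    (fun i hi => (hg i (Finset.mem_Ico.1 hi)).mem_crossers hQ ho (hf i (Finset.mem_Ico.1 hi)))
    (fun i hi k hk hik => by
      have h1 := hg i (Finset.mem_Ico.1 hi)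
      have h2 := hg k (Finset.mem_Ico.1 hk)
      rw [← hik] at h2
      exact h1.index_unique hQ h2)
    (fun o' ho' => by
      obtain ⟨i, j, hij⟩ := exists_hits_of_mem_crossers hQ ho ho'
      have hi : 1 ≤ i ∧ i < len o := ⟨hij.1, hij.2.1⟩
      exact ⟨i, Finset.mem_coe.2 (Finset.mem_Ico.2 hi),
        (hg i hi).track_unique (hf i hi) ((mem_crossers hQ).1 ho').1 hij⟩)
  rw [Nat.card_Ico] at h
  have := one_le_len hQ o
  omega

/-- The tracks met before `o'` are the crossers starting on the other side of it, so the position is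
one more than their number. -/
theorem Hits.card_filter_crossers (hQ : Q.InternalDegreesAtLeastFour) {o o' : Q.Dart} {i j : ℕ}
    (ho : Q.IsOuter o) (ho' : Q.IsOuter o') (h : Hits o i o' j) :
    ((crossers hQ o).filter fun o'' => side hQ o' o''.fst ≠ side hQ o' o'.fst).card + 1 = i := by
  have : Nonempty Q.Dart := ⟨o⟩
  choose! f g hf hg using fun (i : ℕ) (hi : 1 ≤ i ∧ i < len o) => exists_hits hQ hi.1 hi.2
  have hlt : ∀ k ∈ Finset.Ico 1 i, 1 ≤ k ∧ k < len o := fun k hk => by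
    have := Finset.mem_Ico.1 hk
    exact ⟨this.1, this.2.trans h.2.1⟩
  have h := Finset.card_nbij (s := Finset.Ico 1 i) (t := (crossers hQ o).filter fun o'' =>
      side hQ o' o''.fst ≠ side hQ o' o'.fst) f
    (fun k hk => by
      have hk' := hlt k hk
      refine Finset.mem_filter.2 ⟨(hg k hk').mem_crossers hQ ho (hf k hk'), ?_⟩
      rw [Ne, h.side_fst_iff hQ ho ho' (hf k hk') (hg k hk')]
      exact not_le.2 (Finset.mem_Ico.1 hk).2)
    (fun i hi k hk hik => by
      have h1 := hg i (hlt i hi)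
      have h2 := hg k (hlt k hk)
      rw [← hik] at h2
      exact h1.index_unique hQ h2)
    (fun o'' ho'' => by
      obtain ⟨hm, hs⟩ := Finset.mem_filter.1 ho''
      have hout := ((DiscQuadrangulation.mem_crossers hQ).1 hm).1
      obtain ⟨k, l, hkl⟩ := exists_hits_of_mem_crossers hQ ho hm
      rw [Ne, h.side_fst_iff hQ ho ho' hout hkl, not_le] at hs
      have hk : 1 ≤ k ∧ k < len o := ⟨hkl.1, hkl.2.1⟩
      exact ⟨k, Finset.mem_coe.2 (Finset.mem_Ico.2 ⟨hk.1, hs⟩),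
        (hg k hk).track_unique (hf k hk) hout hkl⟩)
  rw [Nat.card_Ico] at h
  have := ‹Hits o i o' j›.1
  omega

end

end DiscQuadrangulation

namespace DiscQuadrangulation

section

open scoped Classical

variable {V W : Type*} [Finite V] [Finite W] {Q : DiscQuadrangulation V}
  {R : DiscQuadrangulation W}

/-! ### Reconstruction from the boundary -/

/-- A bijection of the sets of darts that respects reversal and rotation is induced by a
graph isomorphism. -/
theorem exists_iso_of_dart_bijective (Φ : Q.Dart → R.Dart) (hΦ : Function.Bijective Φ)
    (hs : ∀ d, Φ d.symm = (Φ d).symm) (hn : ∀ d, Φ (Q.rot.next d) = R.rot.next (Φ d)) :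
    ∃ f : Q.graph ≃g R.graph, ∀ d, f.toHom.mapDart d = Φ d := by
  -- Vertices are the cycles of `next`, so a map of darts commuting with `next` acts on vertices.
  have hpow : ∀ (n : ℕ) d, Φ ((Q.rot.next ^ n) d) = (R.rot.next ^ n) (Φ d) := by
    intro n d
    induction n with
    | zero => rfl
    | succ n ih => rw [pow_succ', pow_succ', Equiv.Perm.mul_apply, Equiv.Perm.mul_apply, hn, ih]
  have hfst : ∀ d e, (Φ d).fst = (Φ e).fst ↔ d.fst = e.fst := by
    intro d e
    rw [← Q.rot.sameCycle_iff, ← R.rot.sameCycle_iff]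
    constructor
    · intro h
      obtain ⟨n, -, hn⟩ := h.exists_pow_eq'
      rw [← hpow] at hn
      exact ⟨n, by simpa using hΦ.1 hn⟩
    · intro h
      obtain ⟨n, -, hn⟩ := h.exists_pow_eq'
      exact ⟨n, by rw [zpow_natCast, ← hpow, hn]⟩
  choose dart hdart using exists_dart_fst (Q := Q)
  have hf : ∀ d : Q.Dart, (Φ (dart d.fst)).fst = (Φ d).fst := fun d => (hfst _ _).2 (hdart _)
  have hsnd : ∀ d : Q.Dart, (Φ (dart d.snd)).fst = (Φ d).snd := fun d => by
    rw [show d.snd = d.symm.fst from rfl, hf, hs]; rfl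
  have hbij : Function.Bijective fun v => (Φ (dart v)).fst := by
    constructor
    · intro u v huv
      have := (hfst _ _).1 huv
      rwa [hdart, hdart] at this
    · intro w
      obtain ⟨e, rfl⟩ := exists_dart_fst (Q := R) w
      obtain ⟨d, rfl⟩ := hΦ.2 e
      exact ⟨d.fst, hf d⟩
  refine ⟨⟨Equiv.ofBijective _ hbij, ?_⟩, fun d => ?_⟩
  · intro u v
    constructor
    · intro h
      obtain ⟨d, hd⟩ := hΦ.2 ⟨((Φ (dart u)).fst, (Φ (dart v)).fst), h⟩
      have h1 : (Φ d).fst = (Φ (dart u)).fst := by rw [hd]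
      have h2 : (Φ d).snd = (Φ (dart v)).fst := by rw [hd]
      have h3 := (hfst _ _).1 h1
      rw [← hsnd] at h2
      have h4 := (hfst _ _).1 h2
      rw [hdart] at h3
      rw [hdart, hdart] at h4
      rw [← h3, ← h4]
      exact d.adj
    · intro h
      have h1 := hf ⟨(u, v), h⟩
      have h2 := hsnd ⟨(u, v), h⟩
      simp only [Equiv.ofBijective_apply]
      dsimp only at h1 h2
      rw [h1, h2]
      exact (Φ _).adj
  · apply SimpleGraph.Dart.ext
    exact Prod.ext (hf d) (hsnd d)

/-- A correspondence of the boundaries that respects the orientation and the distances. -/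
structure BoundaryMatch (Q : DiscQuadrangulation V) (R : DiscQuadrangulation W)
    (b : Q.Dart → R.Dart) : Prop where
  isOuter : ∀ o, Q.IsOuter o → R.IsOuter (b o)
  injective : ∀ o o', Q.IsOuter o → Q.IsOuter o' → b o = b o' → o = o'
  surjective : ∀ o', R.IsOuter o' → ∃ o, Q.IsOuter o ∧ b o = o'
  map_φ : ∀ o, Q.IsOuter o → b (Q.φ o) = R.φ (b o)
  dist_eq : ∀ o o', Q.IsOuter o → Q.IsOuter o' →
    R.graph.dist (b o).fst (b o').fst = Q.graph.dist o.fst o'.fst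

namespace BoundaryMatch

variable {b : Q.Dart → R.Dart}

theorem dist_snd_eq (hb : BoundaryMatch Q R b) {o o' : Q.Dart} (ho : Q.IsOuter o)
    (ho' : Q.IsOuter o') : R.graph.dist (b o).fst (b o').snd = Q.graph.dist o.fst o'.snd := by
  rw [← RotationSystem.fst_facePerm, ← RotationSystem.fst_facePerm, ← hb.map_φ o' ho',
    hb.dist_eq o _ ho (isOuter_φ.2 ho')]

/-- Both ends of an outer dart are boundary vertices, and the distances to them decide the side. -/
theorem side_iff (hQ : Q.InternalDegreesAtLeastFour) (hR : R.InternalDegreesAtLeastFour)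
    (hb : BoundaryMatch Q R b) {e o : Q.Dart} (he : Q.IsOuter e) (ho : Q.IsOuter o) :
    side hR (b e) (b o).fst = side hR (b e) (b e).fst ↔ side hQ e o.fst = side hQ e e.fst := by
  rw [side_eq_iff_dist_lt, side_eq_iff_dist_lt, hb.dist_eq o e ho he, hb.dist_snd_eq ho he]

theorem sameTrack_iff (hQ : Q.InternalDegreesAtLeastFour) (hR : R.InternalDegreesAtLeastFour)
    (hb : BoundaryMatch Q R b) {e o : Q.Dart} (he : Q.IsOuter e) (ho : Q.IsOuter o) :
    SameTrack (b e) (b o) ↔ SameTrack e o := by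
  have h1 := hb.side_iff hQ hR he ho
  have h2 := hb.side_iff hQ hR he (isOuter_φ.2 ho)
  rw [hb.map_φ o ho, RotationSystem.fst_facePerm, RotationSystem.fst_facePerm] at h2
  -- There are only two sides, so comparison with the side of `e.fst` also tells whether both ends
  -- of `o` lie on the same side.
  have key : ∀ (x y z x' y' z' : ZMod 2), (x = z ↔ x' = z') → (y = z ↔ y' = z') →
      (y = x ↔ y' = x') := by decide
  have h3 := key _ _ _ _ _ _ h1 h2
  rw [side_snd_eq_iff, side_snd_eq_iff] at h3
  exact not_iff_not.1 h3

theorem exit_eq (hQ : Q.InternalDegreesAtLeastFour) (hR : R.InternalDegreesAtLeastFour)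
    (hb : BoundaryMatch Q R b) {o : Q.Dart} (ho : Q.IsOuter o) : exit (b o) = b (exit o) := by
  have ho' := isOuter_exit hQ o
  have h1 := (hb.sameTrack_iff hQ hR ho ho').2 (sameTrack_exit o)
  rcases (isOuter_sameTrack_iff hR (hb.isOuter o ho) (hb.isOuter _ ho')).1 h1 with h | h
  · exact absurd (hb.injective _ _ ho' ho h) (exit_ne hQ o)
  · exact h.symm

theorem mem_crossers_iff (hQ : Q.InternalDegreesAtLeastFour) (hR : R.InternalDegreesAtLeastFour)
    (hb : BoundaryMatch Q R b) {e o : Q.Dart} (he : Q.IsOuter e) (ho : Q.IsOuter o) :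
    b o ∈ crossers hR (b e) ↔ o ∈ crossers hQ e := by
  rw [mem_crossers, mem_crossers, hb.sameTrack_iff hQ hR he ho, hb.side_iff hQ hR he ho,
    hb.exit_eq hQ hR ho, Ne, hb.side_iff hQ hR he (isOuter_exit hQ o)]
  simp [ho, hb.isOuter o ho]

theorem card_filter_crossers (hQ : Q.InternalDegreesAtLeastFour)
    (hR : R.InternalDegreesAtLeastFour) (hb : BoundaryMatch Q R b) {e : Q.Dart}
    (he : Q.IsOuter e) (P : Q.Dart → Prop) (P' : R.Dart → Prop)
    [DecidablePred P] [DecidablePred P']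
    (hP : ∀ o, Q.IsOuter o → (P' (b o) ↔ P o)) :
    ((crossers hR (b e)).filter P').card = ((crossers hQ e).filter P).card := by
  symm
  refine Finset.card_nbij b (fun o ho => ?_) (fun o ho o' ho' h => ?_) (fun o' ho' => ?_)
  · obtain ⟨h1, h2⟩ := Finset.mem_filter.1 ho
    have h3 := ((mem_crossers hQ).1 h1).1
    exact Finset.mem_filter.2 ⟨(hb.mem_crossers_iff hQ hR he h3).2 h1, (hP o h3).2 h2⟩
  · have h1 := ((mem_crossers hQ).1 (Finset.mem_filter.1 ho).1).1
    have h2 := ((mem_crossers hQ).1 (Finset.mem_filter.1 ho').1).1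
    exact hb.injective o o' h1 h2 h
  · obtain ⟨h1, h2⟩ := Finset.mem_filter.1 ho'
    obtain ⟨o, ho, rfl⟩ := hb.surjective o' ((mem_crossers hR).1 h1).1
    exact ⟨o, Finset.mem_filter.2 ⟨(hb.mem_crossers_iff hQ hR he ho).1 h1, (hP o ho).1 h2⟩, rfl⟩

theorem len_eq (hQ : Q.InternalDegreesAtLeastFour) (hR : R.InternalDegreesAtLeastFour)
    (hb : BoundaryMatch Q R b) {o : Q.Dart} (ho : Q.IsOuter o) : len (b o) = len o := by
  rw [← card_crossers hQ ho, ← card_crossers hR (hb.isOuter o ho)]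
  have := hb.card_filter_crossers hQ hR ho (fun _ => True) (fun _ => True) (fun _ _ => Iff.rfl)
  simpa using this

theorem index_eq (hQ : Q.InternalDegreesAtLeastFour) (hR : R.InternalDegreesAtLeastFour)
    (hb : BoundaryMatch Q R b) {o o' : Q.Dart} (ho : Q.IsOuter o) (ho' : Q.IsOuter o')
    {i j k l : ℕ} (h : Hits o i o' j) (h' : Hits (b o) k (b o') l) : k = i := by
  rw [← h.card_filter_crossers hQ ho ho',
    ← h'.card_filter_crossers hR (hb.isOuter o ho) (hb.isOuter o' ho')]
  congr 1
  exact hb.card_filter_crossers hQ hR ho (fun o'' => side hQ o' o''.fst ≠ side hQ o' o'.fst)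
    (fun o'' => side hR (b o') o''.fst ≠ side hR (b o') (b o').fst) fun o'' ho'' =>
    not_congr (hb.side_iff hQ hR ho' ho'')

theorem hits (hQ : Q.InternalDegreesAtLeastFour) (hR : R.InternalDegreesAtLeastFour)
    (hb : BoundaryMatch Q R b) {o o' : Q.Dart} (ho : Q.IsOuter o) (ho' : Q.IsOuter o')
    {i j : ℕ} (h : Hits o i o' j) : Hits (b o) i (b o') j := by
  obtain ⟨k, l, h'⟩ := exists_hits_of_mem_crossers hR (hb.isOuter o ho)
    ((hb.mem_crossers_iff hQ hR ho ho').2 (h.mem_crossers hQ ho ho'))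
  have h1 := hb.index_eq hQ hR ho ho' h h'
  -- Seen from the other track, the same crossing fixes the second index.
  have h2 := h'.reverse hR (hb.isOuter o ho)
  rw [hb.exit_eq hQ hR ho] at h2
  have h3 := hb.index_eq hQ hR ho' (isOuter_exit hQ o) (h.reverse hQ ho) h2
  rwa [h1, h3] at h'

/-- The boundary together with the distances between its vertices determines the quadrangulation. -/
theorem exists_iso (hQ : Q.InternalDegreesAtLeastFour) (hR : R.InternalDegreesAtLeastFour)
    (hb : BoundaryMatch Q R b) : ∃ f : Q.graph ≃g R.graph,
      (∀ o, Q.IsOuter o → f o.fst = (b o).fst) ∧ Q.IsOrientationPreserving R f := by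
  choose org horg idx hidx hidx' hcoord using exists_coordinates hQ
  set Φ : Q.Dart → R.Dart := fun d => R.step^[idx d] (b (org d)) with hΦ
  have hΦi : ∀ o i, Q.IsOuter o → 1 ≤ i → i ≤ len o → Φ (Q.step^[i] o) = R.step^[i] (b o) := by
    intro o i ho hi hi'
    obtain ⟨h1, h2⟩ := coordinates_unique (horg _) ho (hidx _) (hidx' _) hi hi'
      (hcoord (Q.step^[i] o)).symm
    rw [hΦ]
    dsimp only
    rw [h1, h2]
  -- An outer dart has the coordinates of the last dart on the track from its other end; ends and
  -- lengths correspond, so `Φ` agrees with `b`.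
  have hout : ∀ o, Q.IsOuter o → Φ o = b o := by
    intro o ho
    have h1 := hΦi (exit o) (len o) (isOuter_exit hQ o) (one_le_len hQ o) (len_exit hQ ho).ge
    have h2 : Q.step^[len o] (exit o) = o := by
      rw [← len_exit hQ ho]
      exact exit_exit hQ ho
    rw [h2] at h1
    rw [h1, ← hb.exit_eq hQ hR ho, ← hb.len_eq hQ hR ho, ← len_exit hR (hb.isOuter o ho)]
    exact exit_exit hR (hb.isOuter o ho)
  have hsymm : ∀ d, Φ d.symm = (Φ d).symm := by
    intro d
    have h1 := hidx' d
    have h2 := hidx d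
    rw [hcoord d, symm_iterate_step hQ h1, hΦi _ _ (horg d) h2 h1,
      hΦi _ _ (isOuter_exit hQ _) (by omega) (by rw [len_exit hQ (horg d)]; omega),
      symm_iterate_step hR (by rw [hb.len_eq hQ hR (horg d)]; exact h1),
      hb.len_eq hQ hR (horg d), hb.exit_eq hQ hR (horg d)]
  have hφ : ∀ d, Φ (Q.φ d) = R.φ (Φ d) := by
    intro d
    by_cases hd : Q.IsOuter d
    · rw [hout d hd, hout _ (isOuter_φ.2 hd), hb.map_φ d hd]
    · obtain ⟨o, ho, i, hi, hi', rfl⟩ := exists_coordinates hQ d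
      have hlt : i < len o := by
        rw [isOuter_iterate_iff hQ hi hi'] at hd
        omega
      obtain ⟨o', j, ho', h⟩ := exists_hits hQ hi hlt
      have h' := hb.hits hQ hR ho ho' h
      rw [h.2.2.2.2, hΦi o i ho hi hi', h'.2.2.2.2, hΦi o' j ho' h.2.2.1 h.2.2.2.1.le]
  have hbij : Function.Bijective Φ := by
    constructor
    · intro d e hde
      obtain ⟨o, ho, i, hi, hi', rfl⟩ := exists_coordinates hQ d
      obtain ⟨o', ho', j, hj, hj', rfl⟩ := exists_coordinates hQ e
      rw [hΦi o i ho hi hi', hΦi o' j ho' hj hj'] at hde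
      obtain ⟨h1, rfl⟩ := coordinates_unique (hb.isOuter o ho) (hb.isOuter o' ho') hi
        (by rwa [hb.len_eq hQ hR ho]) hj (by rwa [hb.len_eq hQ hR ho']) hde
      rw [hb.injective o o' ho ho' h1]
    · intro e
      obtain ⟨o', ho', i, hi, hi', rfl⟩ := exists_coordinates hR e
      obtain ⟨o, ho, rfl⟩ := hb.surjective o' ho'
      rw [hb.len_eq hQ hR ho] at hi'
      exact ⟨_, hΦi o i ho hi hi'⟩
  have hnext : ∀ d, Φ (Q.rot.next d) = R.rot.next (Φ d) := by
    intro d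
    have h1 : Q.rot.next d = Q.φ d.symm := by
      rw [RotationSystem.facePerm_apply, SimpleGraph.Dart.symm_symm]
    rw [h1, hφ, hsymm, RotationSystem.facePerm_apply, SimpleGraph.Dart.symm_symm]
  obtain ⟨f, hf⟩ := exists_iso_of_dart_bijective Φ hbij hsymm hnext
  refine ⟨f, fun o ho => ?_, fun d => ?_, fun d => ?_⟩
  · have := hf o
    rw [hout o ho] at this
    rw [← this]; rfl
  · rw [hf, hf, hnext]
  · rw [hf, mem_faceDarts_outer, mem_faceDarts_outer]
    constructor
    · intro hd
      rw [hout d hd]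
      exact hb.isOuter d hd
    · intro hd
      obtain ⟨o, ho, hod⟩ := hb.surjective _ hd
      rw [← hout o ho] at hod
      rwa [← hbij.1 hod]

end BoundaryMatch

end

end DiscQuadrangulation

/-! ### Mirror images of embeddings -/

namespace RotationSystem

variable {V : Type*} {G : SimpleGraph V}

/-- The rotation system of the mirror image. -/
def mirror (ρ : RotationSystem G) : RotationSystem G where
  next := ρ.next⁻¹
  sameCycle_iff d e := by rw [Equiv.Perm.sameCycle_inv, ρ.sameCycle_iff]

variable (ρ : RotationSystem G)

/-- The mirror image traverses each face backwards, along reversed darts. -/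
theorem facePerm_mirror_apply (d : G.Dart) :
    ρ.mirror.facePerm d = (ρ.facePerm⁻¹ d.symm).symm := by
  have h : ρ.facePerm (ρ.next⁻¹ d.symm).symm = d.symm := by
    rw [facePerm_apply, SimpleGraph.Dart.symm_symm]
    exact ρ.next.apply_symm_apply _
  have h' : ρ.facePerm⁻¹ d.symm = (ρ.next⁻¹ d.symm).symm := (Equiv.symm_apply_eq _).2 h.symm
  rw [h', SimpleGraph.Dart.symm_symm]
  rfl

theorem sameCycle_facePerm_mirror (d e : G.Dart) :
    ρ.mirror.facePerm.SameCycle d e ↔ ρ.facePerm.SameCycle d.symm e.symm := by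
  set s : Equiv.Perm G.Dart := SimpleGraph.Dart.symm_involutive.toPerm _ with hs
  have h : ρ.mirror.facePerm = s * ρ.facePerm⁻¹ * s⁻¹ := by
    ext1 d
    exact ρ.facePerm_mirror_apply d
  rw [h, Equiv.Perm.sameCycle_conj, Equiv.Perm.sameCycle_inv]
  rfl

/-- The faces of the mirror image. -/
def mirrorFaceEquiv : ρ.mirror.Face ≃ ρ.Face :=
  Quotient.congr (SimpleGraph.Dart.symm_involutive.toPerm _)
    fun d e => ρ.sameCycle_facePerm_mirror d e

theorem mirrorFaceEquiv_faceOf (d : G.Dart) :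
    ρ.mirrorFaceEquiv (ρ.mirror.faceOf d) = ρ.faceOf d.symm := rfl

theorem mem_faceDarts_mirror (F : ρ.mirror.Face) (d : G.Dart) :
    d ∈ ρ.mirror.faceDarts F ↔ d.symm ∈ ρ.faceDarts (ρ.mirrorFaceEquiv F) := by
  change _ = _ ↔ _ = _
  rw [← mirrorFaceEquiv_faceOf, Equiv.apply_eq_iff_eq]

theorem ncard_faceDarts_mirror (F : ρ.mirror.Face) :
    (ρ.mirror.faceDarts F).ncard = (ρ.faceDarts (ρ.mirrorFaceEquiv F)).ncard := by
  have h : ρ.mirror.faceDarts F = SimpleGraph.Dart.symm '' ρ.faceDarts (ρ.mirrorFaceEquiv F) := by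
    ext d
    rw [mem_faceDarts_mirror, SimpleGraph.Dart.symm_involutive.image_eq_preimage_symm]
    rfl
  rw [h, Set.ncard_image_of_injective _ SimpleGraph.Dart.symm_involutive.injective]

end RotationSystem

namespace DiscQuadrangulation

section

open scoped Classical

variable {V W : Type*} [Finite V] [Finite W] {Q : DiscQuadrangulation V}
  {R : DiscQuadrangulation W}

theorem φ_apply_inv (d : Q.Dart) : Q.φ (Q.φ⁻¹ d) = d := Q.φ.apply_symm_apply d

theorem φ_inv_apply (d : Q.Dart) : Q.φ⁻¹ (Q.φ d) = d := Q.φ.symm_apply_apply d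

theorem isOuter_φ_inv {d : Q.Dart} : Q.IsOuter (Q.φ⁻¹ d) ↔ Q.IsOuter d := by
  rw [← isOuter_φ, φ_apply_inv]

theorem snd_φ_inv (d : Q.Dart) : (Q.φ⁻¹ d).snd = d.fst := by
  have h := Q.rot.fst_facePerm (Q.φ⁻¹ d)
  rw [← h]
  exact congrArg (fun e : Q.Dart => e.fst) (φ_apply_inv d)

/-! ### The mirror image -/

/-- The mirror image of a disc quadrangulation. -/
def mirror (Q : DiscQuadrangulation V) : DiscQuadrangulation V where
  graph := Q.graph
  rot := Q.rot.mirror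
  connected := Q.connected
  euler := by rw [Nat.card_congr Q.rot.mirrorFaceEquiv]; exact Q.euler
  outer := Q.rot.mirrorFaceEquiv.symm Q.outer
  outer_simple := by
    intro d hd e he hde
    rw [RotationSystem.mem_faceDarts_mirror, Equiv.apply_symm_apply] at hd he
    have h := outer_fst_injective (isOuter_φ.2 hd) (isOuter_φ.2 he) (by
      rw [RotationSystem.fst_facePerm, RotationSystem.fst_facePerm]; exact hde)
    exact SimpleGraph.Dart.symm_involutive.injective (Q.φ.injective h)
  outer_length := by
    rw [RotationSystem.ncard_faceDarts_mirror, Equiv.apply_symm_apply]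
    exact Q.outer_length
  inner_length F hF := by
    rw [RotationSystem.ncard_faceDarts_mirror]
    exact Q.inner_length _ fun h => hF (by rw [← h, Equiv.symm_apply_apply])

theorem isOuter_mirror {d : Q.Dart} : Q.mirror.IsOuter d ↔ Q.IsOuter d.symm := by
  refine (Q.rot.mem_faceDarts_mirror (Q.rot.mirrorFaceEquiv.symm Q.outer) d).trans ?_
  rw [Equiv.apply_symm_apply]
  rfl

theorem mem_boundary {v : V} : v ∈ Q.boundary ↔ ∃ d, Q.IsOuter d ∧ d.fst = v := Iff.rfl

theorem boundary_mirror (Q : DiscQuadrangulation V) : Q.mirror.boundary = Q.boundary := by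
  ext v
  rw [mem_boundary, mem_boundary]
  constructor
  · rintro ⟨d, hd, rfl⟩
    exact ⟨Q.φ (SimpleGraph.Dart.symm d), isOuter_φ.2 (isOuter_mirror.1 hd),
      RotationSystem.fst_facePerm _ _⟩
  · rintro ⟨d, hd, rfl⟩
    refine ⟨(Q.φ⁻¹ d).symm, isOuter_mirror.2 ?_, snd_φ_inv d⟩
    rw [SimpleGraph.Dart.symm_symm]
    exact isOuter_φ_inv.2 hd

theorem InternalDegreesAtLeastFour.mirror (hQ : Q.InternalDegreesAtLeastFour) :
    Q.mirror.InternalDegreesAtLeastFour := by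
  intro v hv
  rw [boundary_mirror] at hv
  exact hQ v hv

/-! ### The cyclic order of the boundary -/

theorem three_le_minimalPeriod {o : Q.Dart} (ho : Q.IsOuter o) :
    3 ≤ Function.minimalPeriod Q.φ o := by
  rw [minimalPeriod_φ, ho]
  exact Q.outer_length

theorem isOuter_iterate_φ {o : Q.Dart} (ho : Q.IsOuter o) (n : ℕ) : Q.IsOuter (Q.φ^[n] o) := by
  induction n with
  | zero => exact ho
  | succ n ih => rw [Function.iterate_succ_apply']; exact isOuter_φ.2 ih

theorem exists_iterate_φ {o e : Q.Dart} (ho : Q.IsOuter o) (he : Q.IsOuter e) :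
    ∃ n < Function.minimalPeriod Q.φ o, Q.φ^[n] o = e := by
  obtain ⟨n, rfl⟩ := exists_pow_φ_of_isOuter ho he
  refine ⟨n % Function.minimalPeriod Q.φ o, Nat.mod_lt _ ?_, ?_⟩
  · have := three_le_minimalPeriod ho
    omega
  · rw [Function.iterate_mod_minimalPeriod_eq, Equiv.Perm.coe_pow]

theorem iterate_φ_injOn (o : Q.Dart) {m n : ℕ} (hm : m < Function.minimalPeriod Q.φ o)
    (hn : n < Function.minimalPeriod Q.φ o) (h : Q.φ^[m] o = Q.φ^[n] o) : m = n :=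
  (Function.iterate_injOn_Iio_minimalPeriod hm hn h)

theorem exists_change {α : Type*} (f : ℕ → α) {a b : ℕ} (hab : a ≤ b) (h : f a ≠ f b) :
    ∃ t, a ≤ t ∧ t < b ∧ f (t + 1) ≠ f t := by
  by_contra! hcon
  refine h ?_
  induction b, hab using Nat.le_induction with
  | base => rfl
  | succ b hab ih =>
    rw [hcon b hab (by omega)]
    by_contra h'
    exact h' (ih h' fun t h1 h2 => hcon t h1 (by omega))

/-- A track does not separate four points of the boundary cycle alternately. -/
theorem side_not_alternating (hQ : Q.InternalDegreesAtLeastFour) {a : Q.Dart} (ha : Q.IsOuter a)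
    {i k j : ℕ} (hik : i ≤ k) (hkj : k ≤ j)
    (hj : j < Function.minimalPeriod Q.φ a) (o : Q.Dart)
    (h1 : side hQ o (Q.φ^[0] a).fst ≠ side hQ o (Q.φ^[i] a).fst)
    (h2 : side hQ o (Q.φ^[i] a).fst ≠ side hQ o (Q.φ^[k] a).fst)
    (h3 : side hQ o (Q.φ^[k] a).fst ≠ side hQ o (Q.φ^[j] a).fst) : False := by
  -- Every change of side along the boundary occurs at an outer dart of the track. Three changes
  -- would give three of these, and a track has two.
  obtain ⟨t₁, -, l₁, c₁⟩ := exists_change (fun t => side hQ o (Q.φ^[t] a).fst) (Nat.zero_le i) h1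
  obtain ⟨t₂, g₂, l₂, c₂⟩ := exists_change (fun t => side hQ o (Q.φ^[t] a).fst) hik h2
  obtain ⟨t₃, g₃, l₃, c₃⟩ := exists_change (fun t => side hQ o (Q.φ^[t] a).fst) hkj h3
  have hmem : ∀ t, side hQ o (Q.φ^[t + 1] a).fst ≠ side hQ o (Q.φ^[t] a).fst →
      Q.φ^[t] a ∈ ends o := by
    intro t ht
    rw [Function.iterate_succ_apply', RotationSystem.fst_facePerm, Ne, side_snd_eq_iff,
      not_not] at ht
    exact mem_ends.2 ⟨isOuter_iterate_φ ha t, ht.symm⟩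
  have hsub : ({Q.φ^[t₁] a, Q.φ^[t₂] a, Q.φ^[t₃] a} : Finset Q.Dart) ⊆ ends o := by
    intro d hd
    simp only [Finset.mem_insert, Finset.mem_singleton] at hd
    rcases hd with rfl | rfl | rfl
    · exact hmem _ c₁
    · exact hmem _ c₂
    · exact hmem _ c₃
  have hcard := Finset.card_le_card hsub
  rw [card_ends hQ, Finset.card_eq_three.2 ⟨_, _, _, ?_, ?_, ?_, rfl⟩] at hcard
  · omega
  all_goals
    intro h
    have := iterate_φ_injOn a (by omega) (by omega) h
    omega

/-- The four-point inequality of a single track; summed over the tracks it bounds opposite sides of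
a boundary quadruple by its diagonals. -/
theorem ite_ne_add_ite_ne_le (a b c d : ZMod 2) (h : a ≠ b → b ≠ c → c ≠ d → False) :
    (if a ≠ b then 1 else 0) + (if c ≠ d then 1 else 0) ≤
      (if a ≠ c then 1 else 0) + (if b ≠ d then 1 else 0) ∧
    (if a ≠ d then 1 else 0) + (if b ≠ c then 1 else 0) ≤
      (if a ≠ c then 1 else 0) + (if b ≠ d then 1 else 0) := by
  revert a b c d; decide

theorem card_sep_eq_sum (hQ : Q.InternalDegreesAtLeastFour) (x y : V) :
    (sep hQ x y).card = ∑ o with Q.IsOuter o, if side hQ o x ≠ side hQ o y then 1 else 0 := by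
  rw [← Finset.card_filter, Finset.filter_filter]
  rfl

/-- Edges between boundary vertices do not cross. -/
theorem chords_not_crossing (hQ : Q.InternalDegreesAtLeastFour) {a : Q.Dart} (ha : Q.IsOuter a)
    {i k j : ℕ} (hi : 0 < i) (hik : i < k) (hkj : k < j)
    (hj : j < Function.minimalPeriod Q.φ a)
    (h1 : Q.graph.dist a.fst (Q.φ^[k] a).fst = 1)
    (h2 : Q.graph.dist (Q.φ^[i] a).fst (Q.φ^[j] a).fst = 1) : False := by
  have hpt := fun o => ite_ne_add_ite_ne_le _ _ _ _
    (side_not_alternating hQ ha hik.le hkj.le hj o)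
  have hs1 := Finset.sum_le_sum (s := Finset.univ.filter fun o => Q.IsOuter o)
    fun o _ => (hpt o).1
  have hs2 := Finset.sum_le_sum (s := Finset.univ.filter fun o => Q.IsOuter o)
    fun o _ => (hpt o).2
  have hpos : ∀ s t, s < t → t ≤ j →
      0 < Q.graph.dist (Q.φ^[s] a).fst (Q.φ^[t] a).fst := by
    intro s t hst htj
    refine Q.connected.pos_dist_of_ne fun h => ?_
    have h3 := outer_fst_injective (isOuter_iterate_φ ha s) (isOuter_iterate_φ ha t) h
    have := iterate_φ_injOn a (by omega) (by omega) h3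
    omega
  have hd : ∀ x y, ∑ o with Q.IsOuter o, (if side hQ o x ≠ side hQ o y then 1 else 0) =
      2 * Q.graph.dist x y := fun x y => by rw [← card_sep hQ, card_sep_eq_sum]
  simp only [Finset.sum_add_distrib] at hs1 hs2
  rw [hd, hd, hd, hd] at hs1 hs2
  rw [h2, show Q.graph.dist (Q.φ^[0] a).fst (Q.φ^[k] a).fst = 1 from h1] at hs1 hs2
  have p1 := hpos 0 i hi (by omega)
  have p2 := hpos k j hkj le_rfl
  have p3 := hpos 0 j (by omega) le_rfl
  have p4 := hpos i k hik (by omega)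
  -- Both diagonals have length 1, so the inequalities force all four sides to have length 1. The
  -- resulting triangle contradicts bipartiteness.
  have hadj : Q.graph.Adj (Q.φ^[i] a).fst (Q.φ^[k] a).fst :=
    SimpleGraph.dist_eq_one_iff_adj.1 (by omega)
  refine dist_ne_of_adj hadj (Q.φ^[0] a).fst ?_
  rw [show Q.graph.dist (Q.φ^[0] a).fst (Q.φ^[k] a).fst = 1 from h1]
  omega

/-- A distance preserving correspondence of the boundaries maps boundary edges to boundary edges. -/
theorem map_φ_or (hR : R.InternalDegreesAtLeastFour) {b : Q.Dart → R.Dart}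
    (hout : ∀ o, Q.IsOuter o → R.IsOuter (b o))
    (hinj : ∀ o o', Q.IsOuter o → Q.IsOuter o' → b o = b o' → o = o')
    (hsurj : ∀ o', R.IsOuter o' → ∃ o, Q.IsOuter o ∧ b o = o')
    (hdist : ∀ o o', Q.IsOuter o → Q.IsOuter o' →
      R.graph.dist (b o).fst (b o').fst = Q.graph.dist o.fst o'.fst)
    {o : Q.Dart} (ho : Q.IsOuter o) : b (Q.φ o) = R.φ (b o) ∨ R.φ (b (Q.φ o)) = b o := by
  have ha := hout o ho
  choose! m hm hm' using fun e (he : R.IsOuter e) => exists_iterate_φ ha he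
  set a := b o
  set N := Function.minimalPeriod R.φ a
  set M := Function.minimalPeriod Q.φ o
  have hM := three_le_minimalPeriod ho
  have hN := three_le_minimalPeriod ha
  have hto : ∀ t, Q.IsOuter (Q.φ^[t] o) := isOuter_iterate_φ ho
  have hadj : ∀ t, R.graph.dist (b (Q.φ^[t] o)).fst (b (Q.φ^[t + 1] o)).fst = 1 := by
    intro t
    rw [hdist _ _ (hto t) (hto _), Function.iterate_succ_apply', RotationSystem.fst_facePerm]
    exact SimpleGraph.dist_eq_one_iff_adj.2 (Q.φ^[t] o).adj
  set k := m (b (Q.φ o)) with hk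
  have hkN : k < N := hm _ (hout _ (hto 1))
  have hka : R.φ^[k] a = b (Q.φ o) := hm' _ (hout _ (hto 1))
  have hk0 : k ≠ 0 := by
    intro h
    rw [h] at hka
    have := iterate_φ_injOn o (m := 0) (n := 1) (by omega) (by omega)
      (hinj _ _ ho (hto 1) hka)
    omega
  by_cases hk1 : k = 1
  · left; rw [← hka, hk1]; rfl
  by_cases hkN1 : k + 1 = N
  · right
    rw [← hka, ← Function.iterate_succ_apply' (f := R.φ), show k.succ = N from hkN1]
    exact Function.iterate_minimalPeriod
  -- The boundary edge now goes to a proper chord from position 0 to `k`. The positions `p t` of the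
  -- images of the other boundary vertices follow edges that cannot cross it, so they all lie on one
  -- side of it.
  exfalso
  set p : ℕ → ℕ := fun t => m (b (Q.φ^[t] o)) with hp
  have hpN : ∀ t, p t < N := fun t => hm _ (hout _ (hto t))
  have hpa : ∀ t, R.φ^[p t] a = b (Q.φ^[t] o) := fun t => hm' _ (hout _ (hto t))
  have hpinj : ∀ s t, s < M → t < M → p s = p t → s = t := by
    intro s t hs ht hst
    have h1 := hpa s
    rw [hst, hpa t] at h1
    exact (iterate_φ_injOn o ht hs (hinj _ _ (hto t) (hto s) h1)).symm
  have hp0 : p 0 = 0 := by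
    refine iterate_φ_injOn a (hpN 0) (by omega) ?_
    rw [hpa 0]; rfl
  have hp1 : p 1 = k := rfl
  have hpne : ∀ t, 2 ≤ t → t < M → p t ≠ 0 ∧ p t ≠ k := by
    intro t ht htM
    refine ⟨fun h => ?_, fun h => ?_⟩
    · have := hpinj t 0 htM (by omega) (h.trans hp0.symm)
      omega
    · have := hpinj t 1 htM (by omega) (h.trans hp1.symm)
      omega
  have hchord : R.graph.dist a.fst (R.φ^[k] a).fst = 1 := by
    rw [hka]
    exact hadj 0
  have hstep : ∀ t, 2 ≤ t → t + 1 < M → (p t < k ↔ p (t + 1) < k) := by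
    intro t ht htM
    have h1 := hpne t ht (by omega)
    have h2 := hpne (t + 1) (by omega) htM
    have h3 := hadj t
    rw [← hpa t, ← hpa (t + 1)] at h3
    constructor
    · intro h
      by_contra hcon
      exact chords_not_crossing hR ha (by omega) h (by omega) (hpN (t + 1)) hchord h3
    · intro h
      by_contra hcon
      rw [SimpleGraph.dist_comm] at h3
      exact chords_not_crossing hR ha (by omega) h (by omega) (hpN t) hchord h3
  have hall : ∀ t, 2 ≤ t → t < M → (p t < k ↔ p 2 < k) := by
    intro t ht
    induction t, ht using Nat.le_induction with
    | base => exact fun _ => Iff.rfl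
    | succ t ht ih => exact fun htM => (hstep t ht htM).symm.trans (ih (by omega))
  have hex : ∀ q, q < N → q ≠ 0 → q ≠ k → ∃ t, 2 ≤ t ∧ t < M ∧ p t = q := by
    intro q hq hq0 hqk
    obtain ⟨o', ho', hoq⟩ := hsurj _ (isOuter_iterate_φ ha q)
    obtain ⟨t, ht, rfl⟩ := exists_iterate_φ ho ho'
    have hpt : p t = q := by
      refine iterate_φ_injOn a (hpN t) hq ?_
      rw [hpa t, hoq]
    refine ⟨t, ?_, ht, hpt⟩
    by_contra hcon
    rcases (show t = 0 ∨ t = 1 by omega) with rfl | rfl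
    · exact hq0 (hpt.symm.trans hp0)
    · exact hqk (hpt.symm.trans hp1)
  -- Positions 1 and `N - 1` lie on different sides of the chord, and both are attained.
  obtain ⟨t₁, ht₁, ht₁M, hpt₁⟩ := hex 1 (by omega) one_ne_zero (Ne.symm hk1)
  obtain ⟨t₂, ht₂, ht₂M, hpt₂⟩ := hex (N - 1) (by omega) (by omega) (by omega)
  have e1 := hall t₁ ht₁ ht₁M
  have e2 := hall t₂ ht₂ ht₂M
  omega

/-- A distance preserving correspondence of the boundaries preserves or reverses the cyclic
order. -/
theorem map_φ_forall_or (hR : R.InternalDegreesAtLeastFour) {b : Q.Dart → R.Dart}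
    (hout : ∀ o, Q.IsOuter o → R.IsOuter (b o))
    (hinj : ∀ o o', Q.IsOuter o → Q.IsOuter o' → b o = b o' → o = o')
    (hsurj : ∀ o', R.IsOuter o' → ∃ o, Q.IsOuter o ∧ b o = o')
    (hdist : ∀ o o', Q.IsOuter o → Q.IsOuter o' →
      R.graph.dist (b o).fst (b o').fst = Q.graph.dist o.fst o'.fst) :
    (∀ o, Q.IsOuter o → b (Q.φ o) = R.φ (b o)) ∨
      ∀ o, Q.IsOuter o → R.φ (b (Q.φ o)) = b o := by
  have hor := fun o (ho : Q.IsOuter o) => map_φ_or hR hout hinj hsurj hdist ho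
  by_cases hex : ∃ o, Q.IsOuter o ∧ b (Q.φ o) = R.φ (b o)
  · left
    obtain ⟨o, ho, h⟩ := hex
    -- A change of direction would give `φ (φ e) = e`, excluded by an outer cycle of length at least
    -- 3.
    have hstep : ∀ e, Q.IsOuter e → b (Q.φ e) = R.φ (b e) → b (Q.φ (Q.φ e)) = R.φ (b (Q.φ e)) := by
      intro e he h1
      refine (hor _ (isOuter_φ.2 he)).resolve_right fun h2 => ?_
      rw [h1] at h2
      have h3 := hinj _ _ (isOuter_φ.2 (isOuter_φ.2 he)) he (R.φ.injective h2)
      have h4 := three_le_minimalPeriod he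
      have := iterate_φ_injOn e (m := 2) (n := 0) (by omega) (by omega) h3
      omega
    intro e he
    obtain ⟨n, -, rfl⟩ := exists_iterate_φ ho he
    clear he
    induction n with
    | zero => exact h
    | succ n ih =>
      rw [Function.iterate_succ_apply']
      exact hstep _ (isOuter_iterate_φ ho n) ih
  · right
    push Not at hex
    exact fun o ho => (hor o ho).resolve_left (hex o ho)

/-- A distance preserving correspondence of the boundaries extends to an isomorphism of plane
graphs. -/
theorem exists_isPlaneIso_of_dist_eq
    (hQ : Q.InternalDegreesAtLeastFour) (hR : R.InternalDegreesAtLeastFour)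
    (β : Q.boundary ≃ R.boundary)
    (hβ : ∀ x y : Q.boundary,
      R.graph.dist (β x : W) (β y : W) = Q.graph.dist (x : V) (y : V)) :
    ∃ f : Q.graph ≃g R.graph,
      (∀ x : Q.boundary, f (x : V) = (β x : W)) ∧ Q.IsPlaneIso R f := by
  obtain ⟨r, -⟩ := R.exists_isOuter
  have : Nonempty R.Dart := ⟨r⟩
  have hmem : ∀ o, Q.IsOuter o → o.fst ∈ Q.boundary := fun o ho => ⟨o, ho, rfl⟩
  have hex : ∀ o, ∃ e : R.Dart, ∀ ho : Q.IsOuter o,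
      R.IsOuter e ∧ e.fst = (β ⟨o.fst, hmem o ho⟩ : W) := by
    intro o
    by_cases ho : Q.IsOuter o
    · obtain ⟨e, he, he'⟩ := (β ⟨o.fst, hmem o ho⟩).2
      exact ⟨e, fun _ => ⟨he, he'⟩⟩
    · exact ⟨r, fun h => absurd h ho⟩
  choose b hb using hex
  have hout : ∀ o, Q.IsOuter o → R.IsOuter (b o) := fun o ho => (hb o ho).1
  have hinj : ∀ o o', Q.IsOuter o → Q.IsOuter o' → b o = b o' → o = o' := by
    intro o o' ho ho' h
    have h1 := (hb o ho).2
    rw [h, (hb o' ho').2] at h1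
    have h2 := congrArg Subtype.val (β.injective (Subtype.ext h1))
    exact outer_fst_injective ho ho' h2.symm
  have hsurj : ∀ o', R.IsOuter o' → ∃ o, Q.IsOuter o ∧ b o = o' := by
    intro o' ho'
    obtain ⟨⟨x, hx⟩, hx'⟩ := β.surjective ⟨o'.fst, ⟨o', ho', rfl⟩⟩
    obtain ⟨o, ho, rfl⟩ := hx
    refine ⟨o, ho, outer_fst_injective (hout o ho) ho' ?_⟩
    rw [(hb o ho).2, hx']
  have hdist : ∀ o o', Q.IsOuter o → Q.IsOuter o' →
      R.graph.dist (b o).fst (b o').fst = Q.graph.dist o.fst o'.fst := by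
    intro o o' ho ho'
    rw [(hb o ho).2, (hb o' ho').2, hβ]
  rcases map_φ_forall_or hR hout hinj hsurj hdist with h | h
  · obtain ⟨f, hf, hf'⟩ := BoundaryMatch.exists_iso hQ hR ⟨hout, hinj, hsurj, h, hdist⟩
    refine ⟨f, ?_, Or.inl hf'⟩
    rintro ⟨x, o, ho, rfl⟩
    exact (hf o ho).trans (hb o ho).2
  -- In the mirror image the outer dart starting at the same vertex is the reverse of the preceding
  -- outer dart.
  · set b' : Q.Dart → R.mirror.Dart := fun o => (R.φ⁻¹ (b o)).symm with hb'
    have hfst : ∀ o, (b' o).fst = (b o).fst := fun o => snd_φ_inv (b o)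
    have hb'inj : ∀ o o', b' o = b' o' → b o = b o' := fun o o' h =>
      (R.φ⁻¹).injective (SimpleGraph.Dart.symm_involutive.injective h)
    have hmatch : BoundaryMatch Q R.mirror b' := by
      refine ⟨fun o ho => ?_, fun o o' ho ho' h => hinj o o' ho ho' (hb'inj o o' h),
        fun o' ho' => ?_, fun o ho => ?_, fun o o' ho ho' => ?_⟩
      · rw [isOuter_mirror]
        exact isOuter_φ_inv.2 (hout o ho)
      · obtain ⟨o, ho, h1⟩ := hsurj (R.φ (SimpleGraph.Dart.symm o'))
          (isOuter_φ.2 (isOuter_mirror.1 ho'))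
        refine ⟨o, ho, ?_⟩
        rw [hb']
        dsimp only
        rw [h1, φ_inv_apply]
        exact SimpleGraph.Dart.symm_symm (G := R.graph) o'
      · refine Eq.trans ?_ (R.rot.facePerm_mirror_apply (b' o)).symm
        have h1 : b (Q.φ o) = R.φ⁻¹ (b o) := by
          rw [← h o ho, φ_inv_apply]
        rw [hb']
        dsimp only
        rw [h1, SimpleGraph.Dart.symm_symm]
      · rw [hfst, hfst]
        exact hdist o o' ho ho'
    obtain ⟨f, hf, hf1, hf2⟩ := hmatch.exists_iso hQ hR.mirror
    refine ⟨f, ?_, Or.inr ⟨hf1, fun d => (hf2 d).trans isOuter_mirror⟩⟩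
    rintro ⟨x, o, ho, rfl⟩
    exact (hf o ho).trans ((hfst o).trans (hb o ho).2)

end

end DiscQuadrangulation

theorem theorem2 {V W : Type*} [Finite V] [Finite W]
    (Q : DiscQuadrangulation V) (R : DiscQuadrangulation W)
    (hQ : Q.InternalDegreesAtLeastFour) (hR : R.InternalDegreesAtLeastFour)
    (β : Q.boundary ≃ R.boundary)
    (hβ : ∀ x y : Q.boundary,
      R.graph.dist (β x : W) (β y : W) = Q.graph.dist (x : V) (y : V)) :
    ∃ f : Q.graph ≃g R.graph,
      (∀ x : Q.boundary, f (x : V) = (β x : W)) ∧ Q.IsPlaneIso R f :=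
  DiscQuadrangulation.exists_isPlaneIso_of_dist_eq hQ hR β hβ
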